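/- Let $(\mathsf Y,\mathcal Y)$ be a measurable space and let $\mathcal W$ be a set of probability measures on it. Let $\mathcal P(\mathcal W)$ be the set of probability mass functions on $\mathcal W$ with finite support, with the total variation distance $\|P_1-P_2\|=\sum_{W\in\mathcal W}|P_1(W)-P_2(W)|$. For $P\in\mathcal P(\mathcal W)$ let $\nu$ be a measure dominating all $W$ with $P(W)>0$, for instance $\nu=\sum_W P(W)W$. The order $\alpha$ mean measure $\mu_{\alpha,P}$ is the measure whose $\nu$-density is $\prod_{W:P(W)>0}(\tfrac{dW}{d\nu})^{P(W)}$ if $\alpha=0$, $(\sum_W P(W)(\tfrac{dW}{d\nu})^{\alpha})^{1/\alpha}$ if $\alpha\in(0,\infty)$, and $\max_{W:P(W)>0}\tfrac{dW}{d\nu}$ if $\alpha=\infty$; it does not depend on $\nu$. For a finite signed measure $\mu$ put $\|\mu\|=\sup_{E\in\mathcal Y}(\mu(E)-\mu(\mathsf Y\setminus E))$. Let $P(W|y)=P(W)\tfrac{dW}{d\mu_{1,P}}(y)$ be the posterior. The Rényi information of order $\alpha\in[0,\infty]$ is $$I_\alpha(P;\mathcal W)=\begin{cases}\operatorname{ess\,inf}_{\mu_{1,P}}\ln\frac{1}{\sum_W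 \mathbf 1\{P(W|y)>0\}P(W)}&\alpha=0\\[2pt] \frac{\alpha}{\alpha-1}\ln\|\mu_{\alpha,P}\|&\alpha\in(0,\infty)\setminus\{1\}\\[2pt] \int\sum_W P(W|y)\ln\frac{P(W|y)}{P(W)}\,\mu_{1,P}(dy)&\alpha=1\\[2pt] \ln\|\mu_{\infty,P}\|&\alpha=\infty\end{cases}$$ and the Rényi capacity is $C_\alpha(\mathcal W)=\sup_{P\in\mathcal P(\mathcal W)}I_\alpha(P;\mathcal W)$, an extended real number. **Lemma.** (a) For $\alpha\in(0,1)$: $C_\alpha(\mathcal W)=\infty$ iff there is a sequence $(P_n)$ in $\mathcal P(\mathcal W)$ with $\lim_n\|\mu_{\alpha,P_n}\|=0$. (b) For $\alpha\in(1,\infty]$: $C_\alpha(\mathcal W)=\infty$ iff there is a sequence $(P_n)$ in $\mathcal P(\mathcal W)$ with $\lim_n\|\mu_{\alpha,P_n}\|=\infty$. (c) For $\alpha\in(1,\infty)$: $C_\alpha(\mathcal W)<\infty$ iff $P\mapsto\mu_{\alpha,P}$ is uniformly continuous on $\mathcal P(\mathcal W)$ for the total variation topologies. (d) For $\alpha\in[1,\infty)$: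 $C_\alpha(\mathcal W)<\infty$ iff $P\mapsto I_\alpha(P;\mathcal W)$ is continuous on $\mathcal P(\mathcal W)$ for the total variation topology. For $\alpha=\infty$, continuity of $P\mapsto I_\infty(P;\mathcal W)$ on $\mathcal P(\mathcal W)$ implies $C_\infty(\mathcal W)<\infty$. (e) For $\eta\in[0,\infty)$: if $C_\eta=C_\eta(\mathcal W)<\infty$, then the family $\{I_\alpha(P;\mathcal W)\}_{\alpha\in[0,\eta]}$ is uniformly equicontinuous in $P$ on $\mathcal P(\mathcal W)$. Moreover, for all $P_1,P_2\in\mathcal P(\mathcal W)$, with $\delta=\tfrac12\|P_1-P_2\|$ and $h(\delta)=\delta\ln\tfrac1\delta+(1-\delta)\ln\tfrac1{1-\delta}$ (where $0\ln\tfrac10=0$), $$\sup_{\alpha\in[0,\eta]}|I_\alpha(P_2;\mathcal W)-I_\alpha(P_1;\mathcal W)|\le \ln(1-\delta+\delta e^{C_\eta})+\begin{cases}\ln\min\{\tfrac1{1-\delta},\tfrac{e^{C_0}}{\delta}\}&\eta=0\\ h(\delta)+\delta C_1&\eta=1\\ \tfrac{\eta}{\eta-1}\ln\big[(1-\delta)^{1/\eta}+\delta^{1/\eta}e^{\frac{\eta-1}{\eta}C_\eta}\big]&\eta\in(0,\infty)\setminus\{1\}\end{cases}$$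 (where $\tfrac{1}{0}=\infty$ and $\tfrac{e^{C_0}}{0}=\infty$). (f) For $\eta\in(0,\infty)$: if $C_\eta=C_\eta(\mathcal W)<\infty$, then on every compact subset of $(0,\eta)$ the family $\{I_\alpha(P;\mathcal W)\}_{P\in\mathcal P(\mathcal W)}$ is uniformly equicontinuous in $\alpha$, and its members are Lipschitz in $\alpha$ with a common constant. Explicitly, let $\epsilon_\eta=\tfrac\eta2$ and $\gamma_\eta=C_\eta$ if $\eta\le1$, and $\epsilon_\eta=\tfrac{\eta-1}{8\eta}$ and $\gamma_\eta=\eta C_\eta+\tfrac{5e^{2C_\eta}}{2e^2}$ if $\eta>1$. Then $|I_\alpha(P;\mathcal W)-I_\beta(P;\mathcal W)|\le\tfrac{\gamma_\eta}{\epsilon^2}|\alpha-\beta|$ for all $\epsilon\in(0,\epsilon_\eta]$, all $\alpha,\beta\in[\epsilon,\eta-\epsilon]$ and all $P\in\mathcal P(\mathcal W)$. (g) If $\mathcal W$ is finite, then $C_\alpha(\mathcal W)$ is nondecreasing and continuous in $\alpha$ on $[0,\infty]$. -/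

import Mathlib

open MeasureTheory Filter Topology Set
open scoped ENNReal NNReal

noncomputable section

namespace RenyiCapacity

variable {Y : Type*} [MeasurableSpace Y] {𝒲 : Set (ProbabilityMeasure Y)}

/-- `𝒫(𝒲)`: the probability mass functions on `𝒲` with finite support. -/
abbrev Prior (𝒲 : Set (ProbabilityMeasure Y)) : Type _ := Convexity.StdSimplex ℝ 𝒲

/-- The total variation norm `‖P₁ - P₂‖` of the difference of two priors; for a finitely supported
signed measure on the discrete space `𝒲` it is the sum of the absolute values of the masses. -/
def priorDist (P₁ P₂ : Prior 𝒲) : ℝ :=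
  (P₁.weights - P₂.weights).sum fun _ x => |x|

theorem priorDist_eq_sum (P₁ P₂ : Prior 𝒲) (s : Finset 𝒲)
    (h₁ : P₁.weights.support ⊆ s) (h₂ : P₂.weights.support ⊆ s) :
    priorDist P₁ P₂ = ∑ W ∈ s, |P₁.weights W - P₂.weights W| := by
  classical
  unfold priorDist
  rw [Finsupp.sum_of_support_subset _ (s := s) _ _ (by simp)]
  · simp
  · exact Finsupp.support_sub.trans (Finset.union_subset h₁ h₂)

/-- `𝒫(𝒲)` carries the metric given by the total variation norm. -/
instance : MetricSpace (Prior 𝒲) where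
  dist := priorDist
  dist_self P := by simp [priorDist]
  dist_comm P₁ P₂ := by
    classical
    rw [priorDist_eq_sum P₁ P₂ (P₁.weights.support ∪ P₂.weights.support)
        Finset.subset_union_left Finset.subset_union_right,
      priorDist_eq_sum P₂ P₁ (P₁.weights.support ∪ P₂.weights.support)
        Finset.subset_union_right Finset.subset_union_left]
    exact Finset.sum_congr rfl fun W _ => abs_sub_comm _ _
  dist_triangle P₁ P₂ P₃ := by
    classical
    set s := P₁.weights.support ∪ P₂.weights.support ∪ P₃.weights.support with hs
    have h₁ : P₁.weights.support ⊆ s := by grind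
    have h₂ : P₂.weights.support ⊆ s := by grind
    have h₃ : P₃.weights.support ⊆ s := by grind
    rw [priorDist_eq_sum P₁ P₃ s h₁ h₃, priorDist_eq_sum P₁ P₂ s h₁ h₂,
      priorDist_eq_sum P₂ P₃ s h₂ h₃, ← Finset.sum_add_distrib]
    exact Finset.sum_le_sum fun W _ => abs_sub_le _ _ _
  eq_of_dist_eq_zero {P₁ P₂} h := by
    classical
    change priorDist P₁ P₂ = 0 at h
    rw [priorDist_eq_sum P₁ P₂ (P₁.weights.support ∪ P₂.weights.support)
        Finset.subset_union_left Finset.subset_union_right,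
      Finset.sum_eq_zero_iff_of_nonneg fun W _ => abs_nonneg _] at h
    rw [← Convexity.StdSimplex.weights_inj]
    ext W
    by_cases hW : W ∈ P₁.weights.support ∪ P₂.weights.support
    · linarith [abs_eq_zero.1 (h W hW)]
    · simp only [Finset.mem_union, Finsupp.mem_support_iff, not_or, not_not] at hW
      rw [hW.1, hW.2]

/-- The total variation norm `‖μ - ν‖ = sup_E ((μ - ν)(E) - (μ - ν)(Eᶜ))` of the difference of two
finite measures. -/
def tvDist (μ ν : Measure Y) : ℝ :=
  ⨆ E : {E : Set Y // MeasurableSet E},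
    ((μ.real E - ν.real E) - (μ.real (E : Set Y)ᶜ - ν.real (E : Set Y)ᶜ))

/-- The order one mean measure `μ_{1,P} = ∑_W P(W) W`. Every `W` with `P(W) > 0` is absolutely
continuous with respect to it, and it serves as the reference measure below. -/
def mixture (P : Prior 𝒲) : Measure Y :=
  ∑ W ∈ P.weights.support, ENNReal.ofReal (P.weights W) • (W.1 : Measure Y)

/-- The order `α` mean of the Radon–Nikodym derivatives `dW/dμ_{1,P}` for the prior `P`. -/
def meanDensity (α : ℝ≥0∞) (P : Prior 𝒲) (y : Y) : ℝ≥0∞ :=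
  if α = 0 then
    ∏ W ∈ P.weights.support, ((W.1 : Measure Y).rnDeriv (mixture P) y) ^ (P.weights W)
  else if α = ⊤ then
    P.weights.support.sup fun W => (W.1 : Measure Y).rnDeriv (mixture P) y
  else
    (∑ W ∈ P.weights.support, ENNReal.ofReal (P.weights W) *
      ((W.1 : Measure Y).rnDeriv (mixture P) y) ^ α.toReal) ^ (1 / α.toReal)

/-- The order `α` mean measure `μ_{α,P}` for the prior `P`. It does not depend on the choice of the
reference measure. It is a non-negative measure, so `‖μ_{α,P}‖` is its total mass. -/
def meanMeasure (α : ℝ≥0∞) (P : Prior 𝒲) : Measure Y :=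
  (mixture P).withDensity (meanDensity α P)

/-- The order one posterior `P(W) dW/dμ_{1,P}(y)`. -/
def posterior (P : Prior 𝒲) (W : 𝒲) (y : Y) : ℝ :=
  P.weights W * ((W.1 : Measure Y).rnDeriv (mixture P) y).toReal

open Classical in
/-- The order `α` Rényi information `I_α(P; 𝒲)`, for `α ∈ [0, ∞]`, in nats. -/
def renyiInfo (α : ℝ≥0∞) (P : Prior 𝒲) : ℝ :=
  if α = 0 then
    essInf (fun y => Real.log (1 / ∑ W ∈ P.weights.support,
      if 0 < posterior P W y then P.weights W else 0)) (mixture P)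
  else if α = 1 then
    ∫ y, ∑ W ∈ P.weights.support,
      posterior P W y * Real.log (posterior P W y / P.weights W) ∂(mixture P)
  else if α = ⊤ then
    Real.log ((meanMeasure ⊤ P).real univ)
  else
    α.toReal / (α.toReal - 1) * Real.log ((meanMeasure α P).real univ)

/-- The order `α` Rényi capacity `C_α(𝒲) = sup_{P ∈ 𝒫(𝒲)} I_α(P; 𝒲)`, an extended real. -/
def capacity (α : ℝ≥0∞) (𝒲 : Set (ProbabilityMeasure Y)) : EReal :=
  ⨆ P : Prior 𝒲, ((renyiInfo α P : ℝ) : EReal)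

/-- The modulus of continuity in the prior for the orders in `[0, η]`, as a function of the capacity
`C` of order `η` and half the total variation distance `δ`. In the first case
`- log (max (1 - δ) (δ e^{-C})) = log (min (1 / (1 - δ)) (e^C / δ))`. -/
def priorModulus (η C δ : ℝ) : ℝ :=
  if η = 0 then
    - Real.log (max (1 - δ) (δ * Real.exp (-C))) + Real.log (1 - δ + δ * Real.exp C)
  else if η = 1 then
    Real.binEntropy δ + δ * C + Real.log (1 - δ + δ * Real.exp C)
  else
    η / (η - 1) * Real.log ((1 - δ) ^ (1 / η) + δ ^ (1 / η) * Real.exp ((η - 1) / η * C))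
      + Real.log (1 - δ + δ * Real.exp C)

/-- The largest `ε` for which the Lipschitz bound in the order is asserted on `[ε, η - ε]`. -/
def orderMargin (η : ℝ) : ℝ :=
  if η ≤ 1 then η / 2 else (η - 1) / (8 * η)

/-- The Lipschitz constant in the order on `[ε, η - ε]` is this quantity divided by `ε ^ 2`, where
`C` is the capacity of order `η`. -/
def orderConst (η C : ℝ) : ℝ :=
  if η ≤ 1 then C else η * C + 5 * Real.exp (2 * C) / (2 * Real.exp 2)

end RenyiCapacity

end

namespace RenyiCapacity

/-! ### Power means of finitely many extended non-negative numbers -/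

section PowerMean

variable {ι : Type*} (T : Finset ι) (w x : ι → ℝ≥0∞)

/-! Everything is read off from `mass a P`, the total mass of the mean measure of order a. For a ≠ 1
the information is a/(a-1) · log `mass a P`. In the variable s = 1 - 1/a the logarithm of the mass,
`logMass P s`, is convex (Hölder pointwise for power means, then Hölder for the integral:
`mass_le_rpow_mul_rpow`) and vanishes at s = 0. Hence the information is the slope of the secant of
a convex function from the origin, which makes it monotone in the order (`renyiInfo_mono`). The
orders 0, 1 and ∞ have formulas of their own and are joined to this picture by limits: a second
order expansion at 1, a decomposition into cells of constant active set at 0, and comparison of a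
power mean with the maximum at ∞.

Dependence on the prior. For P = (1-δ)S + δS', homogeneity together with sub- or superadditivity of
t ↦ t^(1/a) compares the masses of P, S and S'; Minkowski makes the a-th power of the mass convex
for a ≤ 1 (`mass_rpow_mix_le`), while for a ≥ 1 the mass is concave. Two priors at half-distance δ
strictly between 0 and 1 are both mixtures with the same part S (`exists_common_part`). Passing from
one to the other through S costs `mixModulus` on one side (`renyiInfo_mix_le`) and log(1-δ+δe^C) on
the other (`renyiInfo_sub_mix_le`). The first cost is again a secant slope, of the log-moment
generating function of a two-point law, so its value at order η dominates those at smaller orders.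
Conversely, continuity at a single prior P₀ already forces finite capacity: mixing a fixed small
fraction of an arbitrary P into P₀ stays near P₀, and its information or mass dominates a fixed
positive multiple of that of P.

Dependence on the order. Away from order one, monotonicity of the mass and convexity of `logMass`
give explicit increments. Near order one the second order expansion only bounds the distance to the
information of order one; convexity upgrades this to a Lipschitz bound
(`div_sub_div_le_of_convexOn`). All constants depend on the prior only through an upper bound for
the information of order η. For finite 𝒲 the bounds are uniform in the prior and survive the
supremum; at ∞ monotonicity and pointwise convergence suffice. -/

theorem sum_mul_rpow_mul_rpow_le (u v : ι → ℝ≥0∞) {p q : ℝ} (hp : 0 < p) (hq : 0 < q)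
    (hpq : p + q = 1) :
    ∑ i ∈ T, w i * (u i ^ p * v i ^ q) ≤ (∑ i ∈ T, w i * u i) ^ p * (∑ i ∈ T, w i * v i) ^ q := by
  have h : (1 / p).HolderConjugate (1 / q) := by
    rw [Real.holderConjugate_iff]
    refine ⟨by rw [one_div, one_lt_inv₀ hp]; linarith, by simpa using hpq⟩
  -- Each weight is split as w = w^p · w^q, one factor for each side of Hölder.
  have := ENNReal.inner_le_Lp_mul_Lq T (fun i => (w i * u i) ^ p) (fun i => (w i * v i) ^ q) h
  simp only [← ENNReal.rpow_mul, mul_one_div_cancel hp.ne', mul_one_div_cancel hq.ne',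
    ENNReal.rpow_one, one_div_one_div] at this
  refine le_trans (le_of_eq (Finset.sum_congr rfl fun i _ => ?_)) this
  rw [ENNReal.mul_rpow_of_nonneg _ _ hp.le, ENNReal.mul_rpow_of_nonneg _ _ hq.le]
  calc w i * (u i ^ p * v i ^ q) = (w i ^ p * w i ^ q) * (u i ^ p * v i ^ q) := by
        rw [← ENNReal.rpow_add_of_nonneg _ _ hp.le hq.le, hpq, ENNReal.rpow_one]
    _ = _ := by ring

/-- The weighted power mean of positive order `a`. -/
noncomputable def powerMean (a : ℝ) : ℝ≥0∞ := (∑ i ∈ T, w i * x i ^ a) ^ (1 / a)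

variable {T w x}

theorem powerMean_rpow {a : ℝ} (ha : 0 < a) : powerMean T w x a ^ a = ∑ i ∈ T, w i * x i ^ a := by
  rw [powerMean, ← ENNReal.rpow_mul, one_div_mul_cancel ha.ne', ENNReal.rpow_one]

theorem powerMean_one : powerMean T w x 1 = ∑ i ∈ T, w i * x i := by simp [powerMean]

theorem powerMean_mul (c : ℝ≥0∞) {a : ℝ} (ha : 0 < a) :
    powerMean T w (fun i => x i * c) a = powerMean T w x a * c := by
  have h : ∑ i ∈ T, w i * (x i * c) ^ a = (∑ i ∈ T, w i * x i ^ a) * c ^ a := by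
    rw [Finset.sum_mul]
    exact Finset.sum_congr rfl fun i _ => by rw [ENNReal.mul_rpow_of_nonneg _ _ ha.le, mul_assoc]
  rw [powerMean, h, ENNReal.mul_rpow_of_nonneg _ _ (by positivity), ← ENNReal.rpow_mul,
    mul_one_div_cancel ha.ne', ENNReal.rpow_one, powerMean]

theorem powerMean_mono (hw : ∑ i ∈ T, w i = 1) {a b : ℝ} (ha : 0 < a) (hab : a ≤ b) :
    powerMean T w x a ≤ powerMean T w x b := by
  have h := ENNReal.rpow_arith_mean_le_arith_mean_rpow T w (fun i => x i ^ a) hw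
    (p := b / a) ((one_le_div ha).2 hab)
  simp only [← ENNReal.rpow_mul, mul_div_cancel₀ b ha.ne'] at h
  have h2 := ENNReal.rpow_le_rpow h (z := 1 / b) (by have := ha.trans_le hab; positivity)
  rw [← ENNReal.rpow_mul] at h2
  have hb := ha.trans_le hab
  rwa [show b / a * (1 / b) = 1 / a by field_simp] at h2

/-- Log-convexity in the reciprocal order: Hölder with exponents cp/a and cq/b, which add up to one
because 1/c = p/a + q/b. -/
theorem powerMean_le_rpow_mul_rpow {a b c p q : ℝ} (ha : 0 < a) (hb : 0 < b) (hp : 0 < p)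
    (hq : 0 < q) (hpq : p + q = 1) (hc : 1 / c = p / a + q / b) :
    powerMean T w x c ≤ powerMean T w x a ^ p * powerMean T w x b ^ q := by
  have hc0 : 0 < c := one_div_pos.1 (hc ▸ by positivity)
  have h1 : c * p / a + c * q / b = 1 := by
    have : c * (1 / c) = 1 := mul_one_div_cancel hc0.ne'
    rw [hc] at this
    rw [← this]; ring
  have h := sum_mul_rpow_mul_rpow_le T w (fun i => x i ^ a) (fun i => x i ^ b)
    (p := c * p / a) (q := c * q / b) (by positivity) (by positivity) h1
  have h2 : ∀ i, (x i ^ a) ^ (c * p / a) * (x i ^ b) ^ (c * q / b) = x i ^ c := fun i => by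
    rw [← ENNReal.rpow_mul, ← ENNReal.rpow_mul, mul_div_cancel₀ _ ha.ne', mul_div_cancel₀ _ hb.ne',
      ← ENNReal.rpow_add_of_nonneg _ _ (by positivity) (by positivity), ← mul_add, hpq, mul_one]
  simp only [h2] at h
  have h3 := ENNReal.rpow_le_rpow h (z := 1 / c) (by positivity)
  rw [ENNReal.mul_rpow_of_nonneg _ _ (by positivity), ← ENNReal.rpow_mul, ← ENNReal.rpow_mul] at h3
  simp only [powerMean]
  rw [← ENNReal.rpow_mul, ← ENNReal.rpow_mul]
  convert h3 using 3 <;> field_simp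

/-- For a ≥ 1 the map t ↦ t^(1/a) is subadditive; for a ≤ 1 it is superadditive, which gives the
companion `add_powerMean_le`. -/
theorem powerMean_add_le {w₁ w₂ : ι → ℝ≥0∞} {a : ℝ} (ha : 1 ≤ a) :
    powerMean T (fun i => w₁ i + w₂ i) x a ≤ powerMean T w₁ x a + powerMean T w₂ x a := by
  simp only [powerMean, add_mul, Finset.sum_add_distrib]
  exact ENNReal.rpow_add_le_add_rpow _ _ (by positivity) (by
    rw [div_le_one (by positivity)]; exact ha)

theorem add_powerMean_le {w₁ w₂ : ι → ℝ≥0∞} {a : ℝ} (ha0 : 0 < a) (ha : a ≤ 1) :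
    powerMean T w₁ x a + powerMean T w₂ x a ≤ powerMean T (fun i => w₁ i + w₂ i) x a := by
  simp only [powerMean, add_mul, Finset.sum_add_distrib]
  exact ENNReal.add_rpow_le_rpow_add _ _ (by rw [le_div_iff₀ ha0]; linarith)

theorem powerMean_smul (c : ℝ≥0∞) {a : ℝ} (ha : 0 < a) :
    powerMean T (fun i => c * w i) x a = c ^ (1 / a) * powerMean T w x a := by
  simp only [powerMean, mul_assoc, ← Finset.mul_sum]
  exact ENNReal.mul_rpow_of_nonneg _ _ (by positivity)

theorem powerMean_mono_weight {w' : ι → ℝ≥0∞} (h : ∀ i ∈ T, w i ≤ w' i) {a : ℝ} (ha : 0 < a) :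
    powerMean T w x a ≤ powerMean T w' x a :=
  ENNReal.rpow_le_rpow (Finset.sum_le_sum fun i hi => by gcongr; exact h i hi) (by positivity)

/-- For orders at least one the power mean is concave in the weights. -/
theorem convexComb_powerMean_le {w₁ w₂ : ι → ℝ≥0∞} {a : ℝ} (ha : 1 ≤ a) {p q : ℝ≥0∞}
    (hpq : p + q = 1) :
    p * powerMean T w₁ x a + q * powerMean T w₂ x a ≤
      powerMean T (fun i => p * w₁ i + q * w₂ i) x a := by
  have ha0 : 0 < a := by linarith
  have h := ENNReal.rpow_arith_mean_le_arith_mean2_rpow p q (powerMean T w₁ x a)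
    (powerMean T w₂ x a) hpq ha
  rw [powerMean_rpow ha0, powerMean_rpow ha0] at h
  have h2 := ENNReal.rpow_le_rpow h (z := 1 / a) (by positivity)
  rw [← ENNReal.rpow_mul, mul_one_div_cancel ha0.ne', ENNReal.rpow_one] at h2
  refine h2.trans (le_of_eq ?_)
  simp only [powerMean, add_mul, Finset.sum_add_distrib, mul_assoc, ← Finset.mul_sum]

theorem powerMean_le_sup (hw : ∑ i ∈ T, w i ≤ 1) {a : ℝ} (ha : 0 < a) :
    powerMean T w x a ≤ T.sup x := by
  have h : ∑ i ∈ T, w i * x i ^ a ≤ (T.sup x) ^ a := calc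
    _ ≤ ∑ i ∈ T, w i * (T.sup x) ^ a := by
        gcongr with i hi
        exact Finset.le_sup hi
    _ = (∑ i ∈ T, w i) * (T.sup x) ^ a := by rw [Finset.sum_mul]
    _ ≤ 1 * (T.sup x) ^ a := by gcongr
    _ = _ := one_mul _
  have h2 := ENNReal.rpow_le_rpow h (z := 1 / a) (by positivity)
  rwa [← ENNReal.rpow_mul, mul_one_div_cancel ha.ne', ENNReal.rpow_one] at h2

theorem rpow_mul_sup_le_powerMean {c : ℝ≥0∞} (hc : ∀ i ∈ T, c ≤ w i) {a : ℝ} (ha : 0 < a) :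
    c ^ (1 / a) * T.sup x ≤ powerMean T w x a := by
  rcases T.eq_empty_or_nonempty with rfl | hT
  · simp
  obtain ⟨i, hi, h⟩ := Finset.exists_mem_eq_sup T hT x
  rw [h]
  calc c ^ (1 / a) * x i = (c * x i ^ a) ^ (1 / a) := by
        rw [ENNReal.mul_rpow_of_nonneg _ _ (by positivity), ← ENNReal.rpow_mul,
          mul_one_div_cancel ha.ne', ENNReal.rpow_one]
    _ ≤ (w i * x i ^ a) ^ (1 / a) := by
        gcongr
        exact hc i hi
    _ ≤ _ := ENNReal.rpow_le_rpow
        (Finset.single_le_sum (f := fun i => w i * x i ^ a) (fun _ _ => zero_le) hi) (by positivity)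

theorem sup_le_sum : T.sup x ≤ ∑ i ∈ T, x i :=
  Finset.sup_le fun _ hi => Finset.single_le_sum (f := x) (fun _ _ => zero_le) hi

end PowerMean

/-! ### The mean measure with respect to an arbitrary reference measure -/

variable {Y : Type*} [MeasurableSpace Y] {𝒲 : Set (ProbabilityMeasure Y)}

/-- The weights of a prior as extended non-negative reals. -/
noncomputable def wt (P : Prior 𝒲) (W : 𝒲) : ℝ≥0∞ := ENNReal.ofReal (P.weights W)

/-- The Radon–Nikodym derivative of a member of `𝒲`. -/
noncomputable def dens (ν : Measure Y) (y : Y) (W : 𝒲) : ℝ≥0∞ := (W.1 : Measure Y).rnDeriv ν y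

/-- The sum of finitely many members of `𝒲`. -/
noncomputable def domMeasure (T : Finset 𝒲) : Measure Y := ∑ W ∈ T, (W.1 : Measure Y)

instance (T : Finset 𝒲) : IsFiniteMeasure (domMeasure T) := by
  unfold domMeasure; infer_instance

theorem absolutelyContinuous_domMeasure {T : Finset 𝒲} {W : 𝒲} (hW : W ∈ T) :
    (W.1 : Measure Y) ≪ domMeasure T := by
  refine Measure.absolutelyContinuous_of_le (Measure.le_iff.2 fun s _ => ?_)
  rw [domMeasure, Measure.finsetSum_apply]
  exact Finset.single_le_sum (f := fun W : 𝒲 => (W.1 : Measure Y) s) (fun _ _ => zero_le) hW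

@[fun_prop]
theorem measurable_dens (ν : Measure Y) (W : 𝒲) : Measurable fun y => dens ν y W :=
  Measure.measurable_rnDeriv _ _

theorem lintegral_dens {ν : Measure Y} [SigmaFinite ν] {W : 𝒲} (h : (W.1 : Measure Y) ≪ ν) :
    ∫⁻ y, dens ν y W ∂ν = 1 := by
  have := Measure.lintegral_rnDeriv h
  simpa [dens] using this

theorem sum_weights (P : Prior 𝒲) {T : Finset 𝒲} (hT : P.weights.support ⊆ T) :
    ∑ W ∈ T, P.weights W = 1 := by
  rw [← P.total, Finsupp.sum_of_support_subset _ hT _ (by simp)]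

theorem wt_eq_zero {P : Prior 𝒲} {W : 𝒲} (h : W ∉ P.weights.support) : wt P W = 0 := by
  simp [wt, Finsupp.notMem_support_iff.1 h]

theorem wt_ne_zero {P : Prior 𝒲} {W : 𝒲} (h : W ∈ P.weights.support) : wt P W ≠ 0 := by
  have := (P.weights_nonneg W).lt_of_ne' (Finsupp.mem_support_iff.1 h)
  simpa [wt] using this

theorem wt_ne_top {P : Prior 𝒲} {W : 𝒲} : wt P W ≠ ⊤ := ENNReal.ofReal_ne_top

theorem sum_wt (P : Prior 𝒲) {T : Finset 𝒲} (hT : P.weights.support ⊆ T) :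
    ∑ W ∈ T, wt P W = 1 := by
  simp only [wt]
  rw [← ENNReal.ofReal_sum_of_nonneg fun W _ => P.weights_nonneg W, sum_weights P hT,
    ENNReal.ofReal_one]

theorem powerMean_eq_of_support_subset (P : Prior 𝒲) {T : Finset 𝒲} (hT : P.weights.support ⊆ T)
    (x : 𝒲 → ℝ≥0∞) (a : ℝ) :
    powerMean T (wt P) x a = powerMean P.weights.support (wt P) x a := by
  unfold powerMean
  rw [Finset.sum_subset hT fun W _ hW => by rw [wt_eq_zero hW, zero_mul]]

@[fun_prop]
theorem measurable_powerMean (T : Finset 𝒲) (w : 𝒲 → ℝ≥0∞) (ν : Measure Y) (a : ℝ) :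
    Measurable fun y => powerMean T w (dens ν y) a := by
  unfold powerMean; fun_prop

theorem mixture_eq (P : Prior 𝒲) :
    mixture P = ∑ W ∈ P.weights.support, wt P W • (W.1 : Measure Y) := rfl

theorem mixture_apply (P : Prior 𝒲) (s : Set Y) :
    mixture P s = ∑ W ∈ P.weights.support, wt P W * (W.1 : Measure Y) s := by
  rw [mixture_eq, Measure.finsetSum_apply]; rfl

instance (P : Prior 𝒲) : IsProbabilityMeasure (mixture P) := ⟨by
  rw [mixture_apply]
  simp [sum_wt P subset_rfl]⟩

theorem absolutelyContinuous_mixture {P : Prior 𝒲} {W : 𝒲} (hW : W ∈ P.weights.support) :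
    (W.1 : Measure Y) ≪ mixture P := by
  refine Measure.AbsolutelyContinuous.mk fun s _ h => ?_
  rw [mixture_apply, Finset.sum_eq_zero_iff] at h
  exact (mul_eq_zero.1 (h W hW)).resolve_left (wt_ne_zero hW)

theorem mixture_absolutelyContinuous {P : Prior 𝒲} {ν : Measure Y}
    (h : ∀ W ∈ P.weights.support, (W.1 : Measure Y) ≪ ν) : mixture P ≪ ν := by
  refine Measure.AbsolutelyContinuous.mk fun s _ hs => ?_
  rw [mixture_apply]
  exact Finset.sum_eq_zero fun W hW => by rw [h W hW hs, mul_zero]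

theorem dens_mul_rnDeriv {P : Prior 𝒲} {ν : Measure Y} [SigmaFinite ν] :
    ∀ᵐ y ∂ν, ∀ W ∈ P.weights.support,
      dens ν y W = dens (mixture P) y W * (mixture P).rnDeriv ν y := by
  refine (Finset.eventually_all _).2 fun W hW => ?_
  filter_upwards [Measure.rnDeriv_mul_rnDeriv (κ := ν) (absolutelyContinuous_mixture hW)] with y hy
  exact hy.symm

theorem meanDensity_eq {a : ℝ} (ha : 0 < a) (P : Prior 𝒲) (y : Y) :
    meanDensity (ENNReal.ofReal a) P y =
      powerMean P.weights.support (wt P) (dens (mixture P) y) a := by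
  have h0 : ENNReal.ofReal a ≠ 0 := by simpa using ha
  simp only [meanDensity, h0, if_false, ENNReal.ofReal_ne_top, ENNReal.toReal_ofReal ha.le]
  rfl

/-- The mean measure does not depend on the reference measure. -/
theorem meanMeasure_eq {a : ℝ} (ha : 0 < a) (P : Prior 𝒲) {T : Finset 𝒲}
    (hT : P.weights.support ⊆ T) (ν : Measure Y) [SigmaFinite ν]
    (hν : ∀ W ∈ P.weights.support, (W.1 : Measure Y) ≪ ν) :
    meanMeasure (ENNReal.ofReal a) P =
      ν.withDensity fun y => powerMean T (wt P) (dens ν y) a := by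
  have h1 : meanDensity (ENNReal.ofReal a) P =
      fun y => powerMean P.weights.support (wt P) (dens (mixture P) y) a :=
    funext fun y => meanDensity_eq ha P y
  rw [meanMeasure, h1]
  -- Chain rule dW/dν = dW/dμ · dμ/dν with μ the mixture; the power mean is homogeneous of degree
  -- one and absorbs the factor dμ/dν.
  conv_lhs => rw [← Measure.withDensity_rnDeriv_eq _ _ (mixture_absolutelyContinuous hν)]
  rw [← withDensity_mul _ (Measure.measurable_rnDeriv _ _)]
  swap
  · rw [Measure.withDensity_rnDeriv_eq _ _ (mixture_absolutelyContinuous hν)]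
    fun_prop
  refine withDensity_congr_ae ?_
  filter_upwards [dens_mul_rnDeriv (P := P) (ν := ν)] with y hy
  rw [powerMean_eq_of_support_subset P hT, Pi.mul_apply,
    Measure.withDensity_rnDeriv_eq _ _ (mixture_absolutelyContinuous hν), mul_comm,
    ← powerMean_mul _ ha]
  unfold powerMean
  congr 1
  exact Finset.sum_congr rfl fun W hW => by rw [hy W hW]

/-! ### Total mass of the mean measures. -/

/-- The total mass of the order `a` mean measure. -/
noncomputable def mass (a : ℝ) (P : Prior 𝒲) : ℝ≥0∞ := meanMeasure (ENNReal.ofReal a) P univ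

theorem mass_eq {a : ℝ} (ha : 0 < a) (P : Prior 𝒲) {T : Finset 𝒲}
    (hT : P.weights.support ⊆ T) (ν : Measure Y) [SigmaFinite ν]
    (hν : ∀ W ∈ P.weights.support, (W.1 : Measure Y) ≪ ν) :
    mass a P = ∫⁻ y, powerMean T (wt P) (dens ν y) a ∂ν := by
  rw [mass, meanMeasure_eq ha P hT ν hν, withDensity_apply _ MeasurableSet.univ, setLIntegral_univ]

theorem mass_eq_mixture {a : ℝ} (ha : 0 < a) (P : Prior 𝒲) :
    mass a P = ∫⁻ y, powerMean P.weights.support (wt P) (dens (mixture P) y) a ∂(mixture P) :=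
  mass_eq ha P subset_rfl _ fun _ => absolutelyContinuous_mixture

theorem mass_eq_domMeasure {a : ℝ} (ha : 0 < a) (P : Prior 𝒲) {T : Finset 𝒲}
    (hT : P.weights.support ⊆ T) :
    mass a P = ∫⁻ y, powerMean T (wt P) (dens (domMeasure T) y) a ∂(domMeasure T) :=
  mass_eq ha P hT _ fun _ hW => absolutelyContinuous_domMeasure (hT hW)

theorem mass_one (P : Prior 𝒲) : mass 1 P = 1 := by
  rw [mass_eq_mixture one_pos]
  simp only [powerMean_one]
  rw [lintegral_finsetSum _ (by fun_prop)]
  rw [← sum_wt P subset_rfl]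
  refine Finset.sum_congr rfl fun W hW => ?_
  rw [lintegral_const_mul _ (by fun_prop), lintegral_dens (absolutelyContinuous_mixture hW), mul_one]

theorem mass_mono {a b : ℝ} (ha : 0 < a) (hab : a ≤ b) (P : Prior 𝒲) : mass a P ≤ mass b P := by
  rw [mass_eq_mixture ha, mass_eq_mixture (ha.trans_le hab)]
  exact lintegral_mono fun y => powerMean_mono (sum_wt P subset_rfl) ha hab

/-- The total mass of the mean measure of infinite order. -/
noncomputable def massTop (P : Prior 𝒲) : ℝ≥0∞ := meanMeasure ⊤ P univ

theorem massTop_eq (P : Prior 𝒲) :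
    massTop P = ∫⁻ y, P.weights.support.sup (dens (mixture P) y) ∂(mixture P) := by
  rw [massTop, meanMeasure, withDensity_apply _ MeasurableSet.univ, setLIntegral_univ]
  simp [meanDensity]
  rfl

theorem massTop_le_card (P : Prior 𝒲) : massTop P ≤ P.weights.support.card := by
  rw [massTop_eq]
  calc _ ≤ ∫⁻ y, ∑ W ∈ P.weights.support, dens (mixture P) y W ∂(mixture P) :=
        lintegral_mono fun y => sup_le_sum
    _ = ∑ W ∈ P.weights.support, 1 := by
        rw [lintegral_finsetSum _ (by fun_prop)]
        exact Finset.sum_congr rfl fun W hW => lintegral_dens (absolutelyContinuous_mixture hW)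
    _ = _ := by simp

theorem massTop_ne_top (P : Prior 𝒲) : massTop P ≠ ⊤ :=
  ne_top_of_le_ne_top (by simp) (massTop_le_card P)

theorem mass_le_massTop {a : ℝ} (ha : 0 < a) (P : Prior 𝒲) : mass a P ≤ massTop P := by
  rw [mass_eq_mixture ha, massTop_eq]
  exact lintegral_mono fun y => powerMean_le_sup (sum_wt P subset_rfl).le ha

theorem mass_ne_top {a : ℝ} (ha : 0 < a) (P : Prior 𝒲) : mass a P ≠ ⊤ :=
  ne_top_of_le_ne_top (massTop_ne_top P) (mass_le_massTop ha P)

theorem rpow_mul_massTop_le_mass {a : ℝ} (ha : 0 < a) (P : Prior 𝒲) {c : ℝ≥0∞}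
    (hc : ∀ W ∈ P.weights.support, c ≤ wt P W) : c ^ (1 / a) * massTop P ≤ mass a P := by
  rw [mass_eq_mixture ha, massTop_eq]
  exact (lintegral_const_mul_le _ _).trans
    (lintegral_mono fun y => rpow_mul_sup_le_powerMean hc ha)

/-- The mass of the mean measure is log-convex in the reciprocal of the order. -/
theorem mass_le_rpow_mul_rpow {a b c p q : ℝ} (ha : 0 < a) (hb : 0 < b) (hp : 0 < p)
    (hq : 0 < q) (hpq : p + q = 1) (hc : 1 / c = p / a + q / b) (P : Prior 𝒲) :
    mass c P ≤ mass a P ^ p * mass b P ^ q := by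
  have hc0 : 0 < c := one_div_pos.1 (hc ▸ by positivity)
  rw [mass_eq_mixture ha, mass_eq_mixture hb, mass_eq_mixture hc0]
  exact (lintegral_mono fun y => powerMean_le_rpow_mul_rpow ha hb hp hq hpq hc).trans
    (ENNReal.lintegral_mul_norm_pow_le (measurable_powerMean _ _ _ _).aemeasurable
      (measurable_powerMean _ _ _ _).aemeasurable hp.le hq.le hpq)

theorem mass_ne_zero {a : ℝ} (ha : 0 < a) (P : Prior 𝒲) : mass a P ≠ 0 := by
  rcases le_total 1 a with h | h
  · exact (one_pos.trans_le (mass_one P ▸ mass_mono one_pos h P)).ne'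
  · intro h0
    have h1 : a ≠ 1 := by
      rintro rfl
      rw [mass_one] at h0; exact one_ne_zero h0
    have h2 : a < 1 := lt_of_le_of_ne h h1
    -- Order 1 is interpolated between a and 2; the exponents solve p + q = 1 and p/a + q/2 = 1. A
    -- vanishing mass of order a would force the mass of order 1, which is one, to vanish.
    have := mass_le_rpow_mul_rpow (a := a) (b := 2) (c := 1) (p := a / (2 - a))
      (q := (2 - 2 * a) / (2 - a)) ha two_pos (div_pos ha (by linarith))
      (div_pos (by linarith) (by linarith))
      (by rw [← add_div, div_eq_one_iff_eq (by linarith)]; ring)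
      (by field_simp [show 2 - a ≠ 0 by linarith]; ring) P
    rw [mass_one, h0, ENNReal.zero_rpow_of_pos (div_pos ha (by linarith)), zero_mul] at this
    simp at this

/-! ### Mixing two priors -/

section Mix

variable {P S S' : Prior 𝒲} {δ : ℝ}

theorem wt_mix (h0 : 0 ≤ δ) (h1 : δ ≤ 1)
    (h : ∀ W, P.weights W = (1 - δ) * S.weights W + δ * S'.weights W) (W : 𝒲) :
    wt P W = ENNReal.ofReal (1 - δ) * wt S W + ENNReal.ofReal δ * wt S' W := by
  have := S.weights_nonneg W
  have := S'.weights_nonneg W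
  simp only [wt]
  rw [h, ENNReal.ofReal_add (mul_nonneg (by linarith) (by assumption)) (by positivity),
    ENNReal.ofReal_mul (by linarith), ENNReal.ofReal_mul h0]

theorem exists_common_support (P S S' : Prior 𝒲) : ∃ T : Finset 𝒲, P.weights.support ⊆ T ∧
    S.weights.support ⊆ T ∧ S'.weights.support ⊆ T := by
  classical
  exact ⟨P.weights.support ∪ S.weights.support ∪ S'.weights.support, by grind, by grind, by grind⟩

theorem ofReal_one_sub_add (h0 : 0 ≤ δ) (h1 : δ ≤ 1) :
    ENNReal.ofReal (1 - δ) + ENNReal.ofReal δ = 1 := by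
  rw [← ENNReal.ofReal_add (by linarith) h0]; simp

theorem meanMeasure_apply {a : ℝ} (ha : 0 < a) (P : Prior 𝒲) {T : Finset 𝒲}
    (hT : P.weights.support ⊆ T) {E : Set Y} (hE : MeasurableSet E) :
    meanMeasure (ENNReal.ofReal a) P E =
      ∫⁻ y in E, powerMean T (wt P) (dens (domMeasure T) y) a ∂(domMeasure T) := by
  rw [meanMeasure_eq ha P hT _ fun _ hW => absolutelyContinuous_domMeasure (hT hW),
    withDensity_apply _ hE]

theorem meanMeasure_mix_le (h0 : 0 ≤ δ) (h1 : δ ≤ 1)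
    (h : ∀ W, P.weights W = (1 - δ) * S.weights W + δ * S'.weights W) {a : ℝ} (ha : 1 ≤ a)
    {E : Set Y} (hE : MeasurableSet E) :
    meanMeasure (ENNReal.ofReal a) P E ≤
      ENNReal.ofReal (1 - δ) ^ (1 / a) * meanMeasure (ENNReal.ofReal a) S E
      + ENNReal.ofReal δ ^ (1 / a) * meanMeasure (ENNReal.ofReal a) S' E := by
  have ha0 : 0 < a := by linarith
  obtain ⟨T, hP, hS, hS'⟩ := exists_common_support P S S'
  rw [meanMeasure_apply ha0 P hP hE, meanMeasure_apply ha0 S hS hE, meanMeasure_apply ha0 S' hS' hE,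
    funext (wt_mix h0 h1 h), ← lintegral_const_mul _ (measurable_powerMean _ _ _ _),
    ← lintegral_const_mul _ (measurable_powerMean _ _ _ _),
    ← lintegral_add_left ((measurable_powerMean _ _ _ _).const_mul _)]
  refine lintegral_mono fun y => ?_
  rw [← powerMean_smul _ ha0, ← powerMean_smul _ ha0]
  exact powerMean_add_le ha

theorem mass_mix_le (h0 : 0 ≤ δ) (h1 : δ ≤ 1)
    (h : ∀ W, P.weights W = (1 - δ) * S.weights W + δ * S'.weights W) {a : ℝ} (ha : 1 ≤ a) :
    mass a P ≤ ENNReal.ofReal (1 - δ) ^ (1 / a) * mass a S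
      + ENNReal.ofReal δ ^ (1 / a) * mass a S' :=
  meanMeasure_mix_le h0 h1 h ha MeasurableSet.univ

theorem le_mass_mix (h0 : 0 ≤ δ) (h1 : δ ≤ 1)
    (h : ∀ W, P.weights W = (1 - δ) * S.weights W + δ * S'.weights W) {a : ℝ} (ha0 : 0 < a)
    (ha : a ≤ 1) :
    ENNReal.ofReal (1 - δ) ^ (1 / a) * mass a S + ENNReal.ofReal δ ^ (1 / a) * mass a S' ≤
      mass a P := by
  obtain ⟨T, hP, hS, hS'⟩ := exists_common_support P S S'
  rw [mass_eq_domMeasure ha0 P hP, mass_eq_domMeasure ha0 S hS, mass_eq_domMeasure ha0 S' hS',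
    funext (wt_mix h0 h1 h), ← lintegral_const_mul _ (measurable_powerMean _ _ _ _),
    ← lintegral_const_mul _ (measurable_powerMean _ _ _ _),
    ← lintegral_add_left ((measurable_powerMean _ _ _ _).const_mul _)]
  refine lintegral_mono fun y => ?_
  rw [← powerMean_smul _ ha0, ← powerMean_smul _ ha0]
  exact add_powerMean_le ha0 ha

theorem convexComb_mass_le (h0 : 0 ≤ δ) (h1 : δ ≤ 1)
    (h : ∀ W, P.weights W = (1 - δ) * S.weights W + δ * S'.weights W) {a : ℝ} (ha : 1 ≤ a) :
    ENNReal.ofReal (1 - δ) * mass a S + ENNReal.ofReal δ * mass a S' ≤ mass a P := by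
  have ha0 : 0 < a := by linarith
  obtain ⟨T, hP, hS, hS'⟩ := exists_common_support P S S'
  rw [mass_eq_domMeasure ha0 P hP, mass_eq_domMeasure ha0 S hS, mass_eq_domMeasure ha0 S' hS',
    funext (wt_mix h0 h1 h), ← lintegral_const_mul _ (measurable_powerMean _ _ _ _),
    ← lintegral_const_mul _ (measurable_powerMean _ _ _ _),
    ← lintegral_add_left ((measurable_powerMean _ _ _ _).const_mul _)]
  exact lintegral_mono fun y => convexComb_powerMean_le ha (ofReal_one_sub_add h0 h1)

/-- The a-th power of the mass is the L^(1/a) norm of ∑ P(W) (dW/dν)^a, an expression linear in P.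
Since 1/a ≥ 1, Minkowski gives convexity in the prior. -/
theorem mass_rpow_mix_le (h0 : 0 ≤ δ) (h1 : δ ≤ 1)
    (h : ∀ W, P.weights W = (1 - δ) * S.weights W + δ * S'.weights W) {a : ℝ} (ha0 : 0 < a)
    (ha : a ≤ 1) :
    mass a P ^ a ≤ ENNReal.ofReal (1 - δ) * mass a S ^ a + ENNReal.ofReal δ * mass a S' ^ a := by
  obtain ⟨T, hP, hS, hS'⟩ := exists_common_support P S S'
  have key : ∀ (R : Prior 𝒲) (c : ℝ≥0∞), R.weights.support ⊆ T →
      c * mass a R ^ a = (∫⁻ y, (∑ W ∈ T, c * wt R W * dens (domMeasure T) y W ^ a) ^ (1 / a)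
        ∂(domMeasure T)) ^ a := fun R c hR => by
    have := mass_eq_domMeasure ha0 R hR
    rw [this]
    have hc : c = (c ^ (1 / a)) ^ a := by
      rw [← ENNReal.rpow_mul, one_div_mul_cancel ha0.ne', ENNReal.rpow_one]
    conv_lhs => rw [hc]
    rw [← ENNReal.mul_rpow_of_nonneg _ _ ha0.le,
      ← lintegral_const_mul _ (measurable_powerMean _ _ _ _)]
    congr 1
    refine lintegral_congr fun y => ?_
    rw [← powerMean_smul _ ha0]
    rfl
  have hP1 := key P 1 hP
  rw [one_mul] at hP1
  rw [hP1, key S _ hS, key S' _ hS']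
  have hmin := ENNReal.lintegral_Lp_add_le (μ := domMeasure T) (p := 1 / a)
    (f := fun y => ∑ W ∈ T, ENNReal.ofReal (1 - δ) * wt S W * dens (domMeasure T) y W ^ a)
    (g := fun y => ∑ W ∈ T, ENNReal.ofReal δ * wt S' W * dens (domMeasure T) y W ^ a)
    (by fun_prop) (by fun_prop) (by rw [le_div_iff₀ ha0]; linarith)
  rw [one_div_one_div] at hmin
  refine le_trans (le_of_eq ?_) hmin
  congr 1
  refine lintegral_congr fun y => ?_
  simp only [Pi.add_apply, ← Finset.sum_add_distrib, ← add_mul, one_mul, wt_mix h0 h1 h]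

/-- The prior P dominates δS' pointwise, and power means are monotone in the weights. -/
theorem rpow_mul_meanMeasure_le_mix (h0 : 0 ≤ δ) (h1 : δ ≤ 1)
    (h : ∀ W, P.weights W = (1 - δ) * S.weights W + δ * S'.weights W) {a : ℝ} (ha : 0 < a)
    {E : Set Y} (hE : MeasurableSet E) :
    ENNReal.ofReal δ ^ (1 / a) * meanMeasure (ENNReal.ofReal a) S' E ≤
      meanMeasure (ENNReal.ofReal a) P E := by
  obtain ⟨T, hP, hS, hS'⟩ := exists_common_support P S S'
  rw [meanMeasure_apply ha P hP hE, meanMeasure_apply ha S' hS' hE,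
    funext (wt_mix h0 h1 h), ← lintegral_const_mul _ (measurable_powerMean _ _ _ _)]
  refine lintegral_mono fun y => ?_
  rw [← powerMean_smul _ ha]
  exact powerMean_mono_weight (fun _ _ => le_add_self) ha

theorem rpow_mul_mass_le_mass_mix (h0 : 0 ≤ δ) (h1 : δ ≤ 1)
    (h : ∀ W, P.weights W = (1 - δ) * S.weights W + δ * S'.weights W) {a : ℝ} (ha : 0 < a) :
    ENNReal.ofReal δ ^ (1 / a) * mass a S' ≤ mass a P :=
  rpow_mul_meanMeasure_le_mix h0 h1 h ha MeasurableSet.univ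

/-! ### Convex combinations and the common part of two priors. -/

/-- A convex combination of two priors. -/
noncomputable def mix (S S' : Prior 𝒲) (δ : ℝ) (h0 : 0 ≤ δ) (h1 : δ ≤ 1) : Prior 𝒲 where
  weights := (1 - δ) • S.weights + δ • S'.weights
  nonneg W := by
    have := S.weights_nonneg W
    have := S'.weights_nonneg W
    have : 0 ≤ 1 - δ := by linarith
    simp only [Finsupp.coe_add, Finsupp.coe_smul, Pi.add_apply, Pi.smul_apply, smul_eq_mul,
      Finsupp.coe_zero, Pi.zero_apply]
    positivity
  total := by
    classical
    have hs : ((1 - δ) • S.weights + δ • S'.weights).support ⊆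
        S.weights.support ∪ S'.weights.support :=
      Finsupp.support_add.trans (Finset.union_subset_union Finsupp.support_smul Finsupp.support_smul)
    rw [Finsupp.sum_of_support_subset _ hs _ (by simp)]
    simp only [Finsupp.coe_add, Finsupp.coe_smul, Pi.add_apply, Pi.smul_apply, smul_eq_mul,
      Finset.sum_add_distrib, ← Finset.mul_sum]
    rw [sum_weights S Finset.subset_union_left, sum_weights S' Finset.subset_union_right]
    ring

theorem mix_weights (h0 : 0 ≤ δ) (h1 : δ ≤ 1) (W : 𝒲) :
    (mix S S' δ h0 h1).weights W = (1 - δ) * S.weights W + δ * S'.weights W := by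
  simp [mix]

theorem dist_eq_sum (P₁ P₂ : Prior 𝒲) {T : Finset 𝒲} (h₁ : P₁.weights.support ⊆ T)
    (h₂ : P₂.weights.support ⊆ T) :
    dist P₁ P₂ = ∑ W ∈ T, |P₁.weights W - P₂.weights W| :=
  priorDist_eq_sum P₁ P₂ T h₁ h₂

theorem dist_mix_le (h0 : 0 ≤ δ) (h1 : δ ≤ 1) : dist (mix S S' δ h0 h1) S ≤ 2 * δ := by
  obtain ⟨T, hP, hS, hS'⟩ := exists_common_support (mix S S' δ h0 h1) S S'
  rw [dist_eq_sum _ _ hP hS]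
  calc _ ≤ ∑ W ∈ T, δ * (S.weights W + S'.weights W) := Finset.sum_le_sum fun W _ => by
        rw [mix_weights, show (1 - δ) * S.weights W + δ * S'.weights W - S.weights W
          = δ * (S'.weights W - S.weights W) by ring, abs_mul, abs_of_nonneg h0]
        gcongr
        rw [abs_le]
        constructor <;> linarith [S.weights_nonneg W, S'.weights_nonneg W]
    _ = 2 * δ := by
        rw [← Finset.mul_sum, Finset.sum_add_distrib, sum_weights S hS, sum_weights S' hS']
        ring

theorem dist_le_two (P₁ P₂ : Prior 𝒲) : dist P₁ P₂ ≤ 2 := by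
  obtain ⟨T, h₁, h₂, -⟩ := exists_common_support P₁ P₂ P₂
  rw [dist_eq_sum _ _ h₁ h₂]
  calc _ ≤ ∑ W ∈ T, (P₁.weights W + P₂.weights W) := Finset.sum_le_sum fun W _ => by
        rw [abs_le]
        constructor <;> linarith [P₁.weights_nonneg W, P₂.weights_nonneg W]
    _ = 2 := by
        rw [Finset.sum_add_distrib, sum_weights P₁ h₁, sum_weights P₂ h₂]
        norm_num

/-- The normalization of a finitely supported non-negative function. -/
noncomputable def normalize (f : 𝒲 →₀ ℝ) (hf : 0 ≤ f) (c : ℝ) (hc : 0 < c)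
    (h : f.sum (fun _ r => r) = c) : Prior 𝒲 where
  weights := c⁻¹ • f
  nonneg W := by
    have := hf W
    simp only [Finsupp.coe_zero, Pi.zero_apply] at this
    simp only [Finsupp.coe_smul, Pi.smul_apply, smul_eq_mul, Finsupp.coe_zero, Pi.zero_apply]
    positivity
  total := by
    rw [Finsupp.sum_smul_index (by simp), Finsupp.sum, ← Finset.mul_sum]
    change c⁻¹ * f.sum (fun _ r => r) = 1
    rw [h, inv_mul_cancel₀ hc.ne']

/-- Two distinct priors that are not mutually singular share a common part `S`. -/
theorem exists_common_part {P₁ P₂ : Prior 𝒲} (hδ : δ = dist P₁ P₂ / 2) (h0 : 0 < δ) (h1 : δ < 1) :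
    ∃ S S₁ S₂ : Prior 𝒲,
      (∀ W, P₁.weights W = (1 - δ) * S.weights W + δ * S₁.weights W) ∧
      (∀ W, P₂.weights W = (1 - δ) * S.weights W + δ * S₂.weights W) := by
  classical
  obtain ⟨T, h₁, h₂, -⟩ := exists_common_support P₁ P₂ P₂
  have hd := dist_eq_sum _ _ h₁ h₂
  let m : 𝒲 →₀ ℝ := Finsupp.zipWith min (min_self 0) P₁.weights P₂.weights
  have hm : ∀ W, m W = min (P₁.weights W) (P₂.weights W) := fun W => rfl
  have hmT : m.support ⊆ T := fun W hW => by
    by_contra hWT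
    have e1 := Finsupp.notMem_support_iff.1 fun h => hWT (h₁ h)
    have e2 := Finsupp.notMem_support_iff.1 fun h => hWT (h₂ h)
    simp [hm, e1, e2] at hW
  have hms : ∑ W ∈ T, m W = 1 - δ := by
    -- min(x, y) = (x + y - |x - y|)/2 relates the overlap of the priors to their distance.
    have : ∀ W, m W = (P₁.weights W + P₂.weights W - |P₁.weights W - P₂.weights W|) / 2 :=
      fun W => by
        rw [hm]
        rcases le_total (P₁.weights W) (P₂.weights W) with h | h
        · rw [min_eq_left h, abs_of_nonpos (by linarith)]; ring
        · rw [min_eq_right h, abs_of_nonneg (by linarith)]; ring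
    simp only [this]
    rw [← Finset.sum_div, Finset.sum_sub_distrib, Finset.sum_add_distrib, sum_weights P₁ h₁,
      sum_weights P₂ h₂, ← hd, hδ]
    ring
  have sumT : ∀ f : 𝒲 →₀ ℝ, f.support ⊆ T → f.sum (fun _ r => r) = ∑ W ∈ T, f W := fun f hf =>
    Finsupp.sum_of_support_subset _ hf _ (by simp)
  have sub1 : (P₁.weights - m).support ⊆ T :=
    Finsupp.support_sub.trans (Finset.union_subset h₁ hmT)
  have sub2 : (P₂.weights - m).support ⊆ T :=
    Finsupp.support_sub.trans (Finset.union_subset h₂ hmT)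
  have h1' : 0 < 1 - δ := by linarith
  -- The overlap has total mass 1 - δ and each excess P - min(P₁, P₂) has total mass δ; all three
  -- are normalized.
  refine ⟨normalize m (fun W => by simp [hm]) (1 - δ) h1' (by rw [sumT _ hmT, hms]),
    normalize (P₁.weights - m) (fun W => by simp [hm]) δ h0 ?_,
    normalize (P₂.weights - m) (fun W => by simp [hm]) δ h0 ?_, fun W => ?_, fun W => ?_⟩
  · rw [sumT _ sub1]
    simp only [Finsupp.coe_sub, Pi.sub_apply, Finset.sum_sub_distrib, hms, sum_weights P₁ h₁]
    ring
  · rw [sumT _ sub2]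
    simp only [Finsupp.coe_sub, Pi.sub_apply, Finset.sum_sub_distrib, hms, sum_weights P₂ h₂]
    ring
  · simp only [normalize, Finsupp.coe_smul, Finsupp.coe_sub, Pi.smul_apply, Pi.sub_apply,
      smul_eq_mul]
    field_simp
    ring
  · simp only [normalize, Finsupp.coe_smul, Finsupp.coe_sub, Pi.smul_apply, Pi.sub_apply,
      smul_eq_mul]
    field_simp
    ring

end Mix

end RenyiCapacity

namespace RenyiCapacity

/-! ### The information of order one -/

theorem exp_sub_one_sub_le (w : ℝ) : Real.exp w - 1 - w ≤ w ^ 2 * max 1 (Real.exp w) := by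
  have h1 : Real.exp w - 1 ≤ w * Real.exp w := by
    have := Real.add_one_le_exp (-w)
    have h2 : Real.exp w * Real.exp (-w) = 1 := by rw [← Real.exp_add]; simp
    nlinarith [Real.exp_pos w]
  have h2 : w ≤ Real.exp w - 1 := by linarith [Real.add_one_le_exp w]
  rcases le_total 0 w with hw | hw
  · calc Real.exp w - 1 - w ≤ w * (Real.exp w - 1) := by linarith
      _ ≤ w * (w * Real.exp w) := by gcongr
      _ ≤ w ^ 2 * max 1 (Real.exp w) := by
        rw [← mul_assoc, ← sq]
        gcongr
        exact le_max_right _ _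
  · calc Real.exp w - 1 - w ≤ w * (Real.exp w - 1) := by linarith
      _ ≤ w * w := mul_le_mul_of_nonpos_left h2 hw
      _ ≤ w ^ 2 * max 1 (Real.exp w) := by
        rw [← sq]
        exact le_mul_of_one_le_right (sq_nonneg _) (le_max_left _ _)

/-- The inequality t ≤ e^(t-1) at t = b|z|/2, squared. -/
theorem sq_le_mul_exp_abs {b : ℝ} (hb : 0 < b) (z : ℝ) :
    z ^ 2 ≤ 4 / (Real.exp 2 * b ^ 2) * Real.exp (b * |z|) := by
  have h := Real.add_one_le_exp (b * |z| / 2 - 1)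
  have h0 : 0 ≤ b * |z| / 2 := by positivity
  have h1 : (b * |z| / 2) ^ 2 ≤ Real.exp (b * |z| / 2 - 1) ^ 2 := by
    apply pow_le_pow_left₀ h0; linarith
  rw [← Real.exp_nat_mul, div_pow, mul_pow, sq_abs] at h1
  have h2 : Real.exp (((2 : ℕ) : ℝ) * (b * |z| / 2 - 1)) = Real.exp (b * |z|) / Real.exp 2 := by
    rw [← Real.exp_sub]; congr 1; push_cast; ring
  rw [h2] at h1
  rw [div_mul_eq_mul_div, le_div_iff₀ (by positivity)]
  rw [div_le_div_iff₀ (by positivity) (by positivity)] at h1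
  linarith

/-- Second order expansion of the power function in the exponent. -/
theorem rpow_one_add_le {b r σ x : ℝ} (hb : 0 < b) (hr : |r| + b ≤ σ) (hσ : σ ≤ 1) (hx : 0 ≤ x) :
    x ^ (1 + r) ≤ x + r * (x * Real.log x)
      + 4 / (Real.exp 2 * b ^ 2) * r ^ 2 * (x ^ (1 + σ) + 1) := by
  have hr1 : |r| < 1 := by linarith
  rw [abs_lt] at hr1
  rcases hx.eq_or_lt with rfl | hx
  · rw [Real.zero_rpow (by linarith)]
    have : 0 ≤ (0 : ℝ) ^ (1 + σ) := Real.rpow_nonneg le_rfl _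
    simp only [zero_mul, mul_zero, add_zero, zero_add]
    positivity
  set z := Real.log x with hz
  have hpow : ∀ p : ℝ, x ^ (1 + p) = x * Real.exp (p * z) := fun p => by
    rw [Real.rpow_add hx, Real.rpow_one, Real.rpow_def_of_pos hx, mul_comm z]
  -- The factor z² is absorbed by e^(b|z|), leaving e^((|r|+b)|z|). For z ≥ 0 this is at most
  -- e^(σz); for z ≤ 0 it is at most e^(-z), which turns into the constant 1 after multiplication by
  -- x.
  have h1 : Real.exp (r * z) - 1 - r * z ≤
      4 / (Real.exp 2 * b ^ 2) * r ^ 2 * (Real.exp (σ * z) + Real.exp (-z)) := by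
    calc _ ≤ (r * z) ^ 2 * max 1 (Real.exp (r * z)) := exp_sub_one_sub_le _
      _ ≤ r ^ 2 * (4 / (Real.exp 2 * b ^ 2) * Real.exp (b * |z|)) * Real.exp (|r| * |z|) := by
        rw [mul_pow]
        gcongr
        · exact sq_le_mul_exp_abs hb z
        · refine max_le (Real.one_le_exp (by positivity)) (Real.exp_le_exp.2 ?_)
          rw [← abs_mul]; exact le_abs_self _
      _ = 4 / (Real.exp 2 * b ^ 2) * r ^ 2 * Real.exp ((|r| + b) * |z|) := by
        rw [add_mul, Real.exp_add]; ring
      _ ≤ _ := by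
        gcongr
        rcases le_total 0 z with h | h
        · rw [abs_of_nonneg h]
          have : Real.exp ((|r| + b) * z) ≤ Real.exp (σ * z) := by gcongr
          linarith [Real.exp_pos (-z)]
        · rw [abs_of_nonpos h]
          have : Real.exp ((|r| + b) * -z) ≤ Real.exp (-z) := by
            apply Real.exp_le_exp.2
            nlinarith
          linarith [Real.exp_pos (σ * z)]
  have h2 : x * Real.exp (-z) = 1 := by
    rw [Real.exp_neg, Real.exp_log hx, mul_inv_cancel₀ hx.ne']
  rw [hpow, hpow]
  have h3 := mul_le_mul_of_nonneg_left h1 hx.le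
  have h4 : x * (4 / (Real.exp 2 * b ^ 2) * r ^ 2 * (Real.exp (σ * z) + Real.exp (-z))) =
      4 / (Real.exp 2 * b ^ 2) * r ^ 2 * (x * Real.exp (σ * z) + 1) := by
    linear_combination (4 / (Real.exp 2 * b ^ 2) * r ^ 2) * h2
  linarith

/-! ### Densities with respect to the mixture, and their moments. -/

variable {Y : Type*} [MeasurableSpace Y] {𝒲 : Set (ProbabilityMeasure Y)} (P : Prior 𝒲)

theorem sum_wt_mul_dens_ae :
    ∀ᵐ y ∂(mixture P), ∑ W ∈ P.weights.support, wt P W * dens (mixture P) y W = 1 := by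
  have hm : Measurable fun y => ∑ W ∈ P.weights.support, wt P W * dens (mixture P) y W := by
    fun_prop
  have h : (mixture P).withDensity (fun y => ∑ W ∈ P.weights.support, wt P W * dens (mixture P) y W)
      = (mixture P).withDensity 1 := by
    rw [withDensity_one]
    ext s hs
    rw [withDensity_apply _ hs, lintegral_finsetSum _ (by fun_prop), mixture_apply]
    refine Finset.sum_congr rfl fun W hW => ?_
    rw [lintegral_const_mul _ (by fun_prop)]
    congr 1
    exact Measure.setLIntegral_rnDeriv (absolutelyContinuous_mixture hW) s
  refine (withDensity_eq_iff hm.aemeasurable aemeasurable_one ?_).1 h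
  rw [← setLIntegral_univ, ← withDensity_apply _ MeasurableSet.univ, h]
  simp

theorem dens_lt_top_ae : ∀ᵐ y ∂(mixture P), ∀ W ∈ P.weights.support, dens (mixture P) y W < ⊤ :=
  (Finset.eventually_all _).2 fun _ _ => Measure.rnDeriv_lt_top _ _

theorem weights_pos {W : 𝒲} (hW : W ∈ P.weights.support) : 0 < P.weights W :=
  (P.weights_nonneg W).lt_of_ne' (Finsupp.mem_support_iff.1 hW)

theorem toReal_wt (W : 𝒲) : (wt P W).toReal = P.weights W :=
  ENNReal.toReal_ofReal (P.weights_nonneg W)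

theorem sum_weights_mul_dens_ae :
    ∀ᵐ y ∂(mixture P),
      ∑ W ∈ P.weights.support, P.weights W * (dens (mixture P) y W).toReal = 1 := by
  filter_upwards [sum_wt_mul_dens_ae P, dens_lt_top_ae P] with y h1 h2
  have := congrArg ENNReal.toReal h1
  rw [ENNReal.toReal_sum fun W hW => ENNReal.mul_ne_top wt_ne_top (h2 W hW).ne] at this
  simpa [toReal_wt] using this

/-- The posterior sums to one, so each density is bounded. This makes all the powers and x log x
integrable without further assumptions. -/
theorem dens_toReal_le_ae :
    ∀ᵐ y ∂(mixture P), ∀ W ∈ P.weights.support,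
      (dens (mixture P) y W).toReal ≤ (P.weights W)⁻¹ := by
  filter_upwards [sum_weights_mul_dens_ae P] with y h W hW
  rw [← mul_one (P.weights W)⁻¹, ← h, le_inv_mul_iff₀ (weights_pos P hW)]
  exact Finset.single_le_sum (f := fun W => P.weights W * (dens (mixture P) y W).toReal)
    (fun W _ => mul_nonneg (P.weights_nonneg W) ENNReal.toReal_nonneg) hW

/-- The moment of order `r` of the density of a random member of `𝒲` under the joint law. -/
noncomputable def moment (r : ℝ) : ℝ :=
  ∫ y, ∑ W ∈ P.weights.support, P.weights W * (dens (mixture P) y W).toReal ^ (1 + r) ∂(mixture P)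

theorem integrable_comp_dens {φ : ℝ → ℝ} (hφ : Measurable φ)
    (hb : ∀ c, ∃ B, ∀ x, 0 ≤ x → x ≤ c → |φ x| ≤ B) {W : 𝒲} (hW : W ∈ P.weights.support) :
    Integrable (fun y => φ (dens (mixture P) y W).toReal) (mixture P) := by
  obtain ⟨B, hB⟩ := hb (P.weights W)⁻¹
  refine Integrable.of_bound (hφ.comp (measurable_dens _ W).ennreal_toReal).aestronglyMeasurable B ?_
  filter_upwards [dens_toReal_le_ae P] with y hy
  exact hB _ ENNReal.toReal_nonneg (hy W hW)

theorem integrable_rpow_dens {p : ℝ} (hp : 0 ≤ p) {W : 𝒲} (hW : W ∈ P.weights.support) :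
    Integrable (fun y => (dens (mixture P) y W).toReal ^ p) (mixture P) :=
  integrable_comp_dens P (φ := fun x => x ^ p) (by fun_prop) (fun c => ⟨c ^ p, fun x h0 hc => by
    rw [abs_of_nonneg (by positivity)]
    gcongr⟩) hW

theorem integrable_mul_log_dens {W : 𝒲} (hW : W ∈ P.weights.support) :
    Integrable (fun y => (dens (mixture P) y W).toReal * Real.log (dens (mixture P) y W).toReal)
      (mixture P) :=
  integrable_comp_dens P (φ := fun x => x * Real.log x) (by fun_prop) (fun c => by
    obtain ⟨B, hB⟩ := (isCompact_Icc (a := (0 : ℝ)) (b := c)).exists_bound_of_continuousOn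
      Real.continuous_mul_log.continuousOn
    exact ⟨B, fun x h0 hc => hB x ⟨h0, hc⟩⟩) hW

theorem integral_dens {W : 𝒲} (hW : W ∈ P.weights.support) :
    ∫ y, (dens (mixture P) y W).toReal ∂(mixture P) = 1 := by
  have := Measure.integral_toReal_rnDeriv (absolutelyContinuous_mixture hW)
  simpa [dens] using this

theorem renyiInfo_one :
    renyiInfo 1 P = ∫ y, ∑ W ∈ P.weights.support, P.weights W *
      ((dens (mixture P) y W).toReal * Real.log (dens (mixture P) y W).toReal) ∂(mixture P) := by
  simp only [renyiInfo, one_ne_zero, if_false, if_true, posterior]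
  refine integral_congr_ae (Eventually.of_forall fun y => Finset.sum_congr rfl fun W hW => ?_)
  rw [mul_div_cancel_left₀ _ (weights_pos P hW).ne', mul_assoc]
  rfl

/-- Integrated form of `rpow_one_add_le`: the linear coefficient in r is the information of order
one, and the remainder is controlled by one moment of fixed order σ. -/
theorem moment_le {b r σ : ℝ} (hb : 0 < b) (hr : |r| + b ≤ σ) (hσ : σ ≤ 1) :
    moment P r ≤ 1 + r * renyiInfo 1 P +
      4 / (Real.exp 2 * b ^ 2) * r ^ 2 * (moment P σ + 1) := by
  have hr1 : |r| < 1 := by linarith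
  have hσ0 : 0 < σ := by linarith [abs_nonneg r]
  rw [abs_lt] at hr1
  have hi1 := fun W (hW : W ∈ P.weights.support) => integrable_rpow_dens P (p := 1 + r)
    (by linarith) hW
  have hi2 := fun W (hW : W ∈ P.weights.support) => integrable_rpow_dens P (p := 1 + σ)
    (by linarith) hW
  have hi3 := fun W (hW : W ∈ P.weights.support) => integrable_mul_log_dens P hW
  have hi4 := fun W (hW : W ∈ P.weights.support) => integrable_comp_dens P (φ := id) measurable_id
    (fun c => ⟨c, fun x h0 hc => by rwa [id, abs_of_nonneg h0]⟩) hW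
  rw [renyiInfo_one, moment, moment]
  rw [integral_finsetSum _ fun W hW => (hi1 W hW).const_mul _,
    integral_finsetSum _ fun W hW => (hi2 W hW).const_mul _,
    integral_finsetSum _ fun W hW => (hi3 W hW).const_mul _]
  simp only [integral_const_mul]
  set K := 4 / (Real.exp 2 * b ^ 2) * r ^ 2
  calc _ ≤ ∑ W ∈ P.weights.support, P.weights W *
        (1 + r * (∫ y, (dens (mixture P) y W).toReal * Real.log (dens (mixture P) y W).toReal
          ∂(mixture P)) + K * ((∫ y, (dens (mixture P) y W).toReal ^ (1 + σ) ∂(mixture P)) + 1)) := by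
        refine Finset.sum_le_sum fun W hW => mul_le_mul_of_nonneg_left ?_ (P.weights_nonneg W)
        have h := integral_mono (μ := mixture P) (hi1 W hW)
          (((hi4 W hW).add ((hi3 W hW).const_mul r)).add
            (((hi2 W hW).add (integrable_const 1)).const_mul K))
          (fun _ => rpow_one_add_le hb hr hσ ENNReal.toReal_nonneg)
        refine h.trans (le_of_eq ?_)
        rw [integral_add' ((hi4 W hW).add ((hi3 W hW).const_mul r))
            (((hi2 W hW).add (integrable_const 1)).const_mul K),
          integral_add' (hi4 W hW) ((hi3 W hW).const_mul r), integral_const_mul, integral_const_mul,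
          integral_add' (hi2 W hW) (integrable_const 1)]
        simp only [id]
        rw [integral_dens P hW]
        simp
    _ = (∑ W ∈ P.weights.support, P.weights W) * (1 + K)
        + r * (∑ W ∈ P.weights.support, P.weights W *
          ∫ y, (dens (mixture P) y W).toReal * Real.log (dens (mixture P) y W).toReal ∂(mixture P))
        + K * (∑ W ∈ P.weights.support, P.weights W *
          ∫ y, (dens (mixture P) y W).toReal ^ (1 + σ) ∂(mixture P)) := by
        rw [Finset.sum_mul, Finset.mul_sum, Finset.mul_sum, ← Finset.sum_add_distrib,
          ← Finset.sum_add_distrib]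
        exact Finset.sum_congr rfl fun W _ => by ring
    _ = _ := by rw [sum_weights P subset_rfl]; ring

theorem moment_nonneg (r : ℝ) : 0 ≤ moment P r :=
  integral_nonneg fun _ => Finset.sum_nonneg fun W _ =>
    mul_nonneg (P.weights_nonneg W) (Real.rpow_nonneg ENNReal.toReal_nonneg _)

theorem ofReal_moment {r : ℝ} (hr : 0 ≤ 1 + r) :
    ENNReal.ofReal (moment P r) =
      ∫⁻ y, ∑ W ∈ P.weights.support, wt P W * dens (mixture P) y W ^ (1 + r) ∂(mixture P) := by
  rw [moment, ofReal_integral_eq_lintegral_ofReal]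
  · refine lintegral_congr_ae ?_
    filter_upwards [dens_lt_top_ae P] with y hy
    rw [ENNReal.ofReal_sum_of_nonneg fun W _ =>
      mul_nonneg (P.weights_nonneg W) (Real.rpow_nonneg ENNReal.toReal_nonneg _)]
    refine Finset.sum_congr rfl fun W hW => ?_
    rw [ENNReal.ofReal_mul (P.weights_nonneg W), ← ENNReal.ofReal_rpow_of_nonneg
      ENNReal.toReal_nonneg hr, ENNReal.ofReal_toReal (hy W hW).ne]
    rfl
  · exact integrable_finsetSum _ fun W hW => (integrable_rpow_dens P hr hW).const_mul _
  · exact Eventually.of_forall fun y => Finset.sum_nonneg fun W _ =>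
      mul_nonneg (P.weights_nonneg W) (Real.rpow_nonneg ENNReal.toReal_nonneg _)

/-- Write x^(2-1/η) = x^(1-1/η) · (x^η)^(1/η) and apply Hölder; the first factor disappears because
∑ P(W) x = 1 almost everywhere. -/
theorem moment_le_mass {η : ℝ} (hη : 1 < η) : moment P (1 - 1 / η) ≤ (mass η P).toReal := by
  have hη0 : 0 < η := by linarith
  have h1 : 1 / η < 1 := by rw [div_lt_one hη0]; exact hη
  rw [← ENNReal.ofReal_le_iff_le_toReal (mass_ne_top hη0 P),
    ofReal_moment P (by linarith), mass_eq_mixture hη0]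
  refine lintegral_mono_ae ?_
  filter_upwards [sum_wt_mul_dens_ae P] with y hy
  have := sum_mul_rpow_mul_rpow_le P.weights.support (wt P) (dens (mixture P) y)
    (fun W => dens (mixture P) y W ^ η) (p := 1 - 1 / η) (q := 1 / η) (by linarith)
    (by positivity) (by ring)
  rw [hy, ENNReal.one_rpow, one_mul] at this
  refine le_trans (le_of_eq (Finset.sum_congr rfl fun W _ => ?_)) this
  rw [← ENNReal.rpow_mul, mul_one_div_cancel hη0.ne',
    ← ENNReal.rpow_add_of_nonneg _ _ (by linarith) zero_le_one, add_comm]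

/-- Concavity of t ↦ t^(1/a) under the probability measure `mixture P`, in the form of Hölder
against the constant 1. -/
theorem mass_le_moment_rpow {a : ℝ} (ha : 1 < a) :
    (mass a P).toReal ≤ moment P (a - 1) ^ (1 / a) := by
  have ha0 : 0 < a := by linarith
  have h1 : 1 / a < 1 := by rw [div_lt_one ha0]; exact ha
  refine ENNReal.toReal_le_of_le_ofReal (Real.rpow_nonneg (moment_nonneg P _) _) ?_
  rw [← ENNReal.ofReal_rpow_of_nonneg (moment_nonneg P _) (by positivity),
    ofReal_moment P (by linarith), mass_eq_mixture ha0]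
  have := ENNReal.lintegral_mul_norm_pow_le (μ := mixture P)
    (f := fun y => ∑ W ∈ P.weights.support, wt P W * dens (mixture P) y W ^ (1 + (a - 1)))
    (g := fun _ => 1) (p := 1 / a) (q := 1 - 1 / a) (by fun_prop) (by fun_prop) (by positivity)
    (by linarith) (by ring)
  simp only [ENNReal.one_rpow, mul_one, lintegral_const, measure_univ, add_sub_cancel] at this ⊢
  exact this

/-- Write x^a = x^(1-a) · (x^(2-1/a))^a, apply Hölder and use ∑ P(W) x = 1. The restriction a ≥ 1/2
keeps the exponent 2 - 1/a nonnegative. -/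
theorem mass_le_moment {a : ℝ} (ha : 1 / 2 ≤ a) (ha1 : a < 1) :
    (mass a P).toReal ≤ moment P (1 - 1 / a) := by
  have ha0 : 0 < a := by linarith
  have h1 : 1 / a ≤ 2 := by rw [div_le_iff₀ ha0]; linarith
  refine ENNReal.toReal_le_of_le_ofReal (moment_nonneg P _) ?_
  rw [ofReal_moment P (by linarith), mass_eq_mixture ha0]
  refine lintegral_mono_ae ?_
  filter_upwards [sum_wt_mul_dens_ae P] with y hy
  have := sum_mul_rpow_mul_rpow_le P.weights.support (wt P) (dens (mixture P) y)
    (fun W => dens (mixture P) y W ^ (1 + (1 - 1 / a))) (p := 1 - a) (q := a) (by linarith)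
    ha0 (by ring)
  rw [hy, ENNReal.one_rpow, one_mul] at this
  have h2 := ENNReal.rpow_le_rpow this (z := 1 / a) (by positivity)
  rw [← ENNReal.rpow_mul, mul_one_div_cancel ha0.ne', ENNReal.rpow_one] at h2
  refine le_trans (le_of_eq ?_) h2
  unfold powerMean
  congr 1
  refine Finset.sum_congr rfl fun W _ => ?_
  rw [← ENNReal.rpow_mul, ← ENNReal.rpow_add_of_nonneg _ _ (by linarith)
    (mul_nonneg (by linarith) ha0.le)]
  congr 2
  field_simp
  ring

theorem mass_toReal_pos {a : ℝ} (ha : 0 < a) : 0 < (mass a P).toReal :=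
  ENNReal.toReal_pos (mass_ne_zero ha P) (mass_ne_top ha P)

theorem renyiInfo_ofReal {a : ℝ} (ha : 0 < a) (ha1 : a ≠ 1) :
    renyiInfo (ENNReal.ofReal a) P = a / (a - 1) * Real.log (mass a P).toReal := by
  have h0 : ENNReal.ofReal a ≠ 0 := by simpa using ha
  have h1 : ENNReal.ofReal a ≠ 1 := by simpa using ha1
  simp only [renyiInfo, h0, h1, if_false, ENNReal.ofReal_ne_top, ENNReal.toReal_ofReal ha.le]
  rfl

/-- By `mass_le_moment_rpow` and log t ≤ t - 1 the left side is at most (m - 1)/(a - 1), m being the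
moment of order a - 1, and `moment_le` applies. Besides the information of order one, the prior
enters only through the mass of order η, which makes the bound uniform under finite capacity. -/
theorem renyiInfo_le_one_add {a b η : ℝ} (hη : 1 < η) (hb : 0 < b) (ha : 1 < a)
    (hab : (a - 1) + b ≤ 1 - 1 / η) :
    renyiInfo (ENNReal.ofReal a) P ≤ renyiInfo 1 P +
      4 / (Real.exp 2 * b ^ 2) * ((mass η P).toReal + 1) * (a - 1) := by
  have ha0 : 0 < a := by linarith
  have hη0 : 0 < 1 / η := by positivity
  rw [renyiInfo_ofReal P ha0 ha.ne']
  have hM := mass_toReal_pos P ha0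
  have h1 := mass_le_moment_rpow P ha
  have hmpos : 0 < moment P (a - 1) := by
    rcases (moment_nonneg P (a - 1)).eq_or_lt with h | h
    · rw [← h, Real.zero_rpow (by positivity)] at h1
      linarith
    · exact h
  have h2 : Real.log (mass a P).toReal ≤ 1 / a * (moment P (a - 1) - 1) := by
    calc _ ≤ Real.log (moment P (a - 1) ^ (1 / a)) := Real.log_le_log hM h1
      _ = 1 / a * Real.log (moment P (a - 1)) := Real.log_rpow hmpos _
      _ ≤ _ := by gcongr; exact Real.log_le_sub_one_of_pos hmpos
  have h3 := moment_le P (r := a - 1) (σ := 1 - 1 / η) hb (by rwa [abs_of_pos (by linarith)])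
    (by linarith)
  have h4 := moment_le_mass P hη
  have ht : 0 < a - 1 := by linarith
  calc _ ≤ a / (a - 1) * (1 / a * (moment P (a - 1) - 1)) := by gcongr
    _ = (moment P (a - 1) - 1) / (a - 1) := by field_simp
    _ ≤ ((a - 1) * renyiInfo 1 P + 4 / (Real.exp 2 * b ^ 2) * (a - 1) ^ 2 *
        ((mass η P).toReal + 1)) / (a - 1) := by
        gcongr
        have : 4 / (Real.exp 2 * b ^ 2) * (a - 1) ^ 2 * (moment P (1 - 1 / η) + 1) ≤
          4 / (Real.exp 2 * b ^ 2) * (a - 1) ^ 2 * ((mass η P).toReal + 1) := by gcongr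
        linarith
    _ = _ := by field_simp

/-- Mirror image below order one, in the variable t = 1/a - 1, for which a/(a-1) = -1/t. -/
theorem renyiInfo_one_add_le {a b η : ℝ} (hη : 1 < η) (hb : 0 < b) (ha : 1 / 2 ≤ a) (ha1 : a < 1)
    (hab : (1 / a - 1) + b ≤ 1 - 1 / η) :
    renyiInfo 1 P - 4 / (Real.exp 2 * b ^ 2) * ((mass η P).toReal + 1) * (1 / a - 1) ≤
      renyiInfo (ENNReal.ofReal a) P := by
  have ha0 : 0 < a := by linarith
  have hη0 : 0 < 1 / η := by positivity
  rw [renyiInfo_ofReal P ha0 ha1.ne]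
  have hM := mass_toReal_pos P ha0
  have h1 := mass_le_moment P ha ha1
  have hs : 0 < 1 / a - 1 := by rw [sub_pos, lt_div_iff₀ ha0]; linarith
  set t := 1 / a - 1 with ht
  have h2 : Real.log (mass a P).toReal ≤ moment P (1 - 1 / a) - 1 :=
    (Real.log_le_log hM h1).trans (Real.log_le_sub_one_of_pos (hM.trans_le h1))
  have h3 := moment_le P (r := 1 - 1 / a) (σ := 1 - 1 / η) hb
    (by rwa [show 1 - 1 / a = -t by rw [ht]; ring, abs_neg, abs_of_pos hs]) (by linarith)
  have h4 := moment_le_mass P hη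
  have h5 : a / (a - 1) = -(1 / t) := by
    have : a - 1 ≠ 0 := by linarith
    have : 1 - a ≠ 0 := by linarith
    rw [ht]; field_simp; ring
  rw [h5]
  have h6 : Real.log (mass a P).toReal ≤ -t * renyiInfo 1 P + 4 / (Real.exp 2 * b ^ 2) * t ^ 2 *
        ((mass η P).toReal + 1) := by
    have : 4 / (Real.exp 2 * b ^ 2) * t ^ 2 * (moment P (1 - 1 / η) + 1) ≤
      4 / (Real.exp 2 * b ^ 2) * t ^ 2 * ((mass η P).toReal + 1) := by gcongr
    rw [show 1 - 1 / a = -t by rw [ht]; ring] at h3 h2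
    rw [neg_sq] at h3
    linarith
  rw [neg_mul, le_neg, one_div, inv_mul_le_iff₀ hs]
  linarith

end RenyiCapacity

namespace RenyiCapacity

/-! ### The information of order zero -/

variable {Y : Type*} [MeasurableSpace Y] {𝒲 : Set (ProbabilityMeasure Y)}

/-- The prior probability of the members of `𝒲` with positive posterior probability. -/
noncomputable def activeWeight (P : Prior 𝒲) (y : Y) : ℝ :=
  ∑ W ∈ P.weights.support with 0 < posterior P W y, P.weights W

theorem renyiInfo_zero (P : Prior 𝒲) :
    renyiInfo 0 P = essInf (fun y => Real.log (1 / activeWeight P y)) (mixture P) := by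
  simp only [renyiInfo, if_true, activeWeight, Finset.sum_filter]

/-- Only finitely many subsets of the support can be active. The bound is needed for the real-valued
essential infimum to behave as an infimum. -/
theorem abs_log_activeWeight_le (P : Prior 𝒲) :
    ∃ B, ∀ y, |Real.log (1 / activeWeight P y)| ≤ B := by
  classical
  refine ⟨∑ A ∈ P.weights.support.powerset, |Real.log (1 / ∑ W ∈ A, P.weights W)|, fun y => ?_⟩
  exact Finset.single_le_sum (f := fun A => |Real.log (1 / ∑ W ∈ A, P.weights W)|)
    (fun _ _ => abs_nonneg _) (Finset.mem_powerset.2 (Finset.filter_subset _ _))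

theorem renyiInfo_zero_le_ae (P : Prior 𝒲) :
    ∀ᵐ y ∂(mixture P), renyiInfo 0 P ≤ Real.log (1 / activeWeight P y) := by
  obtain ⟨B, hB⟩ := abs_log_activeWeight_le P
  rw [renyiInfo_zero]
  exact ae_essInf_le ⟨-B, eventually_map.2 (Eventually.of_forall fun y => (abs_le.1 (hB y)).1)⟩

theorem frequently_lt_renyiInfo_zero_add (P : Prior 𝒲) {κ : ℝ} (hκ : 0 < κ) :
    ∃ᶠ y in ae (mixture P), Real.log (1 / activeWeight P y) < renyiInfo 0 P + κ := by
  obtain ⟨B, hB⟩ := abs_log_activeWeight_le P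
  rw [renyiInfo_zero]
  refine frequently_lt_of_liminf_lt ?_ (lt_add_of_pos_right _ hκ)
  exact IsBoundedUnder.isCoboundedUnder_ge
    ⟨B, eventually_map.2 (Eventually.of_forall fun y => (abs_le.1 (hB y)).2)⟩

theorem posterior_pos_iff {P : Prior 𝒲} {W : 𝒲} (hW : W ∈ P.weights.support) {y : Y}
    (h : dens (mixture P) y W < ⊤) : 0 < posterior P W y ↔ dens (mixture P) y W ≠ 0 := by
  rw [posterior, mul_pos_iff_of_pos_left (weights_pos P hW), ENNReal.toReal_pos_iff,
    pos_iff_ne_zero]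
  exact and_iff_left h

theorem activeWeight_pos_ae (P : Prior 𝒲) : ∀ᵐ y ∂(mixture P), 0 < activeWeight P y := by
  filter_upwards [sum_weights_mul_dens_ae P] with y hy
  have h : ∃ W ∈ P.weights.support, 0 < posterior P W y := by
    by_contra! hcon
    have : ∑ W ∈ P.weights.support, P.weights W * (dens (mixture P) y W).toReal ≤ 0 :=
      Finset.sum_nonpos hcon
    linarith
  obtain ⟨W, hW, hpos⟩ := h
  exact Finset.sum_pos (fun W hW => weights_pos P (Finset.mem_filter.1 hW).1)
    ⟨W, Finset.mem_filter.2 ⟨hW, hpos⟩⟩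

/-- Hölder against the indicator of positive posterior, with ∑ P(W) x = 1 almost everywhere. -/
theorem powerMean_le_activeWeight_ae (P : Prior 𝒲) {a : ℝ} (ha : 0 < a) (ha1 : a < 1) :
    ∀ᵐ y ∂(mixture P), powerMean P.weights.support (wt P) (dens (mixture P) y) a ≤
      ENNReal.ofReal (activeWeight P y) ^ ((1 - a) / a) := by
  classical
  filter_upwards [sum_wt_mul_dens_ae P, dens_lt_top_ae P] with y hy hlt
  have h := sum_mul_rpow_mul_rpow_le P.weights.support (wt P) (dens (mixture P) y)
    (fun W => if 0 < posterior P W y then 1 else 0) (p := a) (q := 1 - a) ha (by linarith) (by ring)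
  rw [hy, ENNReal.one_rpow, one_mul] at h
  have h1 : ∑ W ∈ P.weights.support, wt P W * (if 0 < posterior P W y then 1 else 0) =
      ENNReal.ofReal (activeWeight P y) := by
    rw [activeWeight, ENNReal.ofReal_sum_of_nonneg fun W _ => P.weights_nonneg W, Finset.sum_filter]
    refine Finset.sum_congr rfl fun W _ => ?_
    split_ifs <;> simp [wt]
  rw [h1] at h
  have h2 : ∑ W ∈ P.weights.support, wt P W * dens (mixture P) y W ^ a ≤
      ENNReal.ofReal (activeWeight P y) ^ (1 - a) := by
    refine le_trans (Finset.sum_le_sum fun W hW => ?_) h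
    split_ifs with hp
    · simp
    · have : dens (mixture P) y W = 0 := by
        by_contra h0
        exact hp ((posterior_pos_iff hW (hlt W hW)).2 h0)
      rw [this, ENNReal.zero_rpow_of_pos ha, mul_zero]
      exact zero_le
  have h3 := ENNReal.rpow_le_rpow h2 (z := 1 / a) (by positivity)
  rwa [← ENNReal.rpow_mul, mul_one_div] at h3

theorem renyiInfo_zero_le (P : Prior 𝒲) {a : ℝ} (ha : 0 < a) (ha1 : a < 1) :
    renyiInfo 0 P ≤ renyiInfo (ENNReal.ofReal a) P := by
  have hm : mass a P ≤ ENNReal.ofReal (Real.exp (-((1 - a) / a * renyiInfo 0 P))) := by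
    rw [mass_eq_mixture ha]
    calc _ ≤ ∫⁻ _, ENNReal.ofReal (Real.exp (-((1 - a) / a * renyiInfo 0 P))) ∂(mixture P) := by
          refine lintegral_mono_ae ?_
          filter_upwards [powerMean_le_activeWeight_ae P ha ha1, renyiInfo_zero_le_ae P,
            activeWeight_pos_ae P] with y h1 h2 h3
          refine h1.trans ?_
          rw [ENNReal.ofReal_rpow_of_pos h3]
          refine ENNReal.ofReal_le_ofReal ?_
          rw [Real.rpow_def_of_pos h3]
          refine Real.exp_le_exp.2 ?_
          rw [one_div, Real.log_inv] at h2
          have : 0 ≤ (1 - a) / a := div_nonneg (by linarith) ha.le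
          nlinarith
      _ = _ := by simp
  have h1 := ENNReal.toReal_mono ENNReal.ofReal_ne_top hm
  rw [ENNReal.toReal_ofReal (Real.exp_pos _).le] at h1
  have h2 := Real.log_le_log (mass_toReal_pos P ha) h1
  rw [Real.log_exp] at h2
  rw [renyiInfo_ofReal P ha ha1.ne]
  have h3 : 0 < 1 - a := by linarith
  have h4 := mul_le_mul_of_nonneg_left h2 (div_nonneg ha.le h3.le)
  have h5 : a / (a - 1) = -(a / (1 - a)) := by rw [← div_neg, neg_sub]
  rw [h5]
  have h6 : a / (1 - a) * -((1 - a) / a * renyiInfo 0 P) = -renyiInfo 0 P := by field_simp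
  linarith

/-! ### Cells of constant active set, and the limit of small orders. -/

/-- The members of a finite set whose density is positive at a given point. -/
noncomputable def active (T : Finset 𝒲) (y : Y) : Finset 𝒲 :=
  {W ∈ T | dens (domMeasure T) y W ≠ 0}

theorem measurableSet_active (T A : Finset 𝒲) : MeasurableSet {y : Y | active T y = A} := by
  classical
  by_cases hA : A ⊆ T
  · have : {y : Y | active T y = A} = ⋂ W ∈ T, {y | dens (domMeasure T) y W ≠ 0 ↔ W ∈ A} := by
      ext y
      simp only [Set.mem_ofPred_eq, Finset.ext_iff, active, Finset.mem_filter, Set.mem_iInter]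
      refine ⟨fun h W hW => by simpa [hW] using h W, fun h W => ?_⟩
      by_cases hW : W ∈ T
      · simpa [hW] using h W hW
      · simpa [hW] using fun h => hW (hA h)
    rw [this]
    refine Finset.measurableSet_biInter _ fun W _ => ?_
    have hm : MeasurableSet {y : Y | dens (domMeasure T) y W = 0} :=
      measurable_dens _ W (measurableSet_singleton 0)
    by_cases hW : W ∈ A
    · simp only [hW, iff_true]
      exact hm.compl
    · simpa [hW] using hm
  · convert MeasurableSet.empty
    ext y
    simp only [Set.mem_ofPred_eq, Set.mem_empty_iff_false, iff_false]
    rintro rfl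
    exact hA (Finset.filter_subset _ _)

/-- The integral of a positive lower bound for the active densities on one cell. -/
noncomputable def cellMass (T A : Finset 𝒲) : ℝ≥0∞ :=
  ∫⁻ y in {y | active T y = A}, ∏ W ∈ A, min 1 (dens (domMeasure T) y W) ∂(domMeasure T)

theorem cellMass_ne_zero {T A : Finset 𝒲} (h : domMeasure T {y | active T y = A} ≠ 0) :
    cellMass T A ≠ 0 := by
  intro h0
  have hm : Measurable fun y : Y => ∏ W ∈ A, min 1 (dens (domMeasure T) y W) :=
    Finset.measurable_prod _ fun W _ => measurable_const.min (measurable_dens _ W)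
  rw [cellMass, lintegral_eq_zero_iff hm, EventuallyEq,
    ae_restrict_iff' (measurableSet_active T A)] at h0
  refine h (measure_mono_null (fun y hy => ?_) h0)
  simp only [Set.mem_compl_iff, Set.mem_ofPred_eq, Classical.not_imp] at hy ⊢
  refine ⟨hy, ?_⟩
  rw [Pi.zero_apply, Finset.prod_eq_zero_iff]
  rintro ⟨W, hW, h1⟩
  rw [← hy] at hW
  have := (Finset.mem_filter.1 hW).2
  rcases min_choice 1 (dens (domMeasure T) y W) with h2 | h2 <;> rw [h2] at h1
  · exact one_ne_zero h1
  · exact this h1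

/-- On the cell every density in A is at least the product of the densities truncated at one. The
resulting factor `cellMass T A` depends neither on the prior nor on the order, which is what makes
later bounds uniform. -/
theorem le_mass_of_cell {T : Finset 𝒲} {P : Prior 𝒲} (hT : P.weights.support ⊆ T) {A : Finset 𝒲}
    (hA : A ⊆ T) {a : ℝ} (ha : 0 < a) :
    (∑ W ∈ A, wt P W) ^ (1 / a) * cellMass T A ≤ mass a P := by
  rw [mass_eq_domMeasure ha P hT, cellMass]
  refine (lintegral_const_mul_le _ _).trans (le_trans ?_ (setLIntegral_le_lintegral
    {y | active T y = A} _))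
  refine lintegral_mono fun y => ?_
  have h1 : ∀ W ∈ A, ∏ W ∈ A, min 1 (dens (domMeasure T) y W) ≤ dens (domMeasure T) y W :=
    fun W hW => by
      classical
      rw [← Finset.mul_prod_erase _ _ hW]
      calc _ ≤ dens (domMeasure T) y W * 1 := by
            gcongr
            · exact min_le_right _ _
            · exact Finset.prod_le_one' fun _ _ => min_le_left _ _
        _ = _ := mul_one _
  set q := ∏ W ∈ A, min 1 (dens (domMeasure T) y W)
  calc (∑ W ∈ A, wt P W) ^ (1 / a) * q = (∑ W ∈ A, wt P W * q ^ a) ^ (1 / a) := by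
        rw [← Finset.sum_mul, ENNReal.mul_rpow_of_nonneg _ _ (by positivity), ← ENNReal.rpow_mul,
          mul_one_div_cancel ha.ne', ENNReal.rpow_one]
    _ ≤ (∑ W ∈ A, wt P W * dens (domMeasure T) y W ^ a) ^ (1 / a) := by
        gcongr with W hW
        exact h1 W hW
    _ ≤ _ := ENNReal.rpow_le_rpow (Finset.sum_le_sum_of_subset hA) (by positivity)

theorem exists_cell_le (T : Finset 𝒲) :
    ∃ c : ℝ, 0 < c ∧ c ≤ 1 ∧ ∀ A ∈ T.powerset, cellMass T A ≠ 0 → ENNReal.ofReal c ≤ cellMass T A := by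
  classical
  -- The minimum with one keeps m finite even if no cell has nonzero mass, and later gives log c ≤
  -- 0.
  set m : ℝ≥0∞ := min 1 ({A ∈ T.powerset | cellMass T A ≠ 0}.inf (cellMass T)) with hm
  have h0 : 0 < m := by
    refine lt_min one_pos ((Finset.lt_inf_iff ENNReal.zero_lt_top).2 fun A hA => ?_)
    exact pos_iff_ne_zero.2 (Finset.mem_filter.1 hA).2
  have h1 : m ≤ 1 := min_le_left _ _
  have ht : m ≠ ⊤ := ne_top_of_le_ne_top ENNReal.one_ne_top h1
  refine ⟨m.toReal, ENNReal.toReal_pos h0.ne' ht, ?_, fun A hA hne => ?_⟩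
  · simpa using ENNReal.toReal_mono ENNReal.one_ne_top h1
  · rw [ENNReal.ofReal_toReal ht]
    exact (min_le_right _ _).trans (Finset.inf_le (Finset.mem_filter.2 ⟨hA, hne⟩))

/-- Passes from positivity of the density relative to `mixture P` to positivity relative to
`domMeasure T`, whose cells do not depend on the prior; the two differ by the factor dμ/dν, positive
almost everywhere for the mixture μ. -/
theorem activeWeight_eq_ae {T : Finset 𝒲} {P : Prior 𝒲} (hT : P.weights.support ⊆ T) :
    ∀ᵐ y ∂(mixture P), activeWeight P y = ∑ W ∈ active T y, P.weights W := by
  classical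
  have hν : mixture P ≪ domMeasure T := mixture_absolutelyContinuous fun W hW =>
    absolutelyContinuous_domMeasure (hT hW)
  filter_upwards [hν.ae_le (dens_mul_rnDeriv (P := P) (ν := domMeasure T)),
    Measure.rnDeriv_pos hν, dens_lt_top_ae P] with y h1 h2 h3
  rw [activeWeight, active, Finset.sum_filter, Finset.sum_filter]
  rw [Finset.sum_subset hT fun W _ hW => by
    rw [Finsupp.notMem_support_iff.1 hW, ite_self]]
  refine Finset.sum_congr rfl fun W _ => ?_
  by_cases hW : W ∈ P.weights.support
  · simp only [posterior_pos_iff hW (h3 W hW), h1 W hW, ne_eq, mul_eq_zero, h2.ne', or_false]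
  · simp [Finsupp.notMem_support_iff.1 hW]

theorem cell_ne_zero_ae (T : Finset 𝒲) :
    ∀ᵐ y ∂(domMeasure T), domMeasure T {z | active T z = active T y} ≠ 0 := by
  classical
  have : ∀ᵐ y ∂(domMeasure T), ∀ A ∈ T.powerset,
      domMeasure T {z | active T z = A} = 0 → active T y ≠ A := by
    refine (Finset.eventually_all _).2 fun A _ => ?_
    by_cases h : domMeasure T {z | active T z = A} = 0
    · filter_upwards [measure_eq_zero_iff_ae_notMem.1 h] with y hy _ using hy
    · exact Eventually.of_forall fun y h0 => absurd h0 h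
  filter_upwards [this] with y hy h0
  exact hy _ (Finset.mem_powerset.2 (Finset.filter_subset _ _)) h0 rfl

/-- An upper bound for the information of small order that is uniform over the priors supported in
a fixed finite set. -/
theorem exists_renyiInfo_le_zero_add (T : Finset 𝒲) : ∃ L : ℝ, 0 ≤ L ∧ ∀ P : Prior 𝒲,
    P.weights.support ⊆ T → ∀ a : ℝ, 0 < a → a < 1 →
      (1 - a) * renyiInfo (ENNReal.ofReal a) P ≤ renyiInfo 0 P + a * L := by
  obtain ⟨c, hc0, hc1, hc⟩ := exists_cell_le T
  refine ⟨-Real.log c, by linarith [Real.log_nonpos hc0.le hc1], fun P hT a ha ha1 => ?_⟩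
  have hν : mixture P ≪ domMeasure T := mixture_absolutelyContinuous fun W hW =>
    absolutelyContinuous_domMeasure (hT hW)
  refine le_of_forall_pos_le_add fun κ hκ => ?_
  -- A point of a non-null cell at which -log of the active weight p is within κ of the essential
  -- infimum. Then the mass is at least p^(1/a) · c, and logarithms give (1-a) I_a ≤ -log p - a log
  -- c.
  obtain ⟨y, h1, h2, h3, h4⟩ := ((frequently_lt_renyiInfo_zero_add P hκ).and_eventually
    ((activeWeight_eq_ae hT).and ((activeWeight_pos_ae P).and (hν.ae_le (cell_ne_zero_ae T))))).exists
  rw [h2] at h1 h3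
  have hsub : active T y ⊆ T := Finset.filter_subset _ _
  set p := ∑ W ∈ active T y, P.weights W with hp
  have h5 := hc _ (Finset.mem_powerset.2 hsub) (cellMass_ne_zero h4)
  have h6 := le_mass_of_cell hT hsub ha
  have h7 : ∑ W ∈ active T y, wt P W = ENNReal.ofReal p := by
    rw [hp, ENNReal.ofReal_sum_of_nonneg fun W _ => P.weights_nonneg W]; rfl
  have h8 : ENNReal.ofReal (p ^ (1 / a) * c) ≤ mass a P := by
    rw [ENNReal.ofReal_mul (by positivity), ← ENNReal.ofReal_rpow_of_pos h3, ← h7]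
    exact le_trans (by gcongr) h6
  have h9 := (ENNReal.ofReal_le_iff_le_toReal (mass_ne_top ha P)).1 h8
  have h10 := Real.log_le_log (by positivity) h9
  rw [Real.log_mul (by positivity) hc0.ne', Real.log_rpow h3] at h10
  rw [one_div, Real.log_inv] at h1
  rw [renyiInfo_ofReal P ha ha1.ne]
  have h11 : (1 - a) * (a / (a - 1) * Real.log (mass a P).toReal) =
      -(a * Real.log (mass a P).toReal) := by
    have : a - 1 ≠ 0 := by linarith
    field_simp
    ring
  rw [h11]
  have h12 := mul_le_mul_of_nonneg_left h10 ha.le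
  have h13 : a * (1 / a * Real.log p + Real.log c) = Real.log p + a * Real.log c := by field_simp
  linarith

theorem tendsto_renyiInfo_zero (P : Prior 𝒲) :
    Tendsto (fun a : ℝ => renyiInfo (ENNReal.ofReal a) P) (𝓝[>] 0) (𝓝 (renyiInfo 0 P)) := by
  obtain ⟨L, -, hL⟩ := exists_renyiInfo_le_zero_add P.weights.support
  have hlim : Tendsto (fun a : ℝ => (renyiInfo 0 P + a * L) / (1 - a)) (𝓝[>] 0)
      (𝓝 (renyiInfo 0 P)) := by
    have : ContinuousAt (fun a : ℝ => (renyiInfo 0 P + a * L) / (1 - a)) 0 := by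
      apply ContinuousAt.div <;> [fun_prop; fun_prop; norm_num]
    have h := this.tendsto.mono_left (nhdsWithin_le_nhds (s := Ioi 0))
    simpa using h
  have hmem : Ioo (0 : ℝ) 1 ∈ 𝓝[>] (0 : ℝ) := Ioo_mem_nhdsGT one_pos
  refine tendsto_of_tendsto_of_tendsto_of_le_of_le' tendsto_const_nhds hlim ?_ ?_
  · filter_upwards [hmem] with a ha using renyiInfo_zero_le P ha.1 ha.2
  · filter_upwards [hmem] with a ha
    rw [le_div_iff₀ (by linarith [ha.2]), mul_comm]
    exact hL P subset_rfl a ha.1 ha.2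

end RenyiCapacity

namespace RenyiCapacity

/-! ### The information as a function of the order -/

variable {Y : Type*} [MeasurableSpace Y] {𝒲 : Set (ProbabilityMeasure Y)} (P : Prior 𝒲)

/-- The logarithm of the mass of the mean measure of order `1 / (1 - s)`. -/
noncomputable def logMass (s : ℝ) : ℝ := Real.log (mass (1 / (1 - s)) P).toReal

/-- The reciprocal of the order 1/(1-s) is affine in s, so log-convexity in the reciprocal order
becomes convexity in s. -/
theorem convexOn_logMass : ConvexOn ℝ (Iio 1) (logMass P) := by
  refine convexOn_iff_forall_pos.2 ⟨convex_Iio 1, fun x hx y hy p q hp hq hpq => ?_⟩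
  have hx' : 0 < 1 - x := sub_pos.2 hx
  have hy' : 0 < 1 - y := sub_pos.2 hy
  have hc : 1 - (p * x + q * y) = p * (1 - x) + q * (1 - y) := by linear_combination -hpq
  have hc' : 0 < 1 - (p * x + q * y) := by rw [hc]; positivity
  have h := mass_le_rpow_mul_rpow (a := 1 / (1 - x)) (b := 1 / (1 - y))
    (c := 1 / (1 - (p * x + q * y))) (by positivity) (by positivity) hp hq hpq
    (by rw [one_div_one_div, hc]; field_simp) P
  have hM := mass_toReal_pos P (one_div_pos.2 hx')
  have hN := mass_toReal_pos P (one_div_pos.2 hy')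
  have h1 := ENNReal.toReal_mono (ENNReal.mul_ne_top
    (ENNReal.rpow_ne_top_of_nonneg hp.le (mass_ne_top (one_div_pos.2 hx') P))
    (ENNReal.rpow_ne_top_of_nonneg hq.le (mass_ne_top (one_div_pos.2 hy') P))) h
  rw [ENNReal.toReal_mul, ← ENNReal.toReal_rpow, ← ENNReal.toReal_rpow] at h1
  have h2 := Real.log_le_log (mass_toReal_pos P (one_div_pos.2 hc')) h1
  rw [Real.log_mul (by positivity) (by positivity), Real.log_rpow hM, Real.log_rpow hN] at h2
  exact h2

theorem logMass_zero : logMass P 0 = 0 := by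
  simp [logMass, mass_one]

theorem logMass_one_sub {a : ℝ} : logMass P (1 - 1 / a) = Real.log (mass a P).toReal := by
  simp [logMass]

theorem renyiInfo_eq_logMass {a : ℝ} (ha : 0 < a) (ha1 : a ≠ 1) :
    renyiInfo (ENNReal.ofReal a) P = logMass P (1 - 1 / a) / (1 - 1 / a) := by
  rw [renyiInfo_ofReal P ha ha1, logMass_one_sub]
  have h : a - 1 ≠ 0 := sub_ne_zero.2 ha1
  have : 1 - 1 / a = (a - 1) / a := by field_simp
  rw [this]
  field_simp

theorem renyiInfo_one_div {s : ℝ} (hs : s < 1) (hs0 : s ≠ 0) :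
    renyiInfo (ENNReal.ofReal (1 / (1 - s))) P = logMass P s / s := by
  have h : 0 < 1 - s := by linarith
  rw [renyiInfo_eq_logMass P (by positivity) (by
    rw [ne_eq, div_eq_one_iff_eq h.ne']; intro h; exact hs0 (by linarith)), one_div_one_div,
    sub_sub_cancel]

/-! ### Monotonicity in the order, and the limits at one and infinity. -/

theorem one_sub_one_div_mem {a : ℝ} (ha : 0 < a) : 1 - 1 / a ∈ Iio (1 : ℝ) := by
  have := one_div_pos.2 ha
  rw [mem_Iio]; linarith

theorem one_sub_one_div_ne {a : ℝ} (ha1 : a ≠ 1) : 1 - 1 / a ≠ 0 := by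
  intro h
  apply ha1
  have h1 : a⁻¹ = 1 := by rw [← one_div]; linarith
  rwa [inv_eq_one] at h1

/-- Secants of `logMass P` from the origin, where it vanishes, have increasing slopes. -/
theorem renyiInfo_mono_of_ne_one {a b : ℝ} (ha : 0 < a) (hab : a ≤ b) (ha1 : a ≠ 1) (hb1 : b ≠ 1) :
    renyiInfo (ENNReal.ofReal a) P ≤ renyiInfo (ENNReal.ofReal b) P := by
  have hb := ha.trans_le hab
  have h := (convexOn_logMass P).secant_mono (a := 0) (mem_Iio.2 one_pos) (one_sub_one_div_mem ha)
    (one_sub_one_div_mem hb) (one_sub_one_div_ne ha1) (one_sub_one_div_ne hb1)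
    (by gcongr)
  simpa [logMass_zero, ← renyiInfo_eq_logMass P ha ha1, ← renyiInfo_eq_logMass P hb hb1, ← one_div]
    using h

/-- For b slightly above one, I_a ≤ I_b ≤ I_1 + B(b-1); then b decreases to 1. -/
theorem renyiInfo_le_one {a : ℝ} (ha : 0 < a) (ha1 : a < 1) :
    renyiInfo (ENNReal.ofReal a) P ≤ renyiInfo 1 P := by
  -- The choice η = 2, margin 1/4 in `renyiInfo_le_one_add` admits orders up to 5/4; the
  -- corresponding range below one starts at 4/5.
  set B := 4 / (Real.exp 2 * (1 / 4) ^ 2) * ((mass 2 P).toReal + 1)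
  have hlim : Tendsto (fun b : ℝ => renyiInfo 1 P + B * (b - 1)) (𝓝[>] 1) (𝓝 (renyiInfo 1 P)) := by
    have : ContinuousAt (fun b : ℝ => renyiInfo 1 P + B * (b - 1)) 1 := by fun_prop
    simpa using this.tendsto.mono_left (nhdsWithin_le_nhds (s := Ioi 1))
  refine ge_of_tendsto hlim ?_
  filter_upwards [Ioo_mem_nhdsGT (show (1 : ℝ) < 5 / 4 by norm_num)] with b hb
  exact (renyiInfo_mono_of_ne_one P ha (by linarith [hb.1]) ha1.ne hb.1.ne').trans
    (renyiInfo_le_one_add P one_lt_two (by norm_num) hb.1 (by linarith [hb.2]))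

theorem tendsto_one_sub_mul_one_div_sub (c B : ℝ) :
    Tendsto (fun b : ℝ => c - B * (1 / b - 1)) (𝓝[<] 1) (𝓝 c) := by
  have : ContinuousAt (fun b : ℝ => c - B * (1 / b - 1)) 1 := by fun_prop (disch := norm_num)
  simpa using this.tendsto.mono_left (nhdsWithin_le_nhds (s := Iio 1))

theorem renyiInfo_one_sub_le_of_near {a : ℝ} (ha : a ∈ Ioo (4 / 5 : ℝ) 1) :
    renyiInfo 1 P - 4 / (Real.exp 2 * (1 / 4) ^ 2) * ((mass 2 P).toReal + 1) * (1 / a - 1) ≤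
      renyiInfo (ENNReal.ofReal a) P := by
  have h1 : 1 / a ≤ 5 / 4 := by
    rw [div_le_iff₀ (by linarith [ha.1])]
    linarith [ha.1]
  exact renyiInfo_one_add_le P one_lt_two (by norm_num) (by linarith [ha.1]) ha.2 (by linarith)

theorem renyiInfo_one_le {b : ℝ} (hb : 1 < b) :
    renyiInfo 1 P ≤ renyiInfo (ENNReal.ofReal b) P := by
  refine le_of_tendsto (tendsto_one_sub_mul_one_div_sub (renyiInfo 1 P)
    (4 / (Real.exp 2 * (1 / 4) ^ 2) * ((mass 2 P).toReal + 1))) ?_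
  filter_upwards [Ioo_mem_nhdsLT (show (4 / 5 : ℝ) < 1 by norm_num)] with a ha
  exact (renyiInfo_one_sub_le_of_near P ha).trans
    (renyiInfo_mono_of_ne_one P (by linarith [ha.1]) (by linarith [ha.2]) ha.2.ne hb.ne')

theorem tendsto_renyiInfo_one_left :
    Tendsto (fun a : ℝ => renyiInfo (ENNReal.ofReal a) P) (𝓝[<] 1) (𝓝 (renyiInfo 1 P)) := by
  refine tendsto_of_tendsto_of_tendsto_of_le_of_le' (tendsto_one_sub_mul_one_div_sub (renyiInfo 1 P)
    (4 / (Real.exp 2 * (1 / 4) ^ 2) * ((mass 2 P).toReal + 1))) tendsto_const_nhds ?_ ?_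
  · filter_upwards [Ioo_mem_nhdsLT (show (4 / 5 : ℝ) < 1 by norm_num)] with a ha
    exact renyiInfo_one_sub_le_of_near P ha
  · filter_upwards [Ioo_mem_nhdsLT (show (4 / 5 : ℝ) < 1 by norm_num)] with a ha
    exact renyiInfo_le_one P (by linarith [ha.1]) ha.2

theorem tendsto_renyiInfo_one_right :
    Tendsto (fun a : ℝ => renyiInfo (ENNReal.ofReal a) P) (𝓝[>] 1) (𝓝 (renyiInfo 1 P)) := by
  set B := 4 / (Real.exp 2 * (1 / 4) ^ 2) * ((mass 2 P).toReal + 1)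
  have hlim : Tendsto (fun b : ℝ => renyiInfo 1 P + B * (b - 1)) (𝓝[>] 1) (𝓝 (renyiInfo 1 P)) := by
    have : ContinuousAt (fun b : ℝ => renyiInfo 1 P + B * (b - 1)) 1 := by fun_prop
    simpa using this.tendsto.mono_left (nhdsWithin_le_nhds (s := Ioi 1))
  refine tendsto_of_tendsto_of_tendsto_of_le_of_le' tendsto_const_nhds hlim ?_ ?_
  · filter_upwards [self_mem_nhdsWithin] with b hb using renyiInfo_one_le P hb
  · filter_upwards [Ioo_mem_nhdsGT (show (1 : ℝ) < 5 / 4 by norm_num)] with b hb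
    exact renyiInfo_le_one_add P one_lt_two (by norm_num) hb.1 (by linarith [hb.2])

theorem renyiInfo_mono_real {a b : ℝ} (ha : 0 < a) (hab : a ≤ b) :
    renyiInfo (ENNReal.ofReal a) P ≤ renyiInfo (ENNReal.ofReal b) P := by
  rcases eq_or_ne a 1 with rfl | ha1
  · rcases hab.eq_or_lt with rfl | hb
    · exact le_rfl
    · rw [ENNReal.ofReal_one]; exact renyiInfo_one_le P hb
  rcases eq_or_ne b 1 with rfl | hb1
  · rw [ENNReal.ofReal_one]
    exact renyiInfo_le_one P ha (lt_of_le_of_ne hab ha1)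
  exact renyiInfo_mono_of_ne_one P ha hab ha1 hb1

theorem renyiInfo_zero_le_real {a : ℝ} (ha : 0 < a) :
    renyiInfo 0 P ≤ renyiInfo (ENNReal.ofReal a) P :=
  (renyiInfo_zero_le P (a := min a (1 / 2)) (lt_min ha (by norm_num))
    ((min_le_right _ _).trans_lt (by norm_num))).trans
    (renyiInfo_mono_real P (lt_min ha (by norm_num)) (min_le_left _ _))

theorem massTop_pos : 0 < (massTop P).toReal :=
  ENNReal.toReal_pos (fun h => mass_ne_zero one_pos P (le_antisymm (h ▸ mass_le_massTop one_pos P)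
    zero_le)) (massTop_ne_top P)

theorem renyiInfo_top : renyiInfo ⊤ P = Real.log (massTop P).toReal := by
  simp only [renyiInfo, ENNReal.top_ne_zero, ENNReal.top_ne_one, if_false, if_true]
  rfl

theorem exists_le_wt : ∃ c : ℝ, 0 < c ∧ ∀ W ∈ P.weights.support, ENNReal.ofReal c ≤ wt P W := by
  obtain ⟨W, hW, h⟩ := Finset.exists_min_image P.weights.support P.weights
    P.support_weights_nonempty
  exact ⟨P.weights W, weights_pos P hW, fun V hV => ENNReal.ofReal_le_ofReal (h V hV)⟩

/-- With c a positive lower bound for the weights on the support, the mass lies between c^(1/a)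
`massTop P` and `massTop P`, and c^(1/a) tends to 1. -/
theorem tendsto_renyiInfo_top :
    Tendsto (fun a : ℝ => renyiInfo (ENNReal.ofReal a) P) atTop (𝓝 (renyiInfo ⊤ P)) := by
  obtain ⟨c, hc, hcW⟩ := exists_le_wt P
  have h1 : Tendsto (fun a : ℝ => 1 / a) atTop (𝓝 0) := by
    simpa using tendsto_inv_atTop_zero (𝕜 := ℝ)
  have h2 : Tendsto (fun a : ℝ => 1 / (1 - 1 / a)) atTop (𝓝 1) := by
    have h := (h1.const_sub 1).inv₀ (by norm_num)
    simpa using h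
  have hlow : Tendsto (fun a : ℝ => 1 / (1 - 1 / a) *
      (1 / a * Real.log c + Real.log (massTop P).toReal)) atTop (𝓝 (renyiInfo ⊤ P)) := by
    have := h2.mul ((h1.mul_const (Real.log c)).add_const (Real.log (massTop P).toReal))
    simpa [renyiInfo_top] using this
  have hup : Tendsto (fun a : ℝ => 1 / (1 - 1 / a) * Real.log (massTop P).toReal) atTop
      (𝓝 (renyiInfo ⊤ P)) := by
    simpa [renyiInfo_top] using h2.mul_const (Real.log (massTop P).toReal)
  have hpos : ∀ a : ℝ, 1 < a → 0 < 1 - 1 / a := fun a ha => by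
    rw [sub_pos, div_lt_one (by linarith)]; exact ha
  have hI : ∀ a : ℝ, 1 < a → renyiInfo (ENNReal.ofReal a) P =
      1 / (1 - 1 / a) * Real.log (mass a P).toReal := fun a ha => by
    rw [renyiInfo_eq_logMass P (by linarith) ha.ne', logMass_one_sub, div_eq_mul_one_div, mul_comm]
  refine tendsto_of_tendsto_of_tendsto_of_le_of_le' hlow hup ?_ ?_
  · filter_upwards [eventually_gt_atTop 1] with a ha
    have ha0 : 0 < a := by linarith
    have := hpos a ha
    rw [hI a ha]
    refine mul_le_mul_of_nonneg_left ?_ (by positivity)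
    have h := ENNReal.toReal_mono (mass_ne_top ha0 P) (rpow_mul_massTop_le_mass ha0 P hcW)
    rw [ENNReal.ofReal_rpow_of_pos hc, ENNReal.toReal_mul,
      ENNReal.toReal_ofReal (Real.rpow_nonneg hc.le _)] at h
    have h3 := Real.log_le_log (mul_pos (Real.rpow_pos_of_pos hc _) (massTop_pos P)) h
    rwa [Real.log_mul (Real.rpow_pos_of_pos hc _).ne' (massTop_pos P).ne', Real.log_rpow hc] at h3
  · filter_upwards [eventually_gt_atTop 1] with a ha
    have ha0 : 0 < a := by linarith
    have := hpos a ha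
    rw [hI a ha]
    exact mul_le_mul_of_nonneg_left (Real.log_le_log (mass_toReal_pos P ha0)
      (ENNReal.toReal_mono (massTop_ne_top P) (mass_le_massTop ha0 P))) (by positivity)

theorem renyiInfo_le_top {a : ℝ} (ha : 0 < a) :
    renyiInfo (ENNReal.ofReal a) P ≤ renyiInfo ⊤ P := by
  refine ge_of_tendsto (tendsto_renyiInfo_top P) ?_
  filter_upwards [eventually_ge_atTop a] with b hb using renyiInfo_mono_real P ha hb

theorem renyiInfo_mono : Monotone fun α : ℝ≥0∞ => renyiInfo α P := by
  intro α β h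
  change renyiInfo α P ≤ renyiInfo β P
  rcases eq_or_ne α 0 with rfl | hα
  · rcases eq_or_ne β 0 with rfl | hβ
    · exact le_rfl
    rcases eq_or_ne β ⊤ with rfl | hβ'
    · exact (renyiInfo_zero_le_real P one_pos).trans (renyiInfo_le_top P one_pos)
    · rw [← ENNReal.ofReal_toReal hβ']
      exact renyiInfo_zero_le_real P (ENNReal.toReal_pos hβ hβ')
  rcases eq_or_ne α ⊤ with rfl | hα'
  · rw [top_le_iff.1 h]
  rw [← ENNReal.ofReal_toReal hα']
  have h0 := ENNReal.toReal_pos hα hα'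
  rcases eq_or_ne β ⊤ with rfl | hβ'
  · exact renyiInfo_le_top P h0
  · rw [← ENNReal.ofReal_toReal hβ']
    exact renyiInfo_mono_real P h0 (ENNReal.toReal_mono hβ' h)

theorem one_le_mass_toReal {a : ℝ} (ha : 1 ≤ a) : 1 ≤ (mass a P).toReal := by
  have := ENNReal.toReal_mono (mass_ne_top (by linarith) P) (mass_mono one_pos ha P)
  rwa [mass_one, ENNReal.toReal_one] at this

theorem mass_toReal_le_one {a : ℝ} (ha : 0 < a) (ha1 : a ≤ 1) : (mass a P).toReal ≤ 1 := by
  have := ENNReal.toReal_mono (mass_ne_top one_pos P) (mass_mono ha ha1 P)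
  rwa [mass_one, ENNReal.toReal_one] at this

theorem renyiInfo_nonneg (α : ℝ≥0∞) : 0 ≤ renyiInfo α P := by
  refine le_trans ?_ (renyiInfo_mono P (zero_le : 0 ≤ α))
  refine ge_of_tendsto (tendsto_renyiInfo_zero P) ?_
  filter_upwards [Ioo_mem_nhdsGT (one_pos (α := ℝ))] with a ha
  rw [renyiInfo_ofReal P ha.1 ha.2.ne]
  exact mul_nonneg_of_nonpos_of_nonpos (div_nonpos_of_nonneg_of_nonpos ha.1.le (by linarith [ha.2]))
    (Real.log_nonpos (mass_toReal_pos P ha.1).le (mass_toReal_le_one P ha.1 ha.2.le))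

/-! ### Lipschitz continuity in the order -/

/-- Monotonicity of the mass says (1-b)/b · I_b ≤ (1-a)/a · I_a. -/
theorem renyiInfo_sub_le_of_lt_one {a b : ℝ} (ha : 0 < a) (hab : a ≤ b) (hb : b < 1) :
    renyiInfo (ENNReal.ofReal b) P - renyiInfo (ENNReal.ofReal a) P ≤
      renyiInfo (ENNReal.ofReal a) P / (a * (1 - b)) * (b - a) := by
  have hb0 := ha.trans_le hab
  have ha1 : 0 < 1 - a := by linarith
  have hb1 : 0 < 1 - b := by linarith
  have h := Real.log_le_log (mass_toReal_pos P ha)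
    (ENNReal.toReal_mono (mass_ne_top hb0 P) (mass_mono ha hab P))
  have e : ∀ c : ℝ, 0 < c → c < 1 → Real.log (mass c P).toReal =
      -((1 - c) / c * renyiInfo (ENNReal.ofReal c) P) := fun c hc hc1 => by
    rw [renyiInfo_ofReal P hc hc1.ne]
    have : c - 1 ≠ 0 := by linarith
    field_simp
    ring
  rw [e a ha (by linarith), e b hb0 hb, neg_le_neg_iff, div_mul_eq_mul_div, div_mul_eq_mul_div,
    div_le_div_iff₀ hb0 ha] at h
  rw [div_mul_eq_mul_div, le_div_iff₀ (by positivity)]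
  linarith

/-- With s, t, σ corresponding to a, b, η, convexity bounds the slope of `logMass` on [s, t] by that
on [s, σ]. Since `logMass` is nonnegative at s, it may be divided by t instead of s and dropped at
the end. -/
theorem renyiInfo_sub_le_of_one_lt {a b η : ℝ} (ha : 1 < a) (hab : a ≤ b) (hb : b < η) :
    renyiInfo (ENNReal.ofReal b) P - renyiInfo (ENNReal.ofReal a) P ≤
      renyiInfo (ENNReal.ofReal η) P * (η - 1) / ((b - 1) * (η - a)) * (b - a) := by
  rcases hab.eq_or_lt with rfl | hab
  · simp
  have ha0 : 0 < a := by linarith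
  have hb0 : 0 < b := by linarith
  have hη0 : 0 < η := by linarith
  have hslope := (convexOn_logMass P).secant_mono (a := 1 - 1 / a) (x := 1 - 1 / b)
    (y := 1 - 1 / η) (one_sub_one_div_mem ha0) (one_sub_one_div_mem hb0) (one_sub_one_div_mem hη0)
    (by simpa using hab.ne') (by simpa using (hab.trans hb).ne') (by gcongr)
  rw [renyiInfo_eq_logMass P ha0 ha.ne', renyiInfo_eq_logMass P hb0 (by linarith),
    renyiInfo_eq_logMass P hη0 (by linarith)]
  have hg : 0 ≤ logMass P (1 - 1 / a) := by
    rw [logMass_one_sub]; exact Real.log_nonneg (one_le_mass_toReal P ha.le)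
  set s := 1 - 1 / a with hs
  set t := 1 - 1 / b with ht
  set σ := 1 - 1 / η with hσ
  have hst : t - s = (b - a) / (a * b) := by rw [hs, ht]; field_simp; ring
  have hsσ : σ - s = (η - a) / (a * η) := by rw [hs, hσ]; field_simp; ring
  have hs0 : 0 < s := by rw [hs, sub_pos, div_lt_one ha0]; exact ha
  have htv : t = (b - 1) / b := by rw [ht]; field_simp
  have hσv : σ = (η - 1) / η := by rw [hσ]; field_simp
  have hba : 0 < b - a := by linarith
  have hb1 : 0 < b - 1 := by linarith
  have hη1 : 0 < η - 1 := by linarith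
  have hηa : 0 < η - a := by linarith
  have hst0 : 0 < t - s := by rw [hst]; positivity
  have hsσ0 : 0 < σ - s := by rw [hsσ]; positivity
  have ht0 : 0 < t := by linarith
  have hσ0 : 0 < σ := by linarith
  calc logMass P t / t - logMass P s / s ≤ logMass P t / t - logMass P s / t := by
        gcongr
        linarith
    _ = ((logMass P t - logMass P s) / (t - s)) * ((t - s) / t) := by field_simp
    _ ≤ ((logMass P σ - logMass P s) / (σ - s)) * ((t - s) / t) := by gcongr
    _ ≤ (logMass P σ / (σ - s)) * ((t - s) / t) := by gcongr; linarith
    _ = _ := by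
        rw [hst, hsσ, htv, hσv]
        field_simp

/-- Closeness of g(x)/x to J alone does not control increments. Convexity bounds the slope on [s, t]
by that on [t, 2t], and the linear upper bound at 2t then applies; hence hypotheses up to 2R for a
conclusion up to R. -/
theorem div_sub_div_le_of_convexOn {g : ℝ → ℝ} {R J K : ℝ} (hg : ConvexOn ℝ (Ioc 0 (2 * R)) g)
    (h1 : ∀ x ∈ Ioc 0 (2 * R), J ≤ g x / x) (h2 : ∀ x ∈ Ioc 0 (2 * R), g x / x ≤ J + K * x)
    {s t : ℝ} (hs : 0 < s) (hst : s ≤ t) (ht : t ≤ R) :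
    g t / t - g s / s ≤ 4 * K * (t - s) := by
  rcases hst.eq_or_lt with rfl | hst
  · simp
  have ht0 : 0 < t := hs.trans hst
  have hsm : s ∈ Ioc 0 (2 * R) := ⟨hs, by linarith⟩
  have htm : t ∈ Ioc 0 (2 * R) := ⟨ht0, by linarith⟩
  have h2m : 2 * t ∈ Ioc 0 (2 * R) := ⟨by linarith, by linarith⟩
  have hslope := hg.slope_mono_adjacent hsm h2m hst (by linarith)
  have e1 := h1 s hsm
  have e2 := h1 t htm
  have e3 := h2 _ h2m
  have gs : g s = s * (g s / s) := by field_simp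
  have gt : g t = t * (g t / t) := by field_simp
  have g2 : g (2 * t) = 2 * t * (g (2 * t) / (2 * t)) := by field_simp
  set a := g s / s
  set b := g t / t
  set c := g (2 * t) / (2 * t)
  rw [gs, gt, g2, show 2 * t - t = t by ring, div_le_div_iff₀ (by linarith) ht0] at hslope
  have h3 : t * (b - a) ≤ t * (4 * K * (t - s)) := by
    have h4 : t * b - s * a ≤ (t - s) * (2 * c - b) := by
      have : t * (t * b - s * a) ≤ t * ((t - s) * (2 * c - b)) := by linarith
      exact le_of_mul_le_mul_left this ht0
    have h5 : (t - s) * (2 * c - b - a) ≤ (t - s) * (4 * K * t) := by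
      apply mul_le_mul_of_nonneg_left _ (by linarith)
      linarith
    linarith
  exact le_of_mul_le_mul_left h3 ht0

variable {P}

/-- The room 8ε is split into 3ε for the distance of the order to one and 5ε for the margin in
`renyiInfo_le_one_add`. The factor 4/3 bounds (1/(1-x) - 1)/x for 0 < x ≤ 2ε ≤ 1/4. -/
theorem renyiInfo_sub_le_right {η ε E : ℝ} (hη : 1 < η) (hε : 0 < ε) (hεη : 8 * ε ≤ 1 - 1 / η)
    (hE : 1 ≤ E) (hM : (mass η P).toReal ≤ E) {a b : ℝ} (ha : 1 ≤ a) (hab : a ≤ b)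
    (hb : b ≤ 1 + ε) :
    renyiInfo (ENNReal.ofReal b) P - renyiInfo (ENNReal.ofReal a) P ≤
      5 * E / (2 * Real.exp 2) / ε ^ 2 * (b - a) := by
  have hη0 : 0 < 1 / η := by positivity
  set κ := 4 / (Real.exp 2 * (5 * ε) ^ 2) * ((mass η P).toReal + 1) with hκ
  have hκ0 : 0 ≤ κ := by positivity
  have hκE : κ ≤ 8 * E / (25 * Real.exp 2 * ε ^ 2) := by
    calc κ ≤ 4 / (Real.exp 2 * (5 * ε) ^ 2) * (E + E) := by rw [hκ]; gcongr
      _ = _ := by field_simp; ring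
  -- Numerically 4 · (4/3) · (8/25) = 128/75, below 5/2.
  have hfin : 4 * (κ * (4 / 3)) ≤ 5 * E / (2 * Real.exp 2) / ε ^ 2 := by
    calc _ ≤ 4 * (8 * E / (25 * Real.exp 2 * ε ^ 2) * (4 / 3)) := by gcongr
      _ = (128 / 75) * (E / (Real.exp 2 * ε ^ 2)) := by field_simp; ring
      _ ≤ (5 / 2) * (E / (Real.exp 2 * ε ^ 2)) :=
        mul_le_mul_of_nonneg_right (by norm_num) (by positivity)
      _ = _ := by field_simp
  have key : ∀ c : ℝ, 1 < c → c - 1 ≤ 3 * ε →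
      renyiInfo (ENNReal.ofReal c) P ≤ renyiInfo 1 P + κ * (c - 1) := fun c hc hc2 =>
    renyiInfo_le_one_add P hη (b := 5 * ε) (by positivity) hc (by linarith)
  rcases hab.eq_or_lt with rfl | hab
  · simp
  rcases ha.eq_or_lt with rfl | ha
  · rw [ENNReal.ofReal_one]
    have := key b hab (by linarith)
    calc _ ≤ κ * (b - 1) := by linarith
      _ ≤ _ := by
        apply mul_le_mul_of_nonneg_right _ (by linarith)
        linarith
  have ha0 : 0 < a := by linarith
  have hb0 : 0 < b := by linarith
  rw [renyiInfo_eq_logMass P ha0 ha.ne', renyiInfo_eq_logMass P hb0 (by linarith)]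
  have hs0 : 0 < 1 - 1 / a := by rw [sub_pos, div_lt_one ha0]; exact ha
  have hsb : 1 - 1 / b ≤ ε := by
    have : 1 - 1 / b = (b - 1) / b := by field_simp
    rw [this, div_le_iff₀ hb0]
    nlinarith
  have hst : (1 - 1 / b) - (1 - 1 / a) ≤ b - a := by
    have : (1 - 1 / b) - (1 - 1 / a) = (b - a) / (a * b) := by field_simp; ring
    rw [this]
    exact div_le_self (by linarith) (by nlinarith)
  have hmain := div_sub_div_le_of_convexOn (g := logMass P) (R := ε) (J := renyiInfo 1 P)
    (K := κ * (4 / 3)) ((convexOn_logMass P).subset (fun x hx => mem_Iio.2 (by linarith [hx.2]))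
      (convex_Ioc _ _)) (fun x hx => ?_) (fun x hx => ?_) hs0 (by gcongr : 1 - 1 / a ≤ 1 - 1 / b) hsb
  · refine hmain.trans ?_
    calc _ ≤ 4 * (κ * (4 / 3)) * (b - a) := by gcongr
      _ ≤ _ := by
        apply mul_le_mul_of_nonneg_right hfin (by linarith)
  · have hx1 : x < 1 := by linarith [hx.2]
    rw [← renyiInfo_one_div P hx1 hx.1.ne']
    apply renyiInfo_one_le
    rw [lt_div_iff₀ (by linarith)]
    linarith [hx.1]
  · have hx1 : x < 1 := by linarith [hx.2]
    have hx2 : 0 < 1 - x := by linarith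
    have hx3 : 3 / 4 ≤ 1 - x := by linarith [hx.2]
    have hc : 1 / (1 - x) - 1 ≤ 4 / 3 * x := by
      rw [sub_le_iff_le_add, div_le_iff₀ hx2]
      nlinarith [hx.1]
    rw [← renyiInfo_one_div P hx1 hx.1.ne']
    refine (key _ ?_ ?_).trans ?_
    · rw [lt_div_iff₀ (by linarith)]
      linarith [hx.1]
    · linarith [hx.2]
    · rw [mul_assoc κ]
      exact add_le_add le_rfl (mul_le_mul_of_nonneg_left hc hκ0)

/-- Same argument for the reflected function x ↦ `logMass P (-x)`, whose quotient by x is minus the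
information of order 1/(1+x). Orders are at least 7/8 here, whence 8/7 and 64/49 in passing to
reciprocals. -/
theorem renyiInfo_sub_le_left {η ε E : ℝ} (hη : 1 < η) (hε : 0 < ε) (hεη : 8 * ε ≤ 1 - 1 / η)
    (hE : 1 ≤ E) (hM : (mass η P).toReal ≤ E) {a b : ℝ} (ha : 1 - ε ≤ a) (hab : a ≤ b)
    (hb : b ≤ 1) :
    renyiInfo (ENNReal.ofReal b) P - renyiInfo (ENNReal.ofReal a) P ≤
      5 * E / (2 * Real.exp 2) / ε ^ 2 * (b - a) := by
  have hη0 : 0 < 1 / η := by positivity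
  set κ := 4 / (Real.exp 2 * (5 * ε) ^ 2) * ((mass η P).toReal + 1) with hκ
  have hκ0 : 0 ≤ κ := by positivity
  have hκE : κ ≤ 8 * E / (25 * Real.exp 2 * ε ^ 2) := by
    calc κ ≤ 4 / (Real.exp 2 * (5 * ε) ^ 2) * (E + E) := by rw [hκ]; gcongr
      _ = _ := by field_simp; ring
  have hfin : 4 * κ * (64 / 49) ≤ 5 * E / (2 * Real.exp 2) / ε ^ 2 := by
    calc _ ≤ 4 * (8 * E / (25 * Real.exp 2 * ε ^ 2)) * (64 / 49) := by gcongr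
      _ = (2048 / 1225) * (E / (Real.exp 2 * ε ^ 2)) := by field_simp; ring
      _ ≤ (5 / 2) * (E / (Real.exp 2 * ε ^ 2)) :=
        mul_le_mul_of_nonneg_right (by norm_num) (by positivity)
      _ = _ := by field_simp
  have key : ∀ c : ℝ, 1 / 2 ≤ c → c < 1 → 1 / c - 1 ≤ 3 * ε →
      renyiInfo 1 P - κ * (1 / c - 1) ≤ renyiInfo (ENNReal.ofReal c) P := fun c hc hc1 hc2 =>
    renyiInfo_one_add_le P hη (b := 5 * ε) (by positivity) hc hc1 (by linarith)
  have hε8 : ε ≤ 1 / 8 := by linarith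
  have ha0 : 7 / 8 ≤ a := by linarith
  have ha0' : 0 < a := by linarith
  have hb0 : 0 < b := by linarith
  have hsa : 1 / a - 1 ≤ 8 / 7 * ε := by
    rw [sub_le_iff_le_add, div_le_iff₀ ha0']
    nlinarith
  have hst : (1 / a - 1) - (1 / b - 1) ≤ 64 / 49 * (b - a) := by
    have : (1 / a - 1) - (1 / b - 1) = (b - a) / (a * b) := by field_simp; ring
    rw [this, div_le_iff₀ (by positivity)]
    have h1 : 49 / 64 ≤ a * b := by nlinarith
    have h2 : 0 ≤ b - a := by linarith
    nlinarith
  rcases hab.eq_or_lt with rfl | hab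
  · simp
  rcases hb.eq_or_lt with rfl | hb
  · rw [ENNReal.ofReal_one]
    have := key a (by linarith) hab (by linarith)
    rw [div_one, sub_self, sub_zero] at hst
    calc _ ≤ κ * (1 / a - 1) := by linarith
      _ ≤ κ * (64 / 49 * (1 - a)) := by gcongr
      _ = κ * (64 / 49) * (1 - a) := by ring
      _ ≤ _ := by
        apply mul_le_mul_of_nonneg_right _ (by linarith)
        linarith
  have hs0 : 0 < 1 / b - 1 := by rw [sub_pos, lt_div_iff₀ hb0]; linarith
  have hI : ∀ x : ℝ, 0 < x → logMass P (-x) / x = -renyiInfo (ENNReal.ofReal (1 / (1 + x))) P :=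
    fun x hx => by
      have := renyiInfo_one_div P (s := -x) (by linarith) (by linarith)
      rw [sub_neg_eq_add] at this
      rw [this, div_neg, neg_neg]
  have hconv : ConvexOn ℝ (Ioc 0 (2 * (8 / 7 * ε))) fun x => logMass P (-x) := by
    have h := (convexOn_logMass P).comp_linearMap (-LinearMap.id : ℝ →ₗ[ℝ] ℝ)
    refine h.subset (fun x hx => ?_) (convex_Ioc _ _)
    change -x < 1
    linarith [hx.1]
  have hmain := div_sub_div_le_of_convexOn (g := fun x => logMass P (-x)) (R := 8 / 7 * ε)
    (J := -renyiInfo 1 P) (K := κ) hconv (fun x hx => ?_) (fun x hx => ?_) hs0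
    (by gcongr : 1 / b - 1 ≤ 1 / a - 1) hsa
  · rw [hI _ hs0, hI _ (by rw [sub_pos, lt_div_iff₀ ha0']; linarith), add_sub_cancel,
      add_sub_cancel, one_div_one_div, one_div_one_div] at hmain
    calc _ ≤ 4 * κ * (1 / a - 1 - (1 / b - 1)) := by linarith
      _ ≤ 4 * κ * (64 / 49 * (b - a)) := by gcongr
      _ = 4 * κ * (64 / 49) * (b - a) := by ring
      _ ≤ _ := mul_le_mul_of_nonneg_right hfin (by linarith)
  · rw [hI x hx.1, neg_le_neg_iff]
    have := hx.1
    exact renyiInfo_le_one P (by positivity) (by rw [div_lt_one (by positivity)]; linarith)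
  · rw [hI x hx.1]
    have hx0 := hx.1
    have := key (1 / (1 + x)) ?_ ?_ ?_
    · rw [one_div_one_div, add_sub_cancel_left] at this
      linarith
    · rw [div_le_div_iff₀ (by norm_num) (by positivity)]
      linarith [hx.2]
    · rw [div_lt_one (by positivity)]; linarith
    · rw [one_div_one_div]; linarith [hx.2]

theorem sub_le_mul_sub_glue {f : ℝ → ℝ} {x m z L : ℝ}
    (h1 : ∀ a b, x ≤ a → a ≤ b → b ≤ m → f b - f a ≤ L * (b - a))
    (h2 : ∀ a b, m ≤ a → a ≤ b → b ≤ z → f b - f a ≤ L * (b - a)) :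
    ∀ a b, x ≤ a → a ≤ b → b ≤ z → f b - f a ≤ L * (b - a) := by
  intro a b hxa hab hbz
  rcases le_total b m with hb | hb
  · exact h1 a b hxa hab hb
  rcases le_total m a with ha | ha
  · exact h2 a b ha hab hbz
  linarith [h1 a m hxa ha le_rfl, h2 m b le_rfl hb hbz]

/-- For η > 1 the interval is cut at 1-ε, 1 and 1+ε. The outer pieces use the explicit increments,
the inner ones the expansion near order one, and bounds on adjacent pieces are glued. -/
theorem renyiInfo_sub_le_orderConst {η C ε : ℝ} (hη : 0 < η)
    (hC : renyiInfo (ENNReal.ofReal η) P ≤ C) (hε : 0 < ε) (hεη : ε ≤ orderMargin η) :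
    ∀ a b, ε ≤ a → a ≤ b → b ≤ η - ε →
      renyiInfo (ENNReal.ofReal b) P - renyiInfo (ENNReal.ofReal a) P ≤
        orderConst η C / ε ^ 2 * (b - a) := by
  have hC0 : 0 ≤ C := (renyiInfo_nonneg P _).trans hC
  have hA : ∀ a b, ε ≤ a → a ≤ b → b ≤ 1 - ε → b ≤ η →
      renyiInfo (ENNReal.ofReal b) P - renyiInfo (ENNReal.ofReal a) P ≤ C / ε ^ 2 * (b - a) := by
    intro a b ha hab hb hbη
    refine (renyiInfo_sub_le_of_lt_one P (by linarith) hab (by linarith)).trans ?_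
    have : renyiInfo (ENNReal.ofReal a) P ≤ C :=
      (renyiInfo_mono_real P (by linarith) (by linarith)).trans hC
    have h1 : ε ≤ 1 - b := by linarith
    rw [sq]
    gcongr
    linarith
  unfold orderMargin at hεη
  unfold orderConst
  split_ifs at hεη ⊢ with h
  · exact fun a b ha hab hb => hA a b ha hab (by linarith) (by linarith)
  · have hη1 : 1 < η := not_le.1 h
    have hεη' : 8 * ε ≤ 1 - 1 / η := by
      have : 1 - 1 / η = 8 * ((η - 1) / (8 * η)) := by field_simp
      rw [this]; linarith
    have hεη2 : 8 * ε * η ≤ η - 1 := by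
      have := mul_le_mul_of_nonneg_right hεη' hη.le
      rwa [sub_mul, one_mul, one_div_mul_cancel hη.ne'] at this
    have hεη1 : 8 * ε ≤ η - 1 := by nlinarith
    have hE : 1 ≤ Real.exp (2 * C) := Real.one_le_exp (by linarith)
    have hM : (mass η P).toReal ≤ Real.exp (2 * C) := by
      rw [← Real.log_le_iff_le_exp (mass_toReal_pos P hη)]
      rw [renyiInfo_ofReal P hη hη1.ne', div_mul_eq_mul_div, div_le_iff₀ (by linarith)] at hC
      have h0 := Real.log_nonneg (one_le_mass_toReal P hη1.le)
      nlinarith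
    set D := 5 * Real.exp (2 * C) / (2 * Real.exp 2)
    have hD : 0 ≤ D := by positivity
    have mono : ∀ {x : ℝ} {a b : ℝ}, a ≤ b → x ≤ η * C + D →
        x / ε ^ 2 * (b - a) ≤ (η * C + D) / ε ^ 2 * (b - a) := fun hab hx =>
      mul_le_mul_of_nonneg_right (by gcongr) (sub_nonneg.2 hab)
    have hCη : C ≤ η * C := by nlinarith
    have h1 : ∀ a b, ε ≤ a → a ≤ b → b ≤ 1 - ε →
        renyiInfo (ENNReal.ofReal b) P - renyiInfo (ENNReal.ofReal a) P ≤
          (η * C + D) / ε ^ 2 * (b - a) := fun a b ha hab hb =>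
      (hA a b ha hab hb (by linarith)).trans (mono hab (by linarith))
    have h2 : ∀ a b, 1 - ε ≤ a → a ≤ b → b ≤ 1 →
        renyiInfo (ENNReal.ofReal b) P - renyiInfo (ENNReal.ofReal a) P ≤
          (η * C + D) / ε ^ 2 * (b - a) := fun a b ha hab hb =>
      (renyiInfo_sub_le_left hη1 hε hεη' hE hM ha hab hb).trans
        (mono hab (by nlinarith))
    have h3 : ∀ a b, 1 ≤ a → a ≤ b → b ≤ 1 + ε →
        renyiInfo (ENNReal.ofReal b) P - renyiInfo (ENNReal.ofReal a) P ≤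
          (η * C + D) / ε ^ 2 * (b - a) := fun a b ha hab hb =>
      (renyiInfo_sub_le_right hη1 hε hεη' hE hM ha hab hb).trans
        (mono hab (by nlinarith))
    have h4 : ∀ a b, 1 + ε ≤ a → a ≤ b → b ≤ η - ε →
        renyiInfo (ENNReal.ofReal b) P - renyiInfo (ENNReal.ofReal a) P ≤
          (η * C + D) / ε ^ 2 * (b - a) := fun a b ha hab hb => by
      refine (renyiInfo_sub_le_of_one_lt P (η := η) (by linarith) hab (by linarith)).trans
        (le_trans ?_ (mono (x := η * C) hab (by linarith)))
      have e1 : ε ≤ b - 1 := by linarith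
      have e2 : ε ≤ η - a := by linarith
      have e3 : renyiInfo (ENNReal.ofReal η) P * (η - 1) ≤ η * C := by
        have := renyiInfo_nonneg P (ENNReal.ofReal η)
        nlinarith
      rw [sq]
      gcongr
      linarith
    exact sub_le_mul_sub_glue (sub_le_mul_sub_glue h1 h2) (sub_le_mul_sub_glue h3 h4)

theorem abs_renyiInfo_sub_le_orderConst {η C ε : ℝ} (hη : 0 < η)
    (hC : renyiInfo (ENNReal.ofReal η) P ≤ C) (hε : 0 < ε) (hεη : ε ≤ orderMargin η) {a b : ℝ}
    (ha : a ∈ Icc ε (η - ε)) (hb : b ∈ Icc ε (η - ε)) :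
    |renyiInfo (ENNReal.ofReal a) P - renyiInfo (ENNReal.ofReal b) P| ≤
      orderConst η C / ε ^ 2 * |a - b| := by
  wlog hab : a ≤ b generalizing a b
  · rw [abs_sub_comm, abs_sub_comm a]
    exact this hb ha (le_of_not_ge hab)
  rw [abs_sub_comm, abs_sub_comm a, abs_of_nonneg (sub_nonneg.2 hab), abs_of_nonneg
    (sub_nonneg.2 (renyiInfo_mono_real P (hε.trans_le ha.1) hab))]
  exact renyiInfo_sub_le_orderConst hη hC hε hεη a b ha.1 hab hb.2

end RenyiCapacity

namespace RenyiCapacity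

/-! ### Two-point power means -/

section TwoPoint

/-- The logarithmic moment generating function of a two-point distribution. -/
noncomputable def logMgf (δ x y s : ℝ) : ℝ :=
  Real.log ((1 - δ) * Real.exp (s * x) + δ * Real.exp (s * y))

theorem rpow_convexComb_le {δ u v p : ℝ} (h0 : 0 ≤ δ) (h1 : δ ≤ 1) (hu : 0 ≤ u) (hv : 0 ≤ v)
    (hp : 1 ≤ p) : ((1 - δ) * u + δ * v) ^ p ≤ (1 - δ) * u ^ p + δ * v ^ p := by
  simpa only [smul_eq_mul] using (convexOn_rpow hp).2 (mem_Ici.2 hu) (mem_Ici.2 hv)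
    (sub_nonneg.2 h1) h0 (by ring)

variable {δ : ℝ}

theorem mgf_pos (h0 : 0 ≤ δ) (h1 : δ < 1) (x y : ℝ) (s : ℝ) : 0 < (1 - δ) * Real.exp (s * x) + δ * Real.exp (s * y) := by
  have : 0 < 1 - δ := by linarith
  positivity

theorem mul_mean_le_logMgf (h0 : 0 ≤ δ) (h1 : δ < 1) (x y : ℝ) (s : ℝ) : s * ((1 - δ) * x + δ * y) ≤ logMgf δ x y s := by
  rw [logMgf, Real.le_log_iff_exp_le (mgf_pos h0 h1 x y s)]
  have := convexOn_exp.2 (mem_univ (s * x)) (mem_univ (s * y)) (show 0 ≤ 1 - δ by linarith) h0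
    (by ring)
  simp only [smul_eq_mul] at this
  refine le_trans (le_of_eq ?_) this
  congr 1
  ring

theorem logMgf_mul_le (h0 : 0 ≤ δ) (h1 : δ < 1) (x y : ℝ) {s c : ℝ} (hc : 1 ≤ c) : c * logMgf δ x y s ≤ logMgf δ x y (c * s) := by
  have h := rpow_convexComb_le h0 h1.le (Real.exp_pos (s * x)).le (Real.exp_pos (s * y)).le hc
  rw [← Real.exp_mul, ← Real.exp_mul] at h
  have h2 := Real.log_le_log (Real.rpow_pos_of_pos (mgf_pos h0 h1 x y s) c) h
  rw [Real.log_rpow (mgf_pos h0 h1 x y s)] at h2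
  rw [logMgf, logMgf]
  convert h2 using 5 <;> ring

/-- For s and t of equal sign this is Jensen for a power; for opposite signs the mean of the
two-point law separates the two quotients. -/
theorem logMgf_div_mono (h0 : 0 ≤ δ) (h1 : δ < 1) (x y : ℝ) {s t : ℝ} (hst : s ≤ t) (hs : s ≠ 0) (ht : t ≠ 0) :
    logMgf δ x y s / s ≤ logMgf δ x y t / t := by
  rcases lt_or_gt_of_ne hs with hs | hs <;> rcases lt_or_gt_of_ne ht with ht | ht
  · have h := logMgf_mul_le h0 h1 x y (s := t) (c := s / t) (by rwa [one_le_div_of_neg ht])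
    rw [div_mul_cancel₀ _ ht.ne] at h
    rw [div_le_iff_of_neg hs]
    calc _ = s / t * logMgf δ x y t := by ring
      _ ≤ _ := h
  · calc _ ≤ (1 - δ) * x + δ * y := by
          rw [div_le_iff_of_neg hs, mul_comm]; exact mul_mean_le_logMgf h0 h1 x y s
      _ ≤ _ := by rw [le_div_iff₀ ht, mul_comm]; exact mul_mean_le_logMgf h0 h1 x y t
  · linarith
  · have h := logMgf_mul_le h0 h1 x y (s := s) (c := t / s) (by rwa [one_le_div hs])
    rw [div_mul_cancel₀ _ hs.ne'] at h
    rw [le_div_iff₀ ht]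
    calc _ = t / s * logMgf δ x y s := by ring
      _ ≤ _ := h

end TwoPoint

/-! ### The modulus of continuity in the prior -/

/-- The first summand of `priorModulus` for positive orders. -/
noncomputable def mixModulus (η C δ : ℝ) : ℝ :=
  if η = 1 then Real.binEntropy δ + δ * C
  else η / (η - 1) * Real.log ((1 - δ) ^ (1 / η) + δ ^ (1 / η) * Real.exp ((η - 1) / η * C))

theorem priorModulus_eq {η : ℝ} (hη : η ≠ 0) (C δ : ℝ) :
    priorModulus η C δ = mixModulus η C δ + Real.log (1 - δ + δ * Real.exp C) := by
  rw [priorModulus, if_neg hη, mixModulus]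
  split_ifs <;> rfl

/-- The law takes the value -log(1-δ) with probability 1-δ and C - log δ with probability δ. Its
mean is h(δ) + δC, so the separate formula at η = 1 fits into the same monotone family. -/
theorem mixModulus_eq_logMgf {η C δ : ℝ} (hη : 0 < η) (hη1 : η ≠ 1) (h0 : 0 < δ) (h1 : δ < 1) :
    mixModulus η C δ =
      logMgf δ (-Real.log (1 - δ)) (C - Real.log δ) (1 - 1 / η) / (1 - 1 / η) := by
  have h1' : 0 < 1 - δ := by linarith
  have e1 : η / (η - 1) = 1 / (1 - 1 / η) := by
    have : η - 1 ≠ 0 := sub_ne_zero.2 hη1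
    have e : 1 - 1 / η = (η - 1) / η := by field_simp
    rw [e, one_div_div]
  have e2 : (η - 1) / η = 1 - 1 / η := by field_simp
  rw [mixModulus, if_neg hη1, e1, e2, one_div_mul_eq_div, logMgf]
  congr 3
  · rw [Real.rpow_def_of_pos h1']
    nth_rw 2 [← Real.exp_log h1']
    rw [← Real.exp_add]
    congr 1
    ring
  · rw [Real.rpow_def_of_pos h0]
    nth_rw 2 [← Real.exp_log h0]
    rw [← Real.exp_add, ← Real.exp_add]
    congr 1
    ring

theorem mixModulus_mono {a η C δ : ℝ} (ha : 0 < a) (ha1 : a ≠ 1) (haη : a ≤ η) (h0 : 0 < δ)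
    (h1 : δ < 1) : mixModulus a C δ ≤ mixModulus η C δ := by
  have hη := ha.trans_le haη
  rw [mixModulus_eq_logMgf ha ha1 h0 h1]
  rcases eq_or_ne η 1 with rfl | hη1
  · have hs : 1 - 1 / a < 0 := by
      rw [sub_neg, lt_div_iff₀ ha]
      linarith [lt_of_le_of_ne haη ha1]
    rw [div_le_iff_of_neg hs, mixModulus, if_pos rfl, mul_comm]
    have h := mul_mean_le_logMgf h0.le h1 (-Real.log (1 - δ)) (C - Real.log δ) (1 - 1 / a)
    refine le_trans (le_of_eq ?_) h
    rw [Real.binEntropy, Real.log_inv, Real.log_inv]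
    ring
  · rw [mixModulus_eq_logMgf hη hη1 h0 h1]
    exact logMgf_div_mono h0.le h1 _ _ (by gcongr) (one_sub_one_div_ne ha1)
      (one_sub_one_div_ne hη1)

theorem mixModulus_zero {η : ℝ} (hη : 0 < η) (C : ℝ) : mixModulus η C 0 = 0 := by
  unfold mixModulus
  split_ifs
  · simp
  · simp [Real.zero_rpow (inv_pos.2 hη).ne']

theorem mixModulus_one_nonneg {η C : ℝ} (hη : 0 < η) (hC : 0 ≤ C) : 0 ≤ mixModulus η C 1 := by
  unfold mixModulus
  split_ifs with h
  · simpa using hC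
  · have h1 : η - 1 ≠ 0 := sub_ne_zero.2 h
    rw [sub_self, Real.zero_rpow (one_div_pos.2 hη).ne', Real.one_rpow, zero_add, one_mul,
      Real.log_exp]
    have : η / (η - 1) * ((η - 1) / η * C) = C := by field_simp
    rwa [this]

theorem priorModulus_zero {η : ℝ} (hη : 0 ≤ η) (C : ℝ) : priorModulus η C 0 = 0 := by
  rcases hη.eq_or_lt with rfl | hη
  · simp [priorModulus]
  · simp [priorModulus_eq hη.ne', mixModulus_zero hη]

theorem le_priorModulus_one {η C : ℝ} (hη : 0 ≤ η) (hC : 0 ≤ C) : C ≤ priorModulus η C 1 := by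
  rcases hη.eq_or_lt with rfl | hη
  · have : max 0 (Real.exp (-C)) = Real.exp (-C) := max_eq_right (Real.exp_pos _).le
    simp [priorModulus, this, hC]
  · have := mixModulus_one_nonneg hη hC
    simp [priorModulus_eq hη.ne', this]

theorem continuousAt_priorModulus {η : ℝ} (hη : 0 ≤ η) (C : ℝ) :
    ContinuousAt (priorModulus η C) 0 := by
  have hlog : ContinuousAt (fun δ : ℝ => Real.log (1 - δ + δ * Real.exp C)) 0 :=
    ContinuousAt.log (by fun_prop) (by norm_num)
  unfold priorModulus
  split_ifs with h h'
  · refine ContinuousAt.add (ContinuousAt.neg (ContinuousAt.log ?_ ?_)) hlog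
    · fun_prop
    · simp
  · refine ContinuousAt.add (ContinuousAt.add ?_ (by fun_prop)) hlog
    exact Real.binEntropy_continuous.continuousAt
  · have hη0 : 0 < 1 / η := by
      have := hη.lt_of_ne' h
      positivity
    refine ContinuousAt.add (ContinuousAt.mul continuousAt_const (ContinuousAt.log ?_ ?_)) hlog
    · refine ContinuousAt.add ?_ (ContinuousAt.mul ?_ continuousAt_const)
      · exact ContinuousAt.rpow_const (by fun_prop) (Or.inr hη0.le)
      · exact ContinuousAt.rpow_const continuousAt_id (Or.inr hη0.le)
    · simp only [sub_zero, Real.one_rpow, Real.zero_rpow hη0.ne', zero_mul, add_zero]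
      norm_num

/-! ### Information of a mixture compared with that of its parts. -/

variable {Y : Type*} [MeasurableSpace Y] {𝒲 : Set (ProbabilityMeasure Y)}
variable {P S S' : Prior 𝒲} {δ : ℝ}

theorem mass_toReal_eq_exp {a : ℝ} (ha : 0 < a) (ha1 : a ≠ 1) (P : Prior 𝒲) :
    (mass a P).toReal = Real.exp ((a - 1) / a * renyiInfo (ENNReal.ofReal a) P) := by
  have : a - 1 ≠ 0 := sub_ne_zero.2 ha1
  have e : (a - 1) / a * (a / (a - 1)) = 1 := by field_simp
  rw [renyiInfo_ofReal P ha ha1, ← mul_assoc, e, one_mul, Real.exp_log (mass_toReal_pos P ha)]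

theorem toReal_mass_comb {p q : ℝ} (hp : 0 ≤ p) (hq : 0 ≤ q) {r : ℝ} (hr : 0 ≤ r) {m m' : ℝ≥0∞}
    (hm : m ≠ ⊤) (hm' : m' ≠ ⊤) :
    ENNReal.ofReal p ^ r * m + ENNReal.ofReal q ^ r * m' ≠ ⊤ ∧
    (ENNReal.ofReal p ^ r * m + ENNReal.ofReal q ^ r * m').toReal =
      p ^ r * m.toReal + q ^ r * m'.toReal := by
  rw [ENNReal.ofReal_rpow_of_nonneg hp hr, ENNReal.ofReal_rpow_of_nonneg hq hr]
  have h1 := ENNReal.mul_ne_top (ENNReal.ofReal_ne_top (r := p ^ r)) hm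
  have h2 := ENNReal.mul_ne_top (ENNReal.ofReal_ne_top (r := q ^ r)) hm'
  refine ⟨ENNReal.add_ne_top.2 ⟨h1, h2⟩, ?_⟩
  rw [ENNReal.toReal_add h1 h2, ENNReal.toReal_mul, ENNReal.toReal_mul,
    ENNReal.toReal_ofReal (Real.rpow_nonneg hp _), ENNReal.toReal_ofReal (Real.rpow_nonneg hq _)]

/-- The mass of S is factored out of the mixture inequality. This is possible because it is at most
1 below order one and at least 1 above, so multiplying exp((a-1)/a · C) by it goes in the needed
direction. -/
theorem renyiInfo_mix_le (h0 : 0 < δ) (h1 : δ < 1)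
    (h : ∀ W, P.weights W = (1 - δ) * S.weights W + δ * S'.weights W) {a : ℝ} (ha : 0 < a)
    (ha1 : a ≠ 1) {C : ℝ} (hC : renyiInfo (ENNReal.ofReal a) S' ≤ C) :
    renyiInfo (ENNReal.ofReal a) P ≤ renyiInfo (ENNReal.ofReal a) S + mixModulus a C δ := by
  have h1' : 0 < 1 - δ := by linarith
  have hP := mass_toReal_pos P ha
  have hS := mass_toReal_pos S ha
  have hS' := mass_toReal_eq_exp ha ha1 S'
  obtain ⟨hne, heq⟩ := toReal_mass_comb h1'.le h0.le (one_div_pos.2 ha).le (mass_ne_top ha S)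
    (mass_ne_top ha S')
  set X := (1 - δ) ^ (1 / a) + δ ^ (1 / a) * Real.exp ((a - 1) / a * C) with hX
  have hX0 : 0 < X := by positivity
  rw [mixModulus, if_neg ha1, renyiInfo_ofReal P ha ha1, renyiInfo_ofReal S ha ha1, ← mul_add,
    ← Real.log_mul hS.ne' hX0.ne']
  rcases lt_or_gt_of_ne ha1 with ha1 | ha1
  · have h2 := ENNReal.toReal_mono (mass_ne_top ha P) (le_mass_mix h0.le h1.le h ha ha1.le)
    rw [heq, hS'] at h2
    refine mul_le_mul_of_nonpos_left (Real.log_le_log (by positivity) (le_trans ?_ h2))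
      (div_nonpos_of_nonneg_of_nonpos ha.le (by linarith))
    have h3 : (mass a S).toReal * Real.exp ((a - 1) / a * C) ≤
        Real.exp ((a - 1) / a * renyiInfo (ENNReal.ofReal a) S') := by
      refine (mul_le_of_le_one_left (Real.exp_pos _).le (mass_toReal_le_one S ha ha1.le)).trans ?_
      exact Real.exp_le_exp.2 (mul_le_mul_of_nonpos_left hC
        (div_nonpos_of_nonpos_of_nonneg (by linarith) ha.le))
    calc _ = (1 - δ) ^ (1 / a) * (mass a S).toReal +
          δ ^ (1 / a) * ((mass a S).toReal * Real.exp ((a - 1) / a * C)) := by rw [hX]; ring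
      _ ≤ _ := by gcongr
  · have h2 := ENNReal.toReal_mono hne (mass_mix_le h0.le h1.le h ha1.le)
    rw [heq, hS'] at h2
    refine mul_le_mul_of_nonneg_left (Real.log_le_log hP (h2.trans ?_))
      (div_nonneg ha.le (by linarith))
    have h3 : Real.exp ((a - 1) / a * renyiInfo (ENNReal.ofReal a) S') ≤
        (mass a S).toReal * Real.exp ((a - 1) / a * C) := by
      refine le_trans ?_ (le_mul_of_one_le_left (Real.exp_pos _).le (one_le_mass_toReal S ha1.le))
      exact Real.exp_le_exp.2 (mul_le_mul_of_nonneg_left hC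
        (div_nonneg (by linarith) ha.le))
    calc _ ≤ (1 - δ) ^ (1 / a) * (mass a S).toReal +
          δ ^ (1 / a) * ((mass a S).toReal * Real.exp ((a - 1) / a * C)) := by gcongr
      _ = _ := by rw [hX]; ring

/-- For orders above one the information is concave in the prior. -/
theorem mul_renyiInfo_le_mix (h0 : 0 ≤ δ) (h1 : δ ≤ 1)
    (h : ∀ W, P.weights W = (1 - δ) * S.weights W + δ * S'.weights W) {a : ℝ} (ha1 : 1 < a) :
    (1 - δ) * renyiInfo (ENNReal.ofReal a) S + δ * renyiInfo (ENNReal.ofReal a) S' ≤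
      renyiInfo (ENNReal.ofReal a) P := by
  have ha : 0 < a := by linarith
  have h1' : 0 ≤ 1 - δ := by linarith
  obtain ⟨-, heq⟩ := toReal_mass_comb h1' h0 zero_le_one (mass_ne_top ha S) (mass_ne_top ha S')
  have h2 := convexComb_mass_le h0 h1 h ha1.le
  have h3 := ENNReal.toReal_mono (mass_ne_top ha P) h2
  simp only [ENNReal.rpow_one, Real.rpow_one] at heq
  rw [heq, mass_toReal_eq_exp ha ha1.ne' S, mass_toReal_eq_exp ha ha1.ne' S',
    mass_toReal_eq_exp ha ha1.ne' P] at h3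
  have h4 := convexOn_exp.2 (mem_univ ((a - 1) / a * renyiInfo (ENNReal.ofReal a) S))
    (mem_univ ((a - 1) / a * renyiInfo (ENNReal.ofReal a) S')) h1' h0 (by ring)
  simp only [smul_eq_mul] at h4
  have h5 := Real.exp_le_exp.1 (h4.trans h3)
  have h6 : 0 < (a - 1) / a := div_pos (by linarith) ha
  refine le_of_mul_le_mul_left ?_ h6
  linarith

/-- Below order one, exp(-(1-a)I) is the a-th power of the mass, hence convex in the prior;
nonnegativity of the information of S' removes S', and Jensen with the power 1/(1-a) ≥ 1 finishes.
Above order one, concavity bounds the difference by δ times the information of S. -/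
theorem renyiInfo_sub_mix_le (h0 : 0 ≤ δ) (h1 : δ < 1)
    (h : ∀ W, P.weights W = (1 - δ) * S.weights W + δ * S'.weights W) {a : ℝ} (ha : 0 < a)
    (ha1 : a ≠ 1) {C : ℝ} (hC : renyiInfo (ENNReal.ofReal a) S ≤ C) :
    renyiInfo (ENNReal.ofReal a) S - renyiInfo (ENNReal.ofReal a) P ≤
      Real.log (1 - δ + δ * Real.exp C) := by
  have h1' : 0 < 1 - δ := by linarith
  set I := renyiInfo (ENNReal.ofReal a) S with hI
  have hle : Real.log (1 - δ + δ * Real.exp I) ≤ Real.log (1 - δ + δ * Real.exp C) := by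
    gcongr
  refine le_trans ?_ hle
  rcases lt_or_gt_of_ne ha1 with ha1 | ha1
  · have hk : 0 < 1 - a := by linarith
    have h2 := mass_rpow_mix_le h0 h1.le h ha ha1.le
    have hne : ∀ R : Prior 𝒲, mass a R ^ a ≠ ⊤ := fun R =>
      ENNReal.rpow_ne_top_of_nonneg ha.le (mass_ne_top ha R)
    obtain ⟨hne', heq⟩ := toReal_mass_comb h1'.le h0 zero_le_one (hne S) (hne S')
    simp only [ENNReal.rpow_one, Real.rpow_one] at heq hne'
    have h3 := ENNReal.toReal_mono hne' h2
    have hpow : ∀ R : Prior 𝒲, (mass a R ^ a).toReal =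
        Real.exp (-((1 - a) * renyiInfo (ENNReal.ofReal a) R)) := fun R => by
      rw [← ENNReal.toReal_rpow, mass_toReal_eq_exp ha ha1.ne, ← Real.exp_mul]
      congr 1
      field_simp
      ring
    rw [heq, hpow, hpow, hpow, ← hI] at h3
    have h4 : Real.exp (-((1 - a) * renyiInfo (ENNReal.ofReal a) S')) ≤ 1 :=
      Real.exp_le_one_iff.2 (neg_nonpos.2 (mul_nonneg hk.le (renyiInfo_nonneg _ _)))
    set J := renyiInfo (ENNReal.ofReal a) P
    have h5 : Real.exp ((1 - a) * (I - J)) ≤ 1 - δ + δ * Real.exp ((1 - a) * I) := by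
      calc _ = Real.exp ((1 - a) * I) * Real.exp (-((1 - a) * J)) := by
            rw [← Real.exp_add]; congr 1; ring
        _ ≤ Real.exp ((1 - a) * I) * ((1 - δ) * Real.exp (-((1 - a) * I)) + δ * 1) := by
            gcongr
            exact h3.trans (by gcongr)
        _ = (1 - δ) * (Real.exp ((1 - a) * I) * Real.exp (-((1 - a) * I))) +
            δ * Real.exp ((1 - a) * I) := by ring
        _ = _ := by rw [← Real.exp_add, add_neg_cancel, Real.exp_zero, mul_one]
    have h6 := rpow_convexComb_le h0 h1.le zero_le_one (Real.exp_pos ((1 - a) * I)).le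
      (p := 1 / (1 - a)) (by rw [le_div_iff₀ hk]; linarith)
    rw [Real.one_rpow, mul_one, ← Real.exp_mul,
      show (1 - a) * I * (1 / (1 - a)) = I by field_simp] at h6
    rw [Real.le_log_iff_exp_le (by positivity)]
    refine le_trans ?_ h6
    have h7 := Real.rpow_le_rpow (Real.exp_pos _).le h5 (one_div_pos.2 hk).le
    rwa [← Real.exp_mul, show (1 - a) * (I - J) * (1 / (1 - a)) = I - J by field_simp] at h7
  · have h2 := mul_renyiInfo_le_mix h0 h1.le h ha1
    have h3 := mul_nonneg h0 (renyiInfo_nonneg S' (ENNReal.ofReal a))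
    rw [Real.le_log_iff_exp_le (by positivity)]
    calc Real.exp (I - renyiInfo (ENNReal.ofReal a) P) ≤ Real.exp ((1 - δ) * 0 + δ * I) := by
          gcongr
          linarith
      _ ≤ (1 - δ) * Real.exp 0 + δ * Real.exp I := by
          have := convexOn_exp.2 (mem_univ 0) (mem_univ I) h1'.le h0 (by ring)
          simpa only [smul_eq_mul] using this
      _ = _ := by simp

theorem renyiInfo_zero_sub_mix_le (h0 : 0 ≤ δ) (h1 : δ < 1)
    (h : ∀ W, P.weights W = (1 - δ) * S.weights W + δ * S'.weights W) :
    renyiInfo 0 S - renyiInfo 0 P ≤ Real.log (1 - δ + δ * Real.exp (renyiInfo 0 S)) := by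
  have h1' : 0 < 1 - δ := by linarith
  refine le_of_tendsto_of_tendsto ((tendsto_renyiInfo_zero S).sub (tendsto_renyiInfo_zero P))
    (Tendsto.log (((Real.continuous_exp.tendsto _).comp (tendsto_renyiInfo_zero S)).const_mul δ
      |>.const_add (1 - δ)) (by positivity)) ?_
  filter_upwards [Ioo_mem_nhdsGT (one_pos (α := ℝ))] with a ha
  exact renyiInfo_sub_mix_le h0 h1 h ha.1 ha.2.ne le_rfl

theorem renyiInfo_zero_mix_le (h0 : 0 < δ) (h1 : δ < 1)
    (h : ∀ W, P.weights W = (1 - δ) * S.weights W + δ * S'.weights W) :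
    renyiInfo 0 P ≤ renyiInfo 0 S' - Real.log δ := by
  have hlim : Tendsto (fun a : ℝ => renyiInfo (ENNReal.ofReal a) S' - 1 / (1 - a) * Real.log δ)
      (𝓝[>] 0) (𝓝 (renyiInfo 0 S' - Real.log δ)) := by
    refine (tendsto_renyiInfo_zero S').sub ?_
    have : ContinuousAt (fun a : ℝ => 1 / (1 - a) * Real.log δ) 0 := by
      fun_prop (disch := norm_num)
    simpa using this.tendsto.mono_left (nhdsWithin_le_nhds (s := Ioi 0))
  refine le_of_tendsto_of_tendsto (tendsto_renyiInfo_zero P) hlim ?_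
  filter_upwards [Ioo_mem_nhdsGT (one_pos (α := ℝ))] with a ⟨ha, ha1⟩
  have h2 := rpow_mul_mass_le_mass_mix h0.le h1.le h ha
  have h3 := ENNReal.toReal_mono (mass_ne_top ha P) h2
  rw [ENNReal.toReal_mul, ENNReal.ofReal_rpow_of_pos h0,
    ENNReal.toReal_ofReal (Real.rpow_nonneg h0.le _)] at h3
  have hS := mass_toReal_pos S' ha
  have h4 := Real.log_le_log (by positivity) h3
  rw [Real.log_mul (by positivity) hS.ne', Real.log_rpow h0] at h4
  rw [renyiInfo_ofReal P ha ha1.ne, renyiInfo_ofReal S' ha ha1.ne]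
  have h5 := mul_le_mul_of_nonpos_left h4 (div_nonpos_of_nonneg_of_nonpos ha.le
    (by linarith : a - 1 ≤ 0))
  have h6 : a / (a - 1) * (1 / a * Real.log δ + Real.log (mass a S').toReal) =
      a / (a - 1) * Real.log (mass a S').toReal - 1 / (1 - a) * Real.log δ := by
    have : a - 1 ≠ 0 := by linarith
    have : 1 - a ≠ 0 := by linarith
    field_simp
    ring
  linarith

theorem dist_half_mem (P₁ P₂ : Prior 𝒲) :
    0 ≤ dist P₁ P₂ / 2 ∧ dist P₁ P₂ / 2 ≤ 1 :=
  ⟨by positivity, by linarith [dist_le_two P₁ P₂]⟩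

/-- At the extreme distances there is no excess, respectively no overlap, to normalize. The modulus
is 0 in the first case and at least C in the second. -/
theorem renyiInfo_sub_le_of_trivial {η C : ℝ} (hη : 0 ≤ η) {α : ℝ≥0∞}
    (hC : ∀ P : Prior 𝒲, renyiInfo α P ≤ C) {P₁ P₂ : Prior 𝒲}
    (hd : dist P₁ P₂ / 2 = 0 ∨ dist P₁ P₂ / 2 = 1) :
    renyiInfo α P₂ - renyiInfo α P₁ ≤ priorModulus η C (dist P₁ P₂ / 2) := by
  rcases hd with hd | hd <;> rw [hd]
  · have : P₁ = P₂ := by rw [← dist_eq_zero]; linarith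
    rw [this, priorModulus_zero hη, sub_self]
  · refine le_trans ?_ (le_priorModulus_one hη ((renyiInfo_nonneg P₁ α).trans (hC P₁)))
    linarith [hC P₂, renyiInfo_nonneg P₁ α]

/-- Passage through the common part S, first at order a; `mixModulus_mono` then raises the order of
the modulus to η. -/
theorem renyiInfo_sub_le_of_pos {η C : ℝ} (hC : ∀ P : Prior 𝒲, renyiInfo (ENNReal.ofReal η) P ≤ C)
    {a : ℝ} (ha : 0 < a) (ha1 : a ≠ 1) (haη : a ≤ η) (P₁ P₂ : Prior 𝒲) :
    renyiInfo (ENNReal.ofReal a) P₂ - renyiInfo (ENNReal.ofReal a) P₁ ≤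
      priorModulus η C (dist P₁ P₂ / 2) := by
  have hη := ha.trans_le haη
  have hC' : ∀ P : Prior 𝒲, renyiInfo (ENNReal.ofReal a) P ≤ C := fun P =>
    (renyiInfo_mono_real P ha haη).trans (hC P)
  obtain ⟨hd0, hd1⟩ := dist_half_mem P₁ P₂
  rcases hd0.eq_or_lt with hd | hd0
  · exact renyiInfo_sub_le_of_trivial hη.le hC' (Or.inl hd.symm)
  rcases hd1.eq_or_lt with hd | hd1
  · exact renyiInfo_sub_le_of_trivial hη.le hC' (Or.inr hd)
  obtain ⟨S, S₁, S₂, h₁, h₂⟩ := exists_common_part rfl hd0 hd1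
  rw [priorModulus_eq hη.ne']
  have e1 := renyiInfo_mix_le hd0 hd1 h₂ ha ha1 (hC' S₂)
  have e2 := renyiInfo_sub_mix_le hd0.le hd1 h₁ ha ha1 (hC' S)
  have e3 := mixModulus_mono (C := C) ha ha1 haη hd0 hd1
  linarith

theorem renyiInfo_zero_sub_le {C : ℝ} (hC : ∀ P : Prior 𝒲, renyiInfo 0 P ≤ C) (P₁ P₂ : Prior 𝒲) :
    renyiInfo 0 P₂ - renyiInfo 0 P₁ ≤ priorModulus 0 C (dist P₁ P₂ / 2) := by
  obtain ⟨hd0, hd1⟩ := dist_half_mem P₁ P₂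
  rcases hd0.eq_or_lt with hd | hd0
  · exact renyiInfo_sub_le_of_trivial le_rfl hC (Or.inl hd.symm)
  rcases hd1.eq_or_lt with hd | hd1
  · exact renyiInfo_sub_le_of_trivial le_rfl hC (Or.inr hd)
  obtain ⟨S, S₁, S₂, h₁, h₂⟩ := exists_common_part rfl hd0 hd1
  set δ := dist P₁ P₂ / 2
  have hd1' : 0 < 1 - δ := by linarith
  -- P₂ contains S₂ with weight δ and S with weight 1-δ. Each inclusion bounds its information, and
  -- the better of the two bounds is the first summand of the modulus.
  have e1 := renyiInfo_zero_mix_le hd0 hd1 h₂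
  have e1' := renyiInfo_zero_mix_le (δ := 1 - δ) (S := S₂) (S' := S) hd1' (by linarith)
    (fun W => by rw [h₂]; ring)
  have e2 := renyiInfo_zero_sub_mix_le hd0.le hd1 h₁
  have e3 : Real.log (1 - δ + δ * Real.exp (renyiInfo 0 S)) ≤
      Real.log (1 - δ + δ * Real.exp C) := by
    gcongr
    exact hC S
  rw [priorModulus, if_pos rfl]
  have e4 : renyiInfo 0 P₂ - renyiInfo 0 S ≤ -Real.log (max (1 - δ) (δ * Real.exp (-C))) := by
    rcases le_total (1 - δ) (δ * Real.exp (-C)) with h | h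
    · rw [max_eq_right h, Real.log_mul hd0.ne' (Real.exp_pos _).ne', Real.log_exp]
      linarith [hC S₂, renyiInfo_nonneg S 0]
    · rw [max_eq_left h]
      linarith
  linarith

theorem abs_renyiInfo_sub_le_priorModulus {η : ℝ≥0} {C : ℝ}
    (hC : ∀ P : Prior 𝒲, renyiInfo η P ≤ C) {α : ℝ≥0∞} (hα : α ≤ η) (P₁ P₂ : Prior 𝒲) :
    |renyiInfo α P₂ - renyiInfo α P₁| ≤ priorModulus η C (dist P₁ P₂ / 2) := by
  suffices key : ∀ P₁ P₂ : Prior 𝒲,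
      renyiInfo α P₂ - renyiInfo α P₁ ≤ priorModulus η C (dist P₁ P₂ / 2) by
    rw [abs_le]
    refine ⟨?_, key P₁ P₂⟩
    have := key P₂ P₁
    rw [dist_comm] at this
    linarith
  intro P₁ P₂
  have hα' : α ≠ ⊤ := ne_top_of_le_ne_top ENNReal.coe_ne_top hα
  rw [← ENNReal.ofReal_coe_nnreal] at hC
  have haη : α.toReal ≤ η := ENNReal.toReal_mono ENNReal.coe_ne_top hα
  rw [← ENNReal.ofReal_toReal hα']
  set a := α.toReal with ha
  have ha0 : 0 ≤ a := ENNReal.toReal_nonneg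
  rcases η.coe_nonneg.eq_or_lt with hη | hη
  · have : a = 0 := by linarith
    rw [this, ENNReal.ofReal_zero, ← hη]
    rw [← hη, ENNReal.ofReal_zero] at hC
    exact renyiInfo_zero_sub_le hC P₁ P₂
  rcases ha0.eq_or_lt with h0 | h0
  · rw [← h0, ENNReal.ofReal_zero]
    refine le_of_tendsto ((tendsto_renyiInfo_zero P₂).sub (tendsto_renyiInfo_zero P₁)) ?_
    filter_upwards [Ioo_mem_nhdsGT (show (0 : ℝ) < min η 1 from lt_min hη one_pos)] with b hb
    exact renyiInfo_sub_le_of_pos hC hb.1 (hb.2.trans_le (min_le_right _ _)).ne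
      (hb.2.le.trans (min_le_left _ _)) P₁ P₂
  rcases eq_or_ne a 1 with h1 | h1
  · rw [h1, ENNReal.ofReal_one]
    -- Order one is approached from below so that the orders used do not exceed η.
    refine le_of_tendsto ((tendsto_renyiInfo_one_left P₂).sub (tendsto_renyiInfo_one_left P₁)) ?_
    filter_upwards [Ioo_mem_nhdsLT (one_pos (α := ℝ))] with b hb
    exact renyiInfo_sub_le_of_pos hC hb.1 hb.2.ne (by linarith [hb.2]) P₁ P₂
  · exact renyiInfo_sub_le_of_pos hC h0 h1 haη P₁ P₂

end RenyiCapacity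

namespace RenyiCapacity

/-! ### The capacity -/

variable {Y : Type*} [MeasurableSpace Y] {𝒲 : Set (ProbabilityMeasure Y)}

theorem capacity_eq_top_iff {α : ℝ≥0∞} :
    capacity α 𝒲 = ⊤ ↔ ∀ B : ℝ, ∃ P : Prior 𝒲, B < renyiInfo α P := by
  rw [capacity, iSup_eq_top]
  refine ⟨fun h B => ?_, fun h b hb => ?_⟩
  · obtain ⟨P, hP⟩ := h B (EReal.coe_lt_top B)
    exact ⟨P, EReal.coe_lt_coe_iff.1 hP⟩
  · obtain ⟨P, hP⟩ := h b.toReal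
    exact ⟨P, (EReal.le_coe_toReal hb.ne).trans_lt (EReal.coe_lt_coe_iff.2 hP)⟩

theorem capacity_lt_top_iff {α : ℝ≥0∞} :
    capacity α 𝒲 < ⊤ ↔ ∃ B : ℝ, ∀ P : Prior 𝒲, renyiInfo α P ≤ B := by
  rw [lt_top_iff_ne_top, ne_eq, capacity_eq_top_iff]
  push Not
  rfl

theorem renyiInfo_le_toReal_capacity {α : ℝ≥0∞} (h : capacity α 𝒲 < ⊤) (P : Prior 𝒲) :
    renyiInfo α P ≤ (capacity α 𝒲).toReal := by
  have h1 : (renyiInfo α P : EReal) ≤ capacity α 𝒲 :=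
    le_iSup (fun P : Prior 𝒲 => (renyiInfo α P : EReal)) P
  have := EReal.toReal_le_toReal h1 (EReal.coe_ne_bot _) h.ne
  simpa using this

theorem capacity_mono : Monotone fun α : ℝ≥0∞ => capacity α 𝒲 := fun _ _ h =>
  iSup_mono fun P => EReal.coe_le_coe_iff.2 (renyiInfo_mono P h)

/-! ### Infinite capacity and the mass of the mean measure -/

/-- Applied to the mass for orders above one and to its inverse for orders below one. -/
theorem forall_exists_lt_mul_log_iff {ι : Type*} {f : ι → ℝ≥0∞} (hf : ∀ i, f i ≠ 0)
    (hf' : ∀ i, f i ≠ ⊤) {k : ℝ} (hk : 0 < k) :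
    (∀ B : ℝ, ∃ i, B < k * Real.log (f i).toReal) ↔
      ∃ u : ℕ → ι, Tendsto (fun n => f (u n)) atTop (𝓝 ⊤) := by
  have key : ∀ B i, B < k * Real.log (f i).toReal ↔ ENNReal.ofReal (Real.exp (B / k)) < f i :=
    fun B i => by
      rw [ENNReal.ofReal_lt_iff_lt_toReal (Real.exp_pos _).le (hf' i), ← Real.lt_log_iff_exp_lt
        (ENNReal.toReal_pos (hf i) (hf' i)), div_lt_iff₀ hk, mul_comm]
  simp only [key]
  constructor
  · intro h
    choose u hu using fun n : ℕ => h n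
    refine ⟨u, tendsto_nhds_top_mono ?_ (Eventually.of_forall fun n => (hu n).le)⟩
    exact ENNReal.tendsto_ofReal_atTop.comp (Real.tendsto_exp_atTop.comp
      (tendsto_natCast_atTop_atTop.atTop_div_const hk))
  · rintro ⟨u, hu⟩ B
    obtain ⟨n, hn⟩ := (hu.eventually (lt_mem_nhds ENNReal.ofReal_lt_top)).exists
    exact ⟨u n, hn⟩

theorem capacity_eq_top_iff_tendsto_zero {α : ℝ≥0∞} (h0 : 0 < α) (h1 : α < 1) :
    capacity α 𝒲 = ⊤ ↔
      ∃ P : ℕ → Prior 𝒲, Tendsto (fun n => meanMeasure α (P n) univ) atTop (𝓝 0) := by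
  have hα := (h1.trans ENNReal.one_lt_top).ne
  have ha0 := ENNReal.toReal_pos h0.ne' hα
  have ha1 : α.toReal < 1 := by
    simpa using (ENNReal.toReal_lt_toReal hα ENNReal.one_ne_top).2 h1
  rw [capacity_eq_top_iff, ← ENNReal.ofReal_toReal hα]
  set a := α.toReal
  have hinfo : ∀ P : Prior 𝒲, renyiInfo (ENNReal.ofReal a) P =
      a / (1 - a) * Real.log ((mass a P)⁻¹).toReal := fun P => by
    rw [renyiInfo_ofReal P ha0 ha1.ne, ENNReal.toReal_inv, Real.log_inv, ← neg_sub a 1, div_neg]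
    ring
  simp only [hinfo]
  rw [forall_exists_lt_mul_log_iff (f := fun P : Prior 𝒲 => (mass a P)⁻¹)
    (fun P => ENNReal.inv_ne_zero.2 (mass_ne_top ha0 P))
    (fun P => ENNReal.inv_ne_top.2 (mass_ne_zero ha0 P)) (div_pos ha0 (by linarith))]
  refine exists_congr fun u => ?_
  rw [← ENNReal.inv_zero, tendsto_inv_iff]
  rfl

theorem capacity_eq_top_iff_tendsto_top {α : ℝ≥0∞} (h1 : 1 < α) :
    capacity α 𝒲 = ⊤ ↔
      ∃ P : ℕ → Prior 𝒲, Tendsto (fun n => meanMeasure α (P n) univ) atTop (𝓝 ⊤) := by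
  rw [capacity_eq_top_iff]
  rcases eq_or_ne α ⊤ with rfl | hα
  · simp only [renyiInfo_top]
    have := forall_exists_lt_mul_log_iff (f := fun P : Prior 𝒲 => massTop P)
      (fun P h => (massTop_pos P).ne' (by rw [h]; rfl)) massTop_ne_top one_pos
    simp only [one_mul] at this
    exact this
  · have ha1 : 1 < α.toReal := by
      simpa using (ENNReal.toReal_lt_toReal ENNReal.one_ne_top hα).2 h1
    have ha0 : 0 < α.toReal := by linarith
    rw [← ENNReal.ofReal_toReal hα]
    simp only [renyiInfo_ofReal _ ha0 ha1.ne']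
    exact forall_exists_lt_mul_log_iff (f := fun P : Prior 𝒲 => mass α.toReal P) (mass_ne_zero ha0)
      (mass_ne_top ha0) (div_pos ha0 (by linarith))

/-! ### Continuity in the prior -/

theorem mul_renyiInfo_le {P S S' : Prior 𝒲} {δ : ℝ} (h0 : 0 ≤ δ) (h1 : δ ≤ 1)
    (h : ∀ W, P.weights W = (1 - δ) * S.weights W + δ * S'.weights W) {α : ℝ≥0∞} (hα : 1 ≤ α) :
    δ * renyiInfo α S' ≤ renyiInfo α P := by
  have key : ∀ a : ℝ, 1 < a →
      δ * renyiInfo (ENNReal.ofReal a) S' ≤ renyiInfo (ENNReal.ofReal a) P := fun a ha => by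
    have e1 := mul_renyiInfo_le_mix h0 h1 h ha
    have e2 := mul_nonneg (sub_nonneg.2 h1) (renyiInfo_nonneg S (ENNReal.ofReal a))
    linarith
  rcases eq_or_ne α ⊤ with rfl | hα'
  · refine le_of_tendsto_of_tendsto ((tendsto_renyiInfo_top S').const_mul δ)
      (tendsto_renyiInfo_top P) ?_
    filter_upwards [eventually_gt_atTop 1] with a ha using key a ha
  rcases hα.eq_or_lt with rfl | hα
  · refine le_of_tendsto_of_tendsto ((tendsto_renyiInfo_one_right S').const_mul δ)
      (tendsto_renyiInfo_one_right P) ?_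
    filter_upwards [self_mem_nhdsWithin] with a ha using key a ha
  · rw [← ENNReal.ofReal_toReal hα']
    refine key _ ?_
    simpa using (ENNReal.toReal_lt_toReal ENNReal.one_ne_top hα').2 hα

/-- Only continuity at one prior P₀ is used: mixing a fraction δ of P into P₀ stays within d of P₀,
and δ I(P) is at most the information of that mixture, hence less than I(P₀) + 1. -/
theorem capacity_lt_top_of_continuous {α : ℝ≥0∞} (hα : 1 ≤ α)
    (h : Continuous fun P : Prior 𝒲 => renyiInfo α P) : capacity α 𝒲 < ⊤ := by
  rw [capacity_lt_top_iff]
  rcases isEmpty_or_nonempty (Prior 𝒲) with hE | ⟨⟨P₀⟩⟩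
  · exact ⟨0, fun P => (hE.false P).elim⟩
  obtain ⟨d, hd, hcont⟩ := Metric.continuous_iff.1 h P₀ 1 one_pos
  set δ := min (d / 3) 1 with hδ
  have h0 : 0 < δ := lt_min (by positivity) one_pos
  have h1 : δ ≤ 1 := min_le_right _ _
  refine ⟨(renyiInfo α P₀ + 1) / δ, fun P => ?_⟩
  have e1 := hcont (mix P₀ P δ h0.le h1) ((dist_mix_le h0.le h1).trans_lt (by
    linarith [min_le_left (d / 3) 1]))
  rw [Real.dist_eq, abs_lt] at e1
  have e2 := mul_renyiInfo_le h0.le h1 (mix_weights (S := P₀) (S' := P) h0.le h1) hα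
  rw [le_div_iff₀ h0, mul_comm]
  linarith [e1.2]

theorem uniformEquicontinuous_renyiInfo {η : ℝ≥0} (h : capacity η 𝒲 < ⊤) :
    UniformEquicontinuous (fun (α : Icc (0 : ℝ≥0∞) η) (P : Prior 𝒲) => renyiInfo α P) := by
  refine Metric.uniformEquicontinuous_of_continuity_modulus
    (fun d => priorModulus η (capacity η 𝒲).toReal (d / 2)) ?_ _ fun P₁ P₂ α => ?_
  · have h1 : Tendsto (fun d : ℝ => d / 2) (𝓝 0) (𝓝 0) := by
      have : Continuous fun d : ℝ => d / 2 := by fun_prop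
      simpa using this.tendsto 0
    have h2 := (continuousAt_priorModulus η.coe_nonneg (capacity η 𝒲).toReal).tendsto.comp h1
    rwa [priorModulus_zero η.coe_nonneg] at h2
  · rw [Real.dist_eq, abs_sub_comm]
    exact abs_renyiInfo_sub_le_priorModulus (renyiInfo_le_toReal_capacity h) α.2.2 P₁ P₂

theorem continuous_renyiInfo {α : ℝ≥0∞} (hα : α < ⊤) (h : capacity α 𝒲 < ⊤) :
    Continuous fun P : Prior 𝒲 => renyiInfo α P := by
  lift α to ℝ≥0 using hα.ne
  exact ((uniformEquicontinuous_renyiInfo h).uniformContinuous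
    ⟨(α : ℝ≥0∞), zero_le, le_rfl⟩).continuous

/-! ### Uniform continuity of the mean measure -/

theorem isFiniteMeasure_meanMeasure {a : ℝ} (ha : 0 < a) (P : Prior 𝒲) :
    IsFiniteMeasure (meanMeasure (ENNReal.ofReal a) P) :=
  ⟨(mass_ne_top ha P).lt_top⟩

theorem sub_le_tvDist (μ ν : Measure Y) [IsFiniteMeasure μ] [IsFiniteMeasure ν] :
    μ.real univ - ν.real univ ≤ tvDist μ ν := by
  have hb : BddAbove (range fun E : {E : Set Y // MeasurableSet E} =>
      ((μ.real E - ν.real E) - (μ.real (E : Set Y)ᶜ - ν.real (E : Set Y)ᶜ))) := by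
    refine ⟨μ.real univ + ν.real univ, ?_⟩
    rintro _ ⟨E, rfl⟩
    have e1 := measureReal_mono (μ := μ) (subset_univ (E : Set Y))
    have e2 := measureReal_mono (μ := ν) (subset_univ (E : Set Y)ᶜ)
    have e3 : 0 ≤ ν.real E := measureReal_nonneg
    have e4 : 0 ≤ μ.real (E : Set Y)ᶜ := measureReal_nonneg
    simp only
    linarith
  have := le_ciSup hb ⟨univ, MeasurableSet.univ⟩
  simpa [tvDist] using this

/-- The contribution (1-δ)^(1/a) of the common part S appears in the upper bound for P₁ and in the
lower bound for P₂, and cancels. -/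
theorem meanMeasure_real_sub_le {P₁ P₂ S S₁ S₂ : Prior 𝒲} {δ : ℝ} (h0 : 0 ≤ δ) (h1 : δ ≤ 1)
    (h₁ : ∀ W, P₁.weights W = (1 - δ) * S.weights W + δ * S₁.weights W)
    (h₂ : ∀ W, P₂.weights W = (1 - δ) * S.weights W + δ * S₂.weights W) {a : ℝ} (ha : 1 ≤ a)
    {E : Set Y} (hE : MeasurableSet E) :
    (meanMeasure (ENNReal.ofReal a) P₁).real E - (meanMeasure (ENNReal.ofReal a) P₂).real E ≤
      δ ^ (1 / a) * (mass a S₁).toReal := by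
  have ha0 : 0 < a := by linarith
  have h1' : 0 ≤ 1 - δ := by linarith
  have hne : ∀ R : Prior 𝒲, meanMeasure (ENNReal.ofReal a) R E ≠ ⊤ := fun R =>
    ne_top_of_le_ne_top (mass_ne_top ha0 R) (measure_mono (subset_univ E))
  obtain ⟨hne', heq⟩ := toReal_mass_comb h1' h0 (one_div_pos.2 ha0).le (hne S) (hne S₁)
  have e1 := ENNReal.toReal_mono hne' (meanMeasure_mix_le h0 h1 h₁ ha hE)
  have e2 := ENNReal.toReal_mono (hne P₂) (rpow_mul_meanMeasure_le_mix (δ := 1 - δ) (S := S₂)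
    (S' := S) h1' (by linarith) (fun W => by rw [h₂]; ring) ha0 hE)
  rw [heq] at e1
  rw [ENNReal.toReal_mul, ENNReal.ofReal_rpow_of_nonneg h1' (by positivity),
    ENNReal.toReal_ofReal (Real.rpow_nonneg h1' _)] at e2
  have e3 : (meanMeasure (ENNReal.ofReal a) S₁ E).toReal ≤ (mass a S₁).toReal :=
    ENNReal.toReal_mono (mass_ne_top ha0 S₁) (measure_mono (subset_univ E))
  have e4 := mul_le_mul_of_nonneg_left e3 (Real.rpow_nonneg h0 (1 / a))
  simp only [Measure.real]
  linarith

theorem tvDist_meanMeasure_le {a M : ℝ} (ha : 1 ≤ a)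
    (hM : ∀ P : Prior 𝒲, (mass a P).toReal ≤ M) {P₁ P₂ : Prior 𝒲} (hd : dist P₁ P₂ < 2) :
    tvDist (meanMeasure (ENNReal.ofReal a) P₁) (meanMeasure (ENNReal.ofReal a) P₂) ≤
      2 * M * (dist P₁ P₂ / 2) ^ (1 / a) := by
  have ha0 : 0 < a := by linarith
  have hM0 : 0 ≤ M := ENNReal.toReal_nonneg.trans (hM P₁)
  have : Nonempty {E : Set Y // MeasurableSet E} := ⟨⟨univ, MeasurableSet.univ⟩⟩
  refine ciSup_le fun E => ?_
  rcases (dist_nonneg (x := P₁) (y := P₂)).eq_or_lt with h | h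
  · rw [eq_comm, dist_eq_zero] at h
    subst h
    simp only [sub_self]
    positivity
  obtain ⟨S, S₁, S₂, h₁, h₂⟩ := exists_common_part (P₁ := P₁) (P₂ := P₂) rfl (by positivity)
    (by linarith)
  set δ := dist P₁ P₂ / 2
  have h0 : 0 ≤ δ := by positivity
  have h1 : δ ≤ 1 := by simp only [δ]; linarith
  have e1 := meanMeasure_real_sub_le h0 h1 h₁ h₂ ha E.2
  have e2 := meanMeasure_real_sub_le h0 h1 h₂ h₁ ha E.2.compl
  have e3 := mul_le_mul_of_nonneg_left (hM S₁) (Real.rpow_nonneg h0 (1 / a))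
  have e4 := mul_le_mul_of_nonneg_left (hM S₂) (Real.rpow_nonneg h0 (1 / a))
  linarith

theorem capacity_lt_top_iff_uniformContinuous {α : ℝ≥0∞} (h1 : 1 < α) (ht : α < ⊤) :
    capacity α 𝒲 < ⊤ ↔ ∀ ε : ℝ, 0 < ε → ∃ δ : ℝ, 0 < δ ∧ ∀ P₁ P₂ : Prior 𝒲, dist P₁ P₂ < δ →
      tvDist (meanMeasure α P₁) (meanMeasure α P₂) < ε := by
  have ha1 : 1 < α.toReal := by
    simpa using (ENNReal.toReal_lt_toReal ENNReal.one_ne_top ht.ne).2 h1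
  rw [capacity_lt_top_iff, ← ENNReal.ofReal_toReal ht.ne]
  set a := α.toReal
  have ha0 : 0 < a := by linarith
  constructor
  · rintro ⟨B, hB⟩ ε hε
    have hM : ∀ P : Prior 𝒲, (mass a P).toReal ≤ Real.exp ((a - 1) / a * B) := fun P => by
      rw [mass_toReal_eq_exp ha0 ha1.ne']
      exact Real.exp_le_exp.2 (mul_le_mul_of_nonneg_left (hB P) (div_nonneg (by linarith) ha0.le))
    set M := Real.exp ((a - 1) / a * B)
    have hcont : ContinuousAt (fun d : ℝ => 2 * M * (d / 2) ^ (1 / a)) 0 :=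
      continuousAt_const.mul (ContinuousAt.rpow_const (by fun_prop) (Or.inr (by positivity)))
    obtain ⟨δ, hδ, h⟩ := Metric.continuousAt_iff.1 hcont ε hε
    refine ⟨min δ 2, lt_min hδ two_pos, fun P₁ P₂ hd => ?_⟩
    refine (tvDist_meanMeasure_le ha1.le hM (hd.trans_le (min_le_right _ _))).trans_lt ?_
    have := h (x := dist P₁ P₂) (by
      rw [Real.dist_eq, sub_zero, abs_of_nonneg dist_nonneg]
      exact hd.trans_le (min_le_left _ _))
    rw [zero_div, Real.zero_rpow (one_div_pos.2 ha0).ne', mul_zero, Real.dist_eq, sub_zero] at this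
    exact (le_abs_self _).trans_lt this
  · intro h
    rcases isEmpty_or_nonempty (Prior 𝒲) with hE | ⟨⟨P₀⟩⟩
    · exact ⟨0, fun P => (hE.false P).elim⟩
    obtain ⟨d, hd, hcont⟩ := h 1 one_pos
    set δ := min (d / 3) 1 with hδ
    have h0 : 0 < δ := lt_min (by positivity) one_pos
    have h1 : δ ≤ 1 := min_le_right _ _
    -- The mixture of P₀ with a fraction δ of P is within d of P₀, so δ^(1/a) times the mass of P is
    -- at most the mass of P₀ plus 1; test set for the norm: the whole space.
    refine ⟨a / (a - 1) * Real.log (((mass a P₀).toReal + 1) / δ ^ (1 / a)), fun P => ?_⟩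
    have e1 := hcont (mix P₀ P δ h0.le h1) P₀ ((dist_mix_le h0.le h1).trans_lt (by
      linarith [min_le_left (d / 3) 1]))
    have := isFiniteMeasure_meanMeasure ha0 P₀
    have := isFiniteMeasure_meanMeasure ha0 (mix P₀ P δ h0.le h1)
    have e2 := (sub_le_tvDist _ _).trans_lt e1
    have e3 := ENNReal.toReal_mono (mass_ne_top ha0 _)
      (rpow_mul_mass_le_mass_mix h0.le h1 (mix_weights (S := P₀) (S' := P) h0.le h1) ha0)
    rw [ENNReal.toReal_mul, ENNReal.ofReal_rpow_of_pos h0,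
      ENNReal.toReal_ofReal (Real.rpow_nonneg h0.le _)] at e3
    rw [renyiInfo_ofReal P ha0 ha1.ne']
    refine mul_le_mul_of_nonneg_left (Real.log_le_log (mass_toReal_pos P ha0) ?_)
      (div_nonneg ha0.le (by linarith))
    rw [le_div_iff₀ (by positivity), mul_comm]
    refine e3.trans ?_
    simp only [Measure.real] at e2
    simp only [mass]
    linarith

/-! ### Continuity in the order -/

theorem orderMargin_pos {η : ℝ} (hη : 0 < η) : 0 < orderMargin η := by
  unfold orderMargin
  split_ifs with h
  · positivity
  · exact div_pos (by linarith) (by positivity)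

theorem abs_renyiInfo_sub_le {η : ℝ≥0} (hη : 0 < η) {C : ℝ}
    (hC : ∀ P : Prior 𝒲, renyiInfo η P ≤ C) {ε : ℝ} (hε : 0 < ε) (hεη : ε ≤ orderMargin η)
    {α β : ℝ≥0} (hα : (α : ℝ) ∈ Icc ε (η - ε)) (hβ : (β : ℝ) ∈ Icc ε (η - ε)) (P : Prior 𝒲) :
    |renyiInfo α P - renyiInfo β P| ≤ orderConst η C / ε ^ 2 * |(α : ℝ) - β| := by
  have hC' := hC P
  rw [← ENNReal.ofReal_coe_nnreal] at hC'
  rw [← ENNReal.ofReal_coe_nnreal, ← ENNReal.ofReal_coe_nnreal]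
  exact abs_renyiInfo_sub_le_orderConst (NNReal.coe_pos.2 hη) hC' hε hεη hα hβ

theorem exists_lipschitzOnWith {η : ℝ≥0} (hη : 0 < η) {C : ℝ}
    (hC : ∀ P : Prior 𝒲, renyiInfo η P ≤ C) {K : Set ℝ≥0} (hK : IsCompact K) (hKη : K ⊆ Ioo 0 η) :
    ∃ L : ℝ≥0, ∀ P : Prior 𝒲, LipschitzOnWith L (fun α : ℝ≥0 => renyiInfo α P) K := by
  obtain ⟨ε, hε, hεη, hmem⟩ : ∃ ε : ℝ, 0 < ε ∧ ε ≤ orderMargin η ∧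
      ∀ α ∈ K, (α : ℝ) ∈ Icc ε (η - ε) := by
    have hm := orderMargin_pos (NNReal.coe_pos.2 hη)
    rcases K.eq_empty_or_nonempty with rfl | hne
    · exact ⟨_, hm, le_rfl, by simp⟩
    obtain ⟨p, hp, hpmin⟩ := hK.exists_isLeast hne
    obtain ⟨q, hq, hqmax⟩ := hK.exists_isGreatest hne
    have hp0 : (0 : ℝ) < p := NNReal.coe_pos.2 (hKη hp).1
    have hq0 : (q : ℝ) < η := NNReal.coe_lt_coe.2 (hKη hq).2
    refine ⟨min (orderMargin η) (min p (η - q)), lt_min hm (lt_min hp0 (by linarith)),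
      min_le_left _ _, fun α hα => ⟨?_, ?_⟩⟩
    · exact (min_le_right _ _).trans ((min_le_left _ _).trans (NNReal.coe_le_coe.2 (hpmin hα)))
    · have h1 : (α : ℝ) ≤ q := NNReal.coe_le_coe.2 (hqmax hα)
      have h2 : min (orderMargin η) (min p (η - q)) ≤ (η : ℝ) - q :=
        (min_le_right _ _).trans (min_le_right _ _)
      linarith
  refine ⟨(orderConst η C / ε ^ 2).toNNReal, fun P => LipschitzOnWith.of_dist_le_mul
    fun α hα β hβ => ?_⟩
  rw [Real.dist_eq, NNReal.dist_eq]
  refine (abs_renyiInfo_sub_le hη hC hε hεη (hmem α hα) (hmem β hβ) P).trans ?_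
  gcongr
  exact Real.le_coe_toNNReal _

/-! ### Finitely many probability measures -/

section Finite

variable [Finite 𝒲]

theorem renyiInfo_le_log_card (α : ℝ≥0∞) (P : Prior 𝒲) :
    renyiInfo α P ≤ Real.log (Nat.card 𝒲) := by
  have := Fintype.ofFinite 𝒲
  refine (renyiInfo_mono P le_top).trans ?_
  change renyiInfo ⊤ P ≤ _
  rw [renyiInfo_top]
  refine Real.log_le_log (massTop_pos P) ?_
  have h := ENNReal.toReal_mono (by simp) (massTop_le_card P)
  rw [ENNReal.toReal_natCast] at h
  refine h.trans (Nat.cast_le.2 ?_)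
  rw [Nat.card_eq_fintype_card]
  exact Finset.card_le_univ _

theorem bddAbove_renyiInfo (α : ℝ≥0∞) : BddAbove (range fun P : Prior 𝒲 => renyiInfo α P) :=
  ⟨_, by rintro _ ⟨P, rfl⟩; exact renyiInfo_le_log_card α P⟩

theorem iSup_renyiInfo_mono : Monotone fun α : ℝ≥0∞ => ⨆ P : Prior 𝒲, renyiInfo α P :=
  fun _ β h => ciSup_mono (bddAbove_renyiInfo β) fun P => renyiInfo_mono P h

variable [Nonempty (Prior 𝒲)]

theorem capacity_eq_coe_iSup (α : ℝ≥0∞) :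
    capacity α 𝒲 = ((⨆ P : Prior 𝒲, renyiInfo α P : ℝ) : EReal) := by
  have hlt : capacity α 𝒲 < ⊤ := capacity_lt_top_iff.2 ⟨_, renyiInfo_le_log_card α⟩
  refine le_antisymm (iSup_le fun P => EReal.coe_le_coe_iff.2 (le_ciSup (bddAbove_renyiInfo α) P)) ?_
  obtain ⟨P₀⟩ := ‹Nonempty (Prior 𝒲)›
  have hbot : capacity α 𝒲 ≠ ⊥ := fun h => EReal.coe_ne_bot (renyiInfo α P₀) (le_bot_iff.1
    (h ▸ le_iSup (fun P : Prior 𝒲 => (renyiInfo α P : EReal)) P₀))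
  rw [← EReal.coe_toReal hlt.ne hbot, EReal.coe_le_coe_iff]
  exact ciSup_le (renyiInfo_le_toReal_capacity hlt)

/-- The constant L for T = 𝒲 is the same for all priors, so the bound near order zero passes to the
supremum. -/
theorem continuousAt_iSup_renyiInfo_zero :
    ContinuousAt (fun α : ℝ≥0∞ => ⨆ P : Prior 𝒲, renyiInfo α P) 0 := by
  have := Fintype.ofFinite 𝒲
  obtain ⟨L, -, hL⟩ := exists_renyiInfo_le_zero_add (Finset.univ : Finset 𝒲)
  set f := fun α : ℝ≥0∞ => ⨆ P : Prior 𝒲, renyiInfo α P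
  have hlim : Tendsto (fun α : ℝ≥0∞ => (f 0 + α.toReal * L) / (1 - α.toReal)) (𝓝 0) (𝓝 (f 0)) := by
    have h1 : ContinuousAt (fun a : ℝ => (f 0 + a * L) / (1 - a)) 0 := by
      apply ContinuousAt.div <;> [fun_prop; fun_prop; norm_num]
    have h2 := ENNReal.tendsto_toReal ENNReal.zero_ne_top
    rw [ENNReal.toReal_zero] at h2
    simpa [Function.comp_def] using h1.tendsto.comp h2
  refine tendsto_of_tendsto_of_tendsto_of_le_of_le' tendsto_const_nhds hlim
    (Eventually.of_forall fun α => iSup_renyiInfo_mono zero_le) ?_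
  filter_upwards [Iio_mem_nhds (zero_lt_one (α := ℝ≥0∞))] with α hα
  rcases eq_or_ne α 0 with rfl | h0
  · simp
  have ht := (lt_trans hα ENNReal.one_lt_top).ne
  have ha0 := ENNReal.toReal_pos h0 ht
  have ha1 : α.toReal < 1 := by
    simpa using (ENNReal.toReal_lt_toReal ht ENNReal.one_ne_top).2 hα
  refine ciSup_le fun P => ?_
  have h1 := hL P (Finset.subset_univ _) α.toReal ha0 ha1
  rw [ENNReal.ofReal_toReal ht] at h1
  have h2 : renyiInfo 0 P ≤ f 0 := le_ciSup (bddAbove_renyiInfo 0) P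
  rw [le_div_iff₀ (by linarith), mul_comm]
  linarith

/-- The upper estimate is monotonicity; the lower one holds because a single nearly optimal prior
has converging information. -/
theorem continuousAt_iSup_renyiInfo_top :
    ContinuousAt (fun α : ℝ≥0∞ => ⨆ P : Prior 𝒲, renyiInfo α P) ⊤ := by
  refine tendsto_order.2 ⟨fun x hx => ?_, fun x hx => Eventually.of_forall fun α =>
    (iSup_renyiInfo_mono le_top).trans_lt hx⟩
  obtain ⟨P, hP⟩ := exists_lt_of_lt_ciSup hx
  obtain ⟨b, hb⟩ := ((tendsto_renyiInfo_top P).eventually (lt_mem_nhds hP)).exists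
  filter_upwards [lt_mem_nhds (ENNReal.ofReal_lt_top (r := b))] with α hα
  exact hb.trans_le ((renyiInfo_mono P hα.le).trans (le_ciSup (bddAbove_renyiInfo α) P))

theorem continuousAt_iSup_renyiInfo_of_pos {a : ℝ≥0} (ha : 0 < a) :
    ContinuousAt (fun α : ℝ≥0∞ => ⨆ P : Prior 𝒲, renyiInfo α P) a := by
  have ha' : (0 : ℝ) < a := NNReal.coe_pos.2 ha
  set η : ℝ≥0 := a + 1 with hη
  have hη0 : 0 < η := by positivity
  have hηa : (η : ℝ) = a + 1 := by rw [hη]; push_cast; rfl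
  -- With η = a + 1 this choice puts [a/2, a + 1/2] inside [ε, η - ε].
  set ε : ℝ := min (orderMargin η) (min (a / 2) (1 / 2)) with hε
  have hε0 : 0 < ε := lt_min (orderMargin_pos (NNReal.coe_pos.2 hη0))
    (lt_min (by positivity) (by norm_num))
  have hε1 : ε ≤ a / 2 := (min_le_right _ _).trans (min_le_left _ _)
  have hε2 : ε ≤ 1 / 2 := (min_le_right _ _).trans (min_le_right _ _)
  set C := Real.log (Nat.card 𝒲)
  have htend : Tendsto (fun α : ℝ≥0∞ => α.toReal) (𝓝 a) (𝓝 a) :=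
    ENNReal.tendsto_toReal ENNReal.coe_ne_top
  have hbound : Tendsto (fun α : ℝ≥0∞ => orderConst η C / ε ^ 2 * |α.toReal - a|) (𝓝 a) (𝓝 0) := by
    have h : Continuous fun t : ℝ => orderConst η C / ε ^ 2 * |t - a| := by fun_prop
    simpa [Function.comp_def] using (h.tendsto (a : ℝ)).comp htend
  refine tendsto_iff_dist_tendsto_zero.2 (squeeze_zero' (Eventually.of_forall fun _ => dist_nonneg)
    ?_ hbound)
  filter_upwards [htend.eventually (Icc_mem_nhds (show (a : ℝ) / 2 < a by linarith)
    (show (a : ℝ) < a + 1 / 2 by linarith)), Iio_mem_nhds ENNReal.coe_lt_top] with α hα ht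
  lift α to ℝ≥0 using ne_of_lt ht
  rw [ENNReal.coe_toReal] at hα ⊢
  have key := abs_renyiInfo_sub_le (𝒲 := 𝒲) hη0 (renyiInfo_le_log_card η) hε0 (min_le_left _ _)
    (α := α) (β := a) ⟨by linarith [hα.1], by linarith [hα.2]⟩ ⟨by linarith, by linarith⟩
  rw [Real.dist_eq, abs_le]
  constructor
  · have : (⨆ P : Prior 𝒲, renyiInfo a P) ≤
        (⨆ P : Prior 𝒲, renyiInfo α P) + orderConst η C / ε ^ 2 * |(α : ℝ) - a| :=
      ciSup_le fun P => by
        linarith [(abs_le.1 (key P)).1, le_ciSup (bddAbove_renyiInfo (α : ℝ≥0∞)) P]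
    linarith
  · have : (⨆ P : Prior 𝒲, renyiInfo α P) ≤
        (⨆ P : Prior 𝒲, renyiInfo a P) + orderConst η C / ε ^ 2 * |(α : ℝ) - a| :=
      ciSup_le fun P => by
        linarith [(abs_le.1 (key P)).2, le_ciSup (bddAbove_renyiInfo (a : ℝ≥0∞)) P]
    linarith

theorem continuous_capacity : Continuous fun α : ℝ≥0∞ => capacity α 𝒲 := by
  simp only [capacity_eq_coe_iSup]
  refine continuous_coe_real_ereal.comp (continuous_iff_continuousAt.2 fun α => ?_)
  rcases eq_or_ne α ⊤ with rfl | ht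
  · exact continuousAt_iSup_renyiInfo_top
  lift α to ℝ≥0 using ht
  rcases eq_or_ne α 0 with rfl | h0
  · exact continuousAt_iSup_renyiInfo_zero
  · exact continuousAt_iSup_renyiInfo_of_pos (pos_iff_ne_zero.2 h0)

end Finite

end RenyiCapacity

theorem mainTheorem3 {Y : Type*} [MeasurableSpace Y] (𝒲 : Set (ProbabilityMeasure Y)) :
    -- finiteness of the capacity and the norm of the mean measure, orders in (0,1)
    (∀ α : ℝ≥0∞, 0 < α → α < 1 →
      (RenyiCapacity.capacity α 𝒲 = ⊤ ↔
        ∃ P : ℕ → RenyiCapacity.Prior 𝒲,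
          Tendsto (fun n => RenyiCapacity.meanMeasure α (P n) univ) atTop (𝓝 0))) ∧
    -- finiteness of the capacity and the norm of the mean measure, orders in (1,∞]
    (∀ α : ℝ≥0∞, 1 < α →
      (RenyiCapacity.capacity α 𝒲 = ⊤ ↔
        ∃ P : ℕ → RenyiCapacity.Prior 𝒲,
          Tendsto (fun n => RenyiCapacity.meanMeasure α (P n) univ) atTop (𝓝 ⊤))) ∧
    -- uniform continuity of the mean measure in the prior, orders in (1,∞)
    (∀ α : ℝ≥0∞, 1 < α → α < ⊤ →
      (RenyiCapacity.capacity α 𝒲 < ⊤ ↔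
        ∀ ε : ℝ, 0 < ε → ∃ δ : ℝ, 0 < δ ∧ ∀ P₁ P₂ : RenyiCapacity.Prior 𝒲, dist P₁ P₂ < δ →
          RenyiCapacity.tvDist (RenyiCapacity.meanMeasure α P₁)
            (RenyiCapacity.meanMeasure α P₂) < ε)) ∧
    -- continuity of the information in the prior, orders in [1,∞), and one direction at ∞
    (∀ α : ℝ≥0∞, 1 ≤ α → α < ⊤ →
      (RenyiCapacity.capacity α 𝒲 < ⊤ ↔
        Continuous fun P : RenyiCapacity.Prior 𝒲 => RenyiCapacity.renyiInfo α P)) ∧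
    ((Continuous fun P : RenyiCapacity.Prior 𝒲 => RenyiCapacity.renyiInfo ⊤ P) →
      RenyiCapacity.capacity ⊤ 𝒲 < ⊤) ∧
    -- uniform equicontinuity in the prior, with the explicit modulus
    (∀ η : ℝ≥0, RenyiCapacity.capacity η 𝒲 < ⊤ →
      UniformEquicontinuous (fun (α : Icc (0 : ℝ≥0∞) η) (P : RenyiCapacity.Prior 𝒲) =>
        RenyiCapacity.renyiInfo α P) ∧
      ∀ α : ℝ≥0∞, α ≤ η → ∀ P₁ P₂ : RenyiCapacity.Prior 𝒲,
        |RenyiCapacity.renyiInfo α P₂ - RenyiCapacity.renyiInfo α P₁| ≤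
          RenyiCapacity.priorModulus η (RenyiCapacity.capacity η 𝒲).toReal (dist P₁ P₂ / 2)) ∧
    -- uniform equicontinuity and uniform Lipschitz continuity in the order
    (∀ η : ℝ≥0, 0 < η → RenyiCapacity.capacity η 𝒲 < ⊤ →
      (∀ K : Set ℝ≥0, IsCompact K → K ⊆ Ioo 0 η →
        UniformEquicontinuousOn (fun (P : RenyiCapacity.Prior 𝒲) (α : ℝ≥0) =>
          RenyiCapacity.renyiInfo α P) K ∧
        ∃ L : ℝ≥0, ∀ P : RenyiCapacity.Prior 𝒲,
          LipschitzOnWith L (fun α : ℝ≥0 => RenyiCapacity.renyiInfo α P) K) ∧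
      ∀ ε : ℝ, 0 < ε → ε ≤ RenyiCapacity.orderMargin η →
        ∀ α β : ℝ≥0, (α : ℝ) ∈ Icc ε (η - ε) → (β : ℝ) ∈ Icc ε (η - ε) →
          ∀ P : RenyiCapacity.Prior 𝒲,
            |RenyiCapacity.renyiInfo α P - RenyiCapacity.renyiInfo β P| ≤
              RenyiCapacity.orderConst η (RenyiCapacity.capacity η 𝒲).toReal / ε ^ 2 *
                |(α : ℝ) - β|) ∧
    -- finitely many probability measures: the capacity as a function of the order
    (𝒲.Finite →
      (Monotone fun α : ℝ≥0∞ => RenyiCapacity.capacity α 𝒲) ∧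
      Continuous fun α : ℝ≥0∞ => RenyiCapacity.capacity α 𝒲) := by
  open RenyiCapacity in
  refine ⟨fun α h0 h1 => capacity_eq_top_iff_tendsto_zero h0 h1,
    fun α h1 => capacity_eq_top_iff_tendsto_top h1,
    fun α h1 ht => capacity_lt_top_iff_uniformContinuous h1 ht,
    fun α h1 ht => ⟨continuous_renyiInfo ht, capacity_lt_top_of_continuous h1⟩,
    capacity_lt_top_of_continuous le_top,
    fun η h => ⟨uniformEquicontinuous_renyiInfo h, fun α hα P₁ P₂ =>
      abs_renyiInfo_sub_le_priorModulus (renyiInfo_le_toReal_capacity h) hα P₁ P₂⟩,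
    fun η hη h => ⟨fun K hK hKη => ?_, fun ε hε hεη α β hα hβ P =>
      abs_renyiInfo_sub_le hη (renyiInfo_le_toReal_capacity h) hε hεη hα hβ P⟩,
    fun hfin => ⟨capacity_mono, ?_⟩⟩
  · obtain ⟨L, hL⟩ := exists_lipschitzOnWith hη (renyiInfo_le_toReal_capacity h) hK hKη
    exact ⟨LipschitzOnWith.uniformEquicontinuousOn _ L hL, L, hL⟩
  · have := hfin.to_subtype
    -- Without priors the capacity is an empty supremum, constant in the order.
    rcases isEmpty_or_nonempty (Prior 𝒲) with hE | hne
    · simp only [capacity, iSup_of_empty]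
      exact continuous_const
    · exact continuous_capacity
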